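/- Let $D\subset\mathbb{R}^n$ be open, let $f:D\to\mathbb{R}^n$ be of class $C^r$, $2\le r\le\infty$, and let $\varphi:\mathbb{R}\to D$ be a non-constant $T$-periodic solution ($T>0$) of $\dot z=f(z)$. Suppose that $\varphi$ is hyperbolic: the derivative at the fixed point of a Poincaré map of $\varphi$ (the map that sends a point of a hyperplane section transverse to the orbit at a point of it to its return to the section after a time close to $T$) has no eigenvalue of modulus one. Let $d$ be the antiperiodicity index (A-index) of the first variational equation $\dot y=Df(\varphi(t))y$, that is, the sum of the sizes of those Jordan blocks with a real negative eigenvalue that occur an odd number of times (each counted only once) in the Jordan normal form of a monodromy matrix $\Phi(0)^{-1}\Phi(T)$, where $\Phi$ is a fundamental matrix solution. Then $d\le n-1$, and there are a function $U:\mathbb{R}\to\mathbb{R}^{n\times(n-1)}$ with $$U(t+T)=U(t)\,[I_{n-d-1}\oplus(-I_d)]\qquad(t\in\mathbb{R}),$$ real matrices $H_1\in\mathbb{R}^{(n-d-1)\times(n-d-1)}$ and $H_2\in\mathbb{R}^{d\times d}$, functions $\Lambda_0,\Lambda_1,\Lambda_2$ of $(s,v,w)\in\mathbb{R}\times\mathbb{R}^{n-d-1}\times\mathbb{R}^{d}$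 with values in $\mathbb{R}$, $\mathbb{R}^{n-d-1}$, $\mathbb{R}^d$, and constants $\varepsilon>0$, $C>0$ such that the map $$(s,v,w)\mapsto z=\varphi(s)+U(s)\begin{bmatrix}v\\ w\end{bmatrix}$$ is of class $C^r$ and, for $\|(v,w)\|<\varepsilon$, has values in $D$ and invertible derivative, and such that the following holds. For every $I\subset\mathbb{R}$ and every $g:I\times D\to\mathbb{R}^n$ of class $C^r$ there are functions $\tilde\Lambda_0,\tilde\Lambda_1,\tilde\Lambda_2$ of $(t,s,v,w)$, with values in $\mathbb{R}$, $\mathbb{R}^{n-d-1}$, $\mathbb{R}^d$, such that for $\|(v,w)\|<\varepsilon$ this change of variables transforms $\dot z=f(z)+g(t,z)$ into $$\begin{aligned}\dot s&=1+\Lambda_0(s,v,w)+\tilde\Lambda_0(t,s,v,w),\\ \dot v&=H_1v+\Lambda_1(s,v,w)+\tilde\Lambda_1(t,s,v,w),\\ \dot w&=H_2w+\Lambda_2(s,v,w)+\tilde\Lambda_2(t,s,v,w)\end{aligned}$$ (a continuous curve $(s,v,w)(t)$ with $\|(v,w)(t)\|<\varepsilon$ solves this system if and only if its image $z(t)$ solves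 $\dot z=f(z)+g(t,z)$). Moreover, for all $t\in I$, $s\in\mathbb{R}$ and $\|(v,w)\|<\varepsilon$: (i) if $\lambda_1,\dots,\lambda_{n-1}\in\mathbb{C}$ are the eigenvalues, with multiplicity, of the derivative of the Poincaré map of $\varphi$ (for any section), then the real parts of the eigenvalues of $H_1\oplus H_2$, with multiplicity, are $\frac1T\log|\lambda_\ell|$, $\ell=1,\dots,n-1$; (ii) $\Lambda_\ell(s,0,0)=0$ and $\frac{\partial\Lambda_\ell}{\partial(v,w)}(s,0,0)=0$ for $\ell\in\{0,1,2\}$; (iii) $\Lambda_\ell(s+T,v,w)=\Lambda_\ell(s,v,-w)$ and $\tilde\Lambda_\ell(t,s+T,v,w)=\tilde\Lambda_\ell(t,s,v,-w)$ for $\ell\in\{0,1\}$; (iv) $\Lambda_2(s+T,v,w)=-\Lambda_2(s,v,-w)$ and $\tilde\Lambda_2(t,s+T,v,w)=-\tilde\Lambda_2(t,s,v,-w)$; (v) $\|\tilde\Lambda_\ell(t,s,v,w)\|\le C\,\Big\|g\Big(t,\varphi(s)+U(s)\begin{bmatrix}v\\ w\end{bmatrix}\Big)\Big\|$ for $\ell\in\{0,1,2\}$.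 -/

import Mathlib

open scoped Topology Matrix

/-- `A` is the coefficient matrix of a linear system `x' = A(t) x`; `Φ` is a fundamental matrix
solution of it: a matrix solution on the whole line (entry by entry) that is everywhere
invertible. -/
def IsFundamentalMatrix {n : ℕ} (A Φ : ℝ → Matrix (Fin n) (Fin n) ℝ) : Prop :=
  (∀ t i j, HasDerivAt (fun τ => Φ τ i j) ((A t * Φ t) i j) t) ∧ ∀ t, IsUnit (Φ t)

/-- The Jordan block of size `k` with eigenvalue `μ`: `μ` on the diagonal, `1` just above it. -/
def jordanBlock (μ : ℂ) (k : ℕ) : Matrix (Fin k) (Fin k) ℂ :=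
  Matrix.of fun i j => if i = j then μ else if (i : ℕ) + 1 = (j : ℕ) then 1 else 0

/-- The block diagonal matrix whose diagonal blocks are the Jordan blocks with the listed
eigenvalues and sizes. -/
def jordanMatrix (l : List (ℂ × ℕ)) :
    Matrix (Σ i : Fin l.length, Fin (l.get i).2) (Σ i : Fin l.length, Fin (l.get i).2) ℂ :=
  Matrix.blockDiagonal' fun i => jordanBlock (l.get i).1 (l.get i).2

/-- The list `l` of pairs (eigenvalue, size) lists, with repetition, the blocks of a Jordan normal
form of the real matrix `M`, taken over `ℂ`. -/
def IsJordanForm {n : ℕ} (M : Matrix (Fin n) (Fin n) ℝ) (l : List (ℂ × ℕ)) : Prop :=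
  (∀ b ∈ l, 0 < b.2) ∧
    ∃ (P : Matrix (Fin n) (Σ i : Fin l.length, Fin (l.get i).2) ℂ)
      (Q : Matrix (Σ i : Fin l.length, Fin (l.get i).2) (Fin n) ℂ),
      P * Q = 1 ∧ Q * P = 1 ∧ M.map (algebraMap ℝ ℂ) = P * jordanMatrix l * Q

open Classical in
/-- The sum of the sizes of those blocks in the list `l` that have a real negative eigenvalue and
occur an odd number of times in `l`, each such block being counted only once. -/
noncomputable def oddNegativeSize (l : List (ℂ × ℕ)) : ℕ :=
  ∑ b ∈ l.toFinset with (b.1.im = 0 ∧ b.1.re < 0) ∧ Odd (l.count b), b.2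

/-- `d` is the value of the antiperiodicity index of the `T`-periodic system `x' = A(t) x`,
computed from a Jordan normal form of a monodromy matrix `Φ(0)⁻¹ Φ(T)`. -/
def IsAIndex {n : ℕ} (A : ℝ → Matrix (Fin n) (Fin n) ℝ) (T : ℝ) (d : ℕ) : Prop :=
  ∃ (Φ : ℝ → Matrix (Fin n) (Fin n) ℝ) (l : List (ℂ × ℕ)),
    IsFundamentalMatrix A Φ ∧ IsJordanForm ((Φ 0)⁻¹ * Φ T) l ∧ d = oddNegativeSize l

/-- The antiperiodicity index (A-index) of the `T`-periodic linear system `x' = A(t) x`: the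
number `d` with `IsAIndex A T d`. (It exists and is unique when `A` is continuous.) -/
noncomputable def aIndex {n : ℕ} (A : ℝ → Matrix (Fin n) (Fin n) ℝ) (T : ℝ) : ℕ :=
  Classical.epsilon fun d => IsAIndex A T d

/-- The coefficient matrix `Df(φ(t))` of the first variational equation of `z' = f(z)` along
`φ`. -/
noncomputable def variationalMatrix {n : ℕ} (f : (Fin n → ℝ) → (Fin n → ℝ))
    (φ : ℝ → (Fin n → ℝ)) (t : ℝ) : Matrix (Fin n) (Fin n) ℝ :=
  LinearMap.toMatrix' (fderiv ℝ f (φ t) : (Fin n → ℝ) →ₗ[ℝ] (Fin n → ℝ))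

/-- `φ` is a non-trivial (that is, non-constant) `T`-periodic solution in `D` of `z' = f(z)`. -/
structure IsPeriodicOrbit {n : ℕ} (f : (Fin n → ℝ) → (Fin n → ℝ)) (D : Set (Fin n → ℝ))
    (φ : ℝ → (Fin n → ℝ)) (T : ℝ) : Prop where
  pos : 0 < T
  mem : ∀ t, φ t ∈ D
  solution : IsIntegralCurve φ fun _ => f
  periodic : Function.Periodic φ T
  nontrivial : ∃ t, φ t ≠ φ 0

/-- `P` is a Poincaré map of the `T`-periodic orbit `φ` of `z' = f(z)` at the point `φ s₀`, for
the cross-section `φ s₀ + K`, where `K` is a hyperplane through the origin transverse to the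
velocity `f (φ s₀)` of the orbit. The map is written in the coordinate `h ∈ K` of the section: for
`h` near `0`, the solution starting at `φ s₀ + h` stays in `D` and is at `φ s₀ + P h` at the return
time `τ h`, where `τ` is continuous at `0` and `τ 0 = T`.

These conditions determine `P` near `0`. If `T` is the minimal period, `P` is the first return map
to a small piece of the section. -/
def IsPoincareMap {n : ℕ} (f : (Fin n → ℝ) → (Fin n → ℝ)) (D : Set (Fin n → ℝ))
    (φ : ℝ → (Fin n → ℝ)) (T s₀ : ℝ) (K : Submodule ℝ (Fin n → ℝ)) (P : K → K) : Prop :=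
  IsCompl K (Submodule.span ℝ {f (φ s₀)}) ∧
    ∃ τ : K → ℝ, ContinuousAt τ 0 ∧ τ 0 = T ∧
      ∀ᶠ h : K in 𝓝 0, ∃ γ : ℝ → (Fin n → ℝ),
        γ 0 = φ s₀ + (h : Fin n → ℝ) ∧
        (∀ t ∈ Set.Icc 0 (τ h), γ t ∈ D) ∧
        IsIntegralCurveOn γ (fun _ => f) (Set.Icc 0 (τ h)) ∧
        γ (τ h) = φ s₀ + (P h : Fin n → ℝ)

/-- The `T`-periodic orbit `φ` is hyperbolic: the derivative of its Poincaré map at the fixed point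
has no complex eigenvalue of modulus one. (The eigenvalues do not depend on the section.) -/
def IsHyperbolicOrbit {n : ℕ} (f : (Fin n → ℝ) → (Fin n → ℝ)) (D : Set (Fin n → ℝ))
    (φ : ℝ → (Fin n → ℝ)) (T : ℝ) : Prop :=
  ∃ (s₀ : ℝ) (K : Submodule ℝ (Fin n → ℝ)) (P : K → K) (A : K →L[ℝ] K),
    IsPoincareMap f D φ T s₀ K P ∧ HasFDerivAt P A 0 ∧
      ∀ μ ∈ (A : K →ₗ[ℝ] K).charpoly.aroots ℂ, ‖μ‖ ≠ 1

/-- The coordinates along the orbit: `(s, v, w) ↦ φ(s) + U(s) (v, w)`, where `U(s)` is a matrix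
whose columns are indexed by the `m` coordinates of `v` followed by the `d` coordinates of `w`. -/
noncomputable def orbitCoord {n m d : ℕ} (φ : ℝ → (Fin n → ℝ))
    (U : ℝ → Matrix (Fin n) (Fin m ⊕ Fin d) ℝ)
    (p : ℝ × (Fin m → ℝ) × (Fin d → ℝ)) : Fin n → ℝ :=
  φ p.1 + U p.1 *ᵥ Sum.elim p.2.1 p.2.2

/-! Put `M = Φ(0)⁻¹ Φ(T)`. The velocity `f(φ(t))` solves the variational equation, so it gives `M`
the eigenvalue `1`. A first-order expansion of the flow (`flow_expansion`) shows that the derivative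
of a Poincaré map is the compression of the monodromy operator to the section. Hence the
characteristic polynomial of `M` is `X - 1` times that of this derivative, for every section
(`IsPoincareMap.exists_hasFDerivAt_charpoly`). Hyperbolicity makes the eigenvalue `1` of `M` simple,
so the velocity splits off and leaves an invertible real matrix `B` of size `n - 1`.

Real Floquet theory then says that `B` is similar to `exp L₁ ⊕ (-exp L₂)` with `L₂` of size `d`
(`exists_matSim_exp_neg_exp`). A real matrix without eigenvalues in `(-∞, 0]` has a real logarithm.
Two equal Jordan blocks with a negative eigenvalue have a common real logarithm, because the sign
`-1` is a rotation by `π` in the doubled space. What remains is one copy of each negative block of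
odd multiplicity, of total size `d`, and minus this remainder is an exponential. The multiplicities
can be read off from any Jordan form, since they are determined by the nullities of `(M - x)^j`.

Let the columns of `S` span the `M`-invariant complement of the eigenvector, and let `H = (L₁ ⊕ L₂)
/ T`. The frame `U(t) = Φ(t) S exp(-tH)` satisfies `U(t + T) = U(t) [I ⊕ (-I)]` and `U' = Df(φ) U -
U H`. For `X(s, h) = φ(s) + U(s) h` the second identity gives `DX(s, h)(1, H h) = f(φ(s)) + Df(φ(s))
U(s) h`. So the pullback of `f`, minus `(1, H h)`, is `DX⁻¹` applied to the Taylor remainder of `f`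
along the orbit, and it vanishes to second order. The terms with a tilde are the pullback of `g`,
bounded by the norm of `DX⁻¹`. The relation `X(s + T, v, w) = X(s, v, -w)` yields the symmetries
and, with compactness of one period, the uniform `ε` and `C` (`exists_tube`). `U` has class `C^r`
although `Df(φ)` has only class `C^(r-1)`, because solving a linear equation gains a derivative. -/

/-! ### Logarithms in real Banach algebras. -/

section Logarithm

open Polynomial

/-- In a commutative real Banach algebra, an element joined to `1` by a segment of units is an
exponential. -/
theorem exists_exp_eq_of_segment {𝔸 : Type*} [NormedCommRing 𝔸] [NormedAlgebra ℝ 𝔸]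
    [CompleteSpace 𝔸] (a : 𝔸) (ha : ∀ t ∈ Set.Icc (0 : ℝ) 1, IsUnit (1 + t • (a - 1))) :
    ∃ L : 𝔸, NormedSpace.exp L = a := by
  let F : ℝ → 𝔸 := fun t => 1 + t • (a - 1)
  -- The logarithmic derivative `F' F⁻¹` of the segment. Clamping the time to `[0, 1]`, where `F` is
  -- invertible, makes it continuous on the whole line.
  let h : ℝ → 𝔸 := fun t =>
    (a - 1) * Ring.inverse (F (Set.projIcc (0 : ℝ) 1 zero_le_one t))
  have hcont : Continuous h := by
    refine continuous_const.mul ?_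
    rw [continuous_iff_continuousAt]
    intro t
    obtain ⟨u, hu⟩ := ha _ (Set.projIcc (0 : ℝ) 1 zero_le_one t).2
    have h1 : ContinuousAt (Ring.inverse : 𝔸 → 𝔸)
        (F (Set.projIcc (0 : ℝ) 1 zero_le_one t)) := by
      change ContinuousAt _ (1 + _)
      rw [← hu]
      exact NormedRing.inverse_continuousAt u
    have h2 : Continuous fun t : ℝ => F (Set.projIcc (0 : ℝ) 1 zero_le_one t) := by
      have : Continuous fun t : ℝ => ((Set.projIcc (0 : ℝ) 1 zero_le_one t : Set.Icc (0:ℝ) 1) : ℝ) :=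
        continuous_subtype_val.comp continuous_projIcc
      exact continuous_const.add (this.smul continuous_const)
    exact ContinuousAt.comp (f := fun t : ℝ => F (Set.projIcc (0 : ℝ) 1 zero_le_one t)) h1
      h2.continuousAt
  let L : ℝ → 𝔸 := fun s => ∫ t in (0 : ℝ)..s, h t
  have hL : ∀ s, HasDerivAt L (h s) s := fun s => hcont.integral_hasStrictDerivAt 0 s |>.hasDerivAt
  -- `G` has derivative zero on the segment, so the primitive `L` of the logarithmic derivative is a
  -- logarithm of `F`.
  let G : ℝ → 𝔸 := fun s => NormedSpace.exp (-L s) * F s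
  have hF : ∀ s, HasDerivAt F (a - 1) s := by
    intro s
    have := ((hasDerivAt_id s).smul_const (a - 1)).const_add 1
    rw [one_smul] at this
    exact this
  have hE : ∀ s, HasDerivAt (fun s => NormedSpace.exp (-L s))
      (NormedSpace.exp (-L s) * (- h s)) s := by
    intro s
    have := (hasFDerivAt_exp (𝕂 := ℝ) (x := -L s)).comp_hasDerivAt s (hL s).fun_neg
    exact this
  have hG : ∀ s, HasDerivAt G (NormedSpace.exp (-L s) * (- h s) * F s +
      NormedSpace.exp (-L s) * (a - 1)) s := fun s => (hE s).mul (hF s)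
  have key := constant_of_has_deriv_right_zero (f := G) (a := 0) (b := 1)
    (fun s _ => (hG s).continuousAt.continuousWithinAt) (fun s hs => by
      have h0 := hG s
      have hs' : s ∈ Set.Icc (0 : ℝ) 1 := ⟨hs.1, hs.2.le⟩
      have : h s * F s = a - 1 := by
        simp only [h]
        rw [Set.projIcc_of_mem zero_le_one hs', mul_assoc, Ring.inverse_mul_cancel _ (ha s hs'),
          mul_one]
      have e : NormedSpace.exp (-L s) * (- h s) * F s + NormedSpace.exp (-L s) * (a - 1) = 0 := by
        rw [← this]; ring
      rw [e] at h0
      exact h0.hasDerivWithinAt) 1 ⟨zero_le_one, le_rfl⟩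
  have hL0 : L 0 = 0 := by simp [L]
  have hexp : NormedSpace.exp (-L 1) * a = 1 := by
    simpa [G, F, hL0] using key
  let _ : NormedAlgebra ℚ 𝔸 := NormedAlgebra.restrictScalars ℚ ℝ 𝔸
  refine ⟨L 1, ?_⟩
  calc NormedSpace.exp (L 1) = NormedSpace.exp (L 1) * (NormedSpace.exp (-L 1) * a) := by
        rw [hexp, mul_one]
    _ = a := by
        rw [← mul_assoc, ← NormedSpace.exp_add_of_commute (Commute.all _ _)]
        simp

/-- An element of an algebra killed by a polynomial `q` differs by a unit from every scalar that
is not a root of `q`; the inverse lies in every subalgebra containing the element. -/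
theorem isUnit_sub_algebraMap_of_aeval_eq_zero {K A : Type*} [Field K] [Ring A] [Algebra K A]
    {a : A} {q : K[X]} (hq : aeval a q = 0) {x : K} (hx : q.eval x ≠ 0) :
    IsUnit (a - algebraMap K A x) := by
  have h1 : (X - C x) ∣ q - C (q.eval x) := by
    rw [dvd_iff_isRoot]; simp
  obtain ⟨r, hr⟩ := h1
  have h2 : (a - algebraMap K A x) * aeval a r = - algebraMap K A (q.eval x) := by
    have := congrArg (aeval a) hr
    simp only [map_sub, hq, aeval_C, map_mul, aeval_X, zero_sub] at this
    exact this.symm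
  have h3 : aeval a r * (a - algebraMap K A x) = - algebraMap K A (q.eval x) := by
    rw [mul_comm] at hr
    have := congrArg (aeval a) hr
    simp only [map_sub, hq, aeval_C, map_mul, aeval_X, zero_sub] at this
    exact this.symm
  have hc : algebraMap K A (q.eval x)⁻¹ * algebraMap K A (q.eval x) = 1 := by
    rw [← map_mul, inv_mul_cancel₀ hx, map_one]
  refine ⟨⟨a - algebraMap K A x, - (algebraMap K A (q.eval x)⁻¹ * aeval a r), ?_, ?_⟩, rfl⟩
  · rw [mul_neg, ← mul_assoc, ← Algebra.commutes, mul_assoc, h2, mul_neg, hc, neg_neg]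
  · rw [neg_mul, mul_assoc, h3, mul_neg, hc, neg_neg]

/-- An element of a real Banach algebra killed by a polynomial without roots in `(-∞, 0]` is an
exponential. -/
theorem exists_exp_eq_of_aeval {𝔸 : Type*} [NormedRing 𝔸] [NormedAlgebra ℝ 𝔸]
    [CompleteSpace 𝔸] (a : 𝔸) (q : ℝ[X]) (hq : aeval a q = 0)
    (hroot : ∀ x ≤ 0, q.eval x ≠ 0) : ∃ L : 𝔸, NormedSpace.exp L = a := by
  -- The closed subalgebra generated by `a` is commutative and complete. The inverses needed along
  -- the segment are polynomials in `a`, so they stay in it.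
  let S := Algebra.elemental ℝ a
  have : IsClosed (S : Set 𝔸) := Algebra.elemental.isClosed ℝ a
  have : CompleteSpace S := this.completeSpace_coe
  let b : S := ⟨a, Algebra.elemental.self_mem ℝ a⟩
  have hb : aeval b q = 0 := by
    apply Subtype.val_injective
    have := Polynomial.aeval_algHom_apply S.val b q
    exact this.symm.trans hq
  let _ : NormedCommRing S := { (inferInstance : NormedRing S) with mul_comm := mul_comm }
  obtain ⟨L, hL⟩ := exists_exp_eq_of_segment b (fun t ht => by
    rcases eq_or_lt_of_le ht.1 with h0 | h0
    · simp [← h0]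
    -- `1 + t (b - 1) = t (b - (t - 1) / t)`, and the scalar subtracted from `b` lies in `(-∞, 0]`,
    -- where `q` has no root.
    · have hx : (t - 1) / t ≤ 0 := div_nonpos_of_nonpos_of_nonneg (by linarith [ht.2]) h0.le
      have h1 := isUnit_sub_algebraMap_of_aeval_eq_zero hb (hroot _ hx)
      have h2 : (1 : S) + t • (b - 1) = algebraMap ℝ S t * (b - algebraMap ℝ S ((t - 1) / t)) := by
        rw [mul_sub, ← map_mul, mul_div_cancel₀ _ h0.ne', map_sub, map_one, Algebra.smul_def]
        ring
      rw [h2]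
      exact ((isUnit_iff_ne_zero.2 h0.ne').map (algebraMap ℝ S)).mul h1)
  let _ : NormedAlgebra ℚ S := NormedAlgebra.restrictScalars ℚ ℝ S
  let _ : NormedAlgebra ℚ 𝔸 := NormedAlgebra.restrictScalars ℚ ℝ 𝔸
  refine ⟨L, ?_⟩
  have := NormedSpace.map_exp (S.val : S →ₐ[ℝ] 𝔸) continuous_subtype_val L
  rw [hL] at this
  exact this.symm

end Logarithm

/-! ### Similarity of matrices and primary decomposition. -/

section Similarity

open Polynomial

/-- Similarity of square matrices, possibly with different index types. -/
def MatSim {K : Type*} [CommRing K] {m n : Type*} [Fintype m] [Fintype n] [DecidableEq m]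
    [DecidableEq n] (M : Matrix m m K) (N : Matrix n n K) : Prop :=
  ∃ (P : Matrix m n K) (Q : Matrix n m K), P * Q = 1 ∧ Q * P = 1 ∧ M = P * N * Q

namespace MatSim

variable {K : Type*} [CommRing K] {m n o p : Type*} [Fintype m] [Fintype n] [Fintype o] [Fintype p]
  [DecidableEq m] [DecidableEq n] [DecidableEq o] [DecidableEq p]

theorem refl (M : Matrix m m K) : MatSim M M := ⟨1, 1, by simp, by simp, by simp⟩

theorem symm {M : Matrix m m K} {N : Matrix n n K} (h : MatSim M N) : MatSim N M := by
  obtain ⟨P, Q, h1, h2, rfl⟩ := h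
  refine ⟨Q, P, h2, h1, ?_⟩
  calc N = (Q * P) * N * (Q * P) := by rw [h2, Matrix.one_mul, Matrix.mul_one]
    _ = _ := by simp only [Matrix.mul_assoc]

theorem trans {M : Matrix m m K} {N : Matrix n n K} {R : Matrix o o K} (h : MatSim M N)
    (h' : MatSim N R) : MatSim M R := by
  obtain ⟨P, Q, h1, h2, rfl⟩ := h
  obtain ⟨P', Q', h1', h2', rfl⟩ := h'
  refine ⟨P * P', Q' * Q, ?_, ?_, by simp only [Matrix.mul_assoc]⟩
  · calc P * P' * (Q' * Q) = P * (P' * Q') * Q := by simp only [Matrix.mul_assoc]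
      _ = 1 := by rw [h1', Matrix.mul_one, h1]
  · calc Q' * Q * (P * P') = Q' * (Q * P) * P' := by simp only [Matrix.mul_assoc]
      _ = 1 := by rw [h2, Matrix.mul_one, h2']

theorem submatrix (M : Matrix m m K) (e : n ≃ m) : MatSim M (M.submatrix e e) := by
  refine ⟨(1 : Matrix m m K).submatrix id e, (1 : Matrix m m K).submatrix e id, ?_, ?_, ?_⟩
  · rw [Matrix.submatrix_mul_equiv]; simp
  · rw [← Matrix.submatrix_mul _ _ e id e Function.bijective_id]; simp
  · rw [Matrix.submatrix_mul_equiv, Matrix.submatrix_mul_equiv]; simp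

theorem of_submatrix_eq {M : Matrix m m K} {N : Matrix n n K} (e : n ≃ m)
    (h : ∀ i j, M (e i) (e j) = N i j) : MatSim M N := by
  have : N = M.submatrix e e := by ext i j; simp [h]
  rw [this]
  exact submatrix M e

theorem fromBlocks {M : Matrix m m K} {N : Matrix n n K} {R : Matrix o o K} {S : Matrix p p K}
    (h : MatSim M N) (h' : MatSim R S) :
    MatSim (Matrix.fromBlocks M 0 0 R) (Matrix.fromBlocks N 0 0 S) := by
  obtain ⟨P, Q, h1, h2, rfl⟩ := h
  obtain ⟨P', Q', h1', h2', rfl⟩ := h'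
  refine ⟨Matrix.fromBlocks P 0 0 P', Matrix.fromBlocks Q 0 0 Q', ?_, ?_, ?_⟩ <;>
    simp [Matrix.fromBlocks_multiply, h1, h2, h1', h2']

theorem sumAssoc (M : Matrix m m K) (N : Matrix n n K) (R : Matrix o o K) :
    MatSim (Matrix.fromBlocks (Matrix.fromBlocks M 0 0 N) 0 0 R)
      (Matrix.fromBlocks M 0 0 (Matrix.fromBlocks N 0 0 R)) :=
  of_submatrix_eq (Equiv.sumAssoc m n o).symm (by
    rintro (i | i | i) (j | j | j) <;> simp)

theorem map {L : Type*} [CommRing L] (f : K →+* L) {M : Matrix m m K} {N : Matrix n n K}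
    (h : MatSim M N) : MatSim (M.map f) (N.map f) := by
  obtain ⟨P, Q, h1, h2, rfl⟩ := h
  refine ⟨P.map f, Q.map f, ?_, ?_, ?_⟩
  · rw [← Matrix.map_mul, h1, Matrix.map_one _ f.map_zero f.map_one]
  · rw [← Matrix.map_mul, h2, Matrix.map_one _ f.map_zero f.map_one]
  · rw [Matrix.map_mul, Matrix.map_mul]

theorem neg {M : Matrix m m K} {N : Matrix n n K} (h : MatSim M N) : MatSim (-M) (-N) := by
  obtain ⟨P, Q, h1, h2, rfl⟩ := h
  exact ⟨P, Q, h1, h2, by simp⟩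

theorem aeval {M : Matrix m m K} {N : Matrix n n K} (h : MatSim M N) (q : K[X]) :
    MatSim (Polynomial.aeval M q) (Polynomial.aeval N q) := by
  obtain ⟨P, Q, h1, h2, rfl⟩ := h
  refine ⟨P, Q, h1, h2, ?_⟩
  induction q using Polynomial.induction_on' with
  | add p q hp hq => rw [map_add, map_add, hp, hq, Matrix.mul_add, Matrix.add_mul]
  | monomial k a =>
    have hpow : ∀ k : ℕ, (P * N * Q) ^ k = P * N ^ k * Q := by
      intro k
      induction k with
      | zero => simp [h1]
      | succ k ih =>
        rw [pow_succ, ih, pow_succ]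
        calc P * N ^ k * Q * (P * N * Q) = P * N ^ k * (Q * P) * N * Q := by
              simp only [Matrix.mul_assoc]
          _ = _ := by rw [h2]; simp only [Matrix.mul_assoc, Matrix.mul_one]
    rw [aeval_monomial, aeval_monomial, hpow]
    simp [Algebra.algebraMap_eq_smul_one]

theorem charpoly_eq [Nontrivial K] {M : Matrix m m K} {N : Matrix n n K} (h : MatSim M N) :
    M.charpoly = N.charpoly := by
  obtain ⟨P, Q, h1, h2, rfl⟩ := h
  have hc : Fintype.card n = Fintype.card m :=
    Matrix.square_of_invertible (R := K) Q P h2 h1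
  rw [Matrix.mul_assoc, Matrix.charpoly_mul_comm_of_le _ _ hc.le, hc]
  simp [Matrix.mul_assoc, h2]

theorem card_eq [Nontrivial K] {M : Matrix m m K} {N : Matrix n n K} (h : MatSim M N) :
    Fintype.card m = Fintype.card n := by
  have := congrArg natDegree h.charpoly_eq
  rwa [Matrix.charpoly_natDegree_eq_dim, Matrix.charpoly_natDegree_eq_dim] at this

end MatSim

/-- A linear map represented by a matrix in a basis indexed by any type is similar to its matrix in
any other basis. -/
theorem matSim_toMatrix {K V : Type*} [CommRing K] [AddCommGroup V] [Module K V]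
    {m n : Type*} [Fintype m] [Fintype n] [DecidableEq m] [DecidableEq n]
    (b : Module.Basis m K V) (c : Module.Basis n K V) (f : V →ₗ[K] V) :
    MatSim (LinearMap.toMatrix b b f) (LinearMap.toMatrix c c f) := by
  refine ⟨b.toMatrix c, c.toMatrix b, Module.Basis.toMatrix_mul_toMatrix_flip _ _,
    Module.Basis.toMatrix_mul_toMatrix_flip _ _, ?_⟩
  rw [basis_toMatrix_mul_linearMap_toMatrix_mul_basis_toMatrix]

/-- Primary decomposition in matrix form. -/
theorem exists_matSim_fromBlocks {K : Type*} [Field K] {n : Type*} [Fintype n] [DecidableEq n]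
    (M : Matrix n n K) {p q : K[X]} (hpq : IsCoprime p q) (h : aeval M (p * q) = 0) :
    ∃ (a b : ℕ) (A : Matrix (Fin a) (Fin a) K) (B : Matrix (Fin b) (Fin b) K),
      MatSim M (Matrix.fromBlocks A 0 0 B) ∧ aeval A p = 0 ∧ aeval B q = 0 := by
  let f : Module.End K (n → K) := Matrix.toLinAlgEquiv' M
  have hf : aeval f (p * q) = 0 := by
    have := Polynomial.aeval_algHom_apply (Matrix.toLinAlgEquiv' : Matrix n n K ≃ₐ[K] _).toAlgHom M
      (p * q)
    rw [h, map_zero] at this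
    exact this
  -- Coprimality makes these two invariant kernels complementary. A basis adapted to them gives the
  -- two blocks.
  let V₁ := LinearMap.ker (aeval f p)
  let V₂ := LinearMap.ker (aeval f q)
  have hcompl : IsCompl V₁ V₂ := by
    refine ⟨disjoint_ker_aeval_of_isCoprime f hpq, codisjoint_iff.2 ?_⟩
    rw [sup_ker_aeval_eq_ker_aeval_mul_of_coprime f hpq, hf, LinearMap.ker_zero]
  have hinv : ∀ r : K[X], ∀ x ∈ LinearMap.ker (aeval f r), f x ∈ LinearMap.ker (aeval f r) := by
    intro r x hx
    rw [LinearMap.mem_ker] at hx ⊢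
    have : aeval f r (f x) = f (aeval f r x) := by
      have h1 : aeval f (r * X) = aeval f (X * r) := by rw [mul_comm]
      simp only [map_mul, aeval_X] at h1
      exact congrArg (fun g : Module.End K (n → K) => g x) h1
    rw [this, hx, map_zero]
  have hker : ∀ r : K[X], aeval (f.restrict (hinv r)) r = 0 := by
    intro r
    have h1 : ∀ s : K[X], ∀ x : LinearMap.ker (aeval f r),
        ((aeval (f.restrict (hinv r)) s x : LinearMap.ker (aeval f r)) : n → K) =
          aeval f s (x : n → K) := by
      intro s
      induction s using Polynomial.induction_on' with
      | add s t hs ht => intro x; simp [hs, ht]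
      | monomial k a =>
        intro x
        have h2 : ∀ k : ℕ, (((f.restrict (hinv r)) ^ k) x : n → K) = (f ^ k) (x : n → K) := by
          intro k
          induction k with
          | zero => simp
          | succ k ih => rw [pow_succ', pow_succ', Module.End.mul_apply, Module.End.mul_apply, ← ih]; rfl
        simp [aeval_monomial, Module.algebraMap_end_apply, h2]
    ext x : 1
    apply Subtype.val_injective
    rw [h1]
    exact x.2
  let b₁ := Module.finBasis K V₁
  let b₂ := Module.finBasis K V₂
  let e := Submodule.prodEquivOfIsCompl V₁ V₂ hcompl
  let b := (b₁.prod b₂).map e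
  refine ⟨_, _, LinearMap.toMatrix b₁ b₁ (f.restrict (hinv p)),
    LinearMap.toMatrix b₂ b₂ (f.restrict (hinv q)), ?_, ?_, ?_⟩
  · have h1 : LinearMap.toMatrix b b f = Matrix.fromBlocks
        (LinearMap.toMatrix b₁ b₁ (f.restrict (hinv p))) 0 0
        (LinearMap.toMatrix b₂ b₂ (f.restrict (hinv q))) := by
      have hl : ∀ x : V₁, e.symm (f (x : n → K)) = (f.restrict (hinv p) x, 0) := by
        intro x
        rw [LinearEquiv.symm_apply_eq]
        simp [e]
      have hr : ∀ x : V₂, e.symm (f (x : n → K)) = (0, f.restrict (hinv q) x) := by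
        intro x
        rw [LinearEquiv.symm_apply_eq]
        simp [e]
      ext (i | i) (j | j) <;> simp [LinearMap.toMatrix_apply, b, e, hl, hr]
    rw [← h1]
    have h2 := matSim_toMatrix (Pi.basisFun K n) b f
    have h3 : LinearMap.toMatrix (Pi.basisFun K n) (Pi.basisFun K n) f = M := by
      rw [LinearMap.toMatrix_eq_toMatrix']
      exact LinearMap.toMatrix'_toLin' M
    rwa [h3] at h2
  · have := Polynomial.aeval_algHom_apply (LinearMap.toMatrixAlgEquiv b₁).toAlgHom
      (f.restrict (hinv p)) p
    rw [hker p, map_zero] at this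
    exact this
  · have := Polynomial.aeval_algHom_apply (LinearMap.toMatrixAlgEquiv b₂).toAlgHom
      (f.restrict (hinv q)) q
    rw [hker q, map_zero] at this
    exact this

end Similarity

/-! ### Existence of the Jordan normal form. -/

section Jordan

open Polynomial

/-- The Jordan block of size `k` with eigenvalue `μ` over any commutative ring. -/
def jordanBlockOver {K : Type*} [CommRing K] (μ : K) (k : ℕ) : Matrix (Fin k) (Fin k) K :=
  Matrix.of fun i j => if i = j then μ else if (i : ℕ) + 1 = (j : ℕ) then 1 else 0

/-- The block diagonal matrix of a family of Jordan blocks. -/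
def jordanSum {K : Type*} [CommRing K] {ι : Type*} [DecidableEq ι] (b : ι → K × ℕ) :
    Matrix (Σ i, Fin (b i).2) (Σ i, Fin (b i).2) K :=
  Matrix.blockDiagonal' fun i => jordanBlockOver (b i).1 (b i).2

/-- The powers are listed in decreasing order so that multiplication by `X` has its ones above the
diagonal. For independence, the Taylor shift turns `X - μ` into `X`, and divisibility by `X ^ k`
kills all coefficients of degree below `k`. -/
theorem exists_basis_quotient {K : Type*} [Field K] (μ : K) (k : ℕ) (I : Ideal K[X])
    (hI : I = Ideal.span {(X - C μ) ^ k}) :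
    ∃ B : Module.Basis (Fin k) K (K[X] ⧸ I),
      ∀ j : Fin k, B j = Submodule.Quotient.mk ((X - C μ) ^ (k - 1 - (j : ℕ))) := by
  subst hI
  have hmonic : ((X - C μ) ^ k).Monic := (monic_X_sub_C μ).pow k
  have hfin : Module.Finite K (K[X] ⧸ Ideal.span {(X - C μ) ^ k}) := hmonic.finite_quotient
  have hrank : Module.finrank K (K[X] ⧸ Ideal.span {(X - C μ) ^ k}) = k := by
    rw [finrank_quotient_span_eq_natDegree' hmonic, natDegree_pow, natDegree_X_sub_C, mul_one]
  have hli : LinearIndependent K fun j : Fin k =>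
      (Submodule.Quotient.mk ((X - C μ) ^ (k - 1 - (j : ℕ))) :
        K[X] ⧸ Ideal.span {(X - C μ) ^ k}) := by
    rw [Fintype.linearIndependent_iff]
    intro c hc i
    have h1 : (Submodule.Quotient.mk (∑ j : Fin k, c j • (X - C μ) ^ (k - 1 - (j : ℕ))) :
        K[X] ⧸ Ideal.span {(X - C μ) ^ k}) = 0 := by
      rw [← hc]
      change Submodule.mkQ _ _ = _
      rw [map_sum]
      rfl
    rw [Submodule.Quotient.mk_eq_zero, Ideal.mem_span_singleton] at h1
    have h2 := _root_.map_dvd (taylorAlgHom μ) h1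
    have h3 : taylorAlgHom μ (X - C μ) = X := by
      change taylor μ (X - C μ) = X
      simp
    rw [map_pow, h3, map_sum, X_pow_dvd_iff] at h2
    have h4 := h2 (k - 1 - i) (by omega)
    simp only [map_smul, map_pow, h3, finsetSum_coeff, coeff_smul, coeff_X_pow, smul_eq_mul] at h4
    rw [Finset.sum_eq_single i] at h4
    · simpa using h4
    · intro j _ hj
      rw [if_neg, mul_zero]
      intro h
      exact hj (Fin.ext (by omega))
    · simp
  refine ⟨Module.Basis.mk hli ?_, fun j => by simp⟩
  rw [hli.span_eq_top_of_card_eq_finrank' (by simp [hrank])]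

theorem X_smul_basis_quotient {K : Type*} [Field K] (μ : K) (k : ℕ) (I : Ideal K[X])
    (hI : I = Ideal.span {(X - C μ) ^ k}) (B : Module.Basis (Fin k) K (K[X] ⧸ I))
    (hB : ∀ j : Fin k, B j = Submodule.Quotient.mk ((X - C μ) ^ (k - 1 - (j : ℕ)))) (j : Fin k) :
    (X : K[X]) • B j = ∑ i, jordanBlockOver μ k i j • B i := by
  subst hI
  have hX : (X : K[X]) • B j = μ • B j +
      Submodule.Quotient.mk ((X - C μ) ^ (k - 1 - (j : ℕ) + 1)) := by
    rw [hB, ← Submodule.Quotient.mk_smul, ← Submodule.Quotient.mk_smul,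
      ← Submodule.Quotient.mk_add]
    congr 1
    rw [smul_eq_mul, smul_eq_C_mul]
    ring
  rw [hX]
  by_cases hj : (j : ℕ) = 0
  · have h0 : (Submodule.Quotient.mk ((X - C μ) ^ (k - 1 - (j : ℕ) + 1)) :
        K[X] ⧸ Ideal.span {(X - C μ) ^ k}) = 0 := by
      rw [Submodule.Quotient.mk_eq_zero, Ideal.mem_span_singleton]
      exact pow_dvd_pow _ (by omega)
    rw [h0, add_zero, Finset.sum_eq_single j]
    · simp [jordanBlockOver]
    · intro i _ hi
      simp [jordanBlockOver, hi, hj]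
    · simp
  · let i₀ : Fin k := ⟨j - 1, by omega⟩
    have hi₀ : i₀ ≠ j := fun h => by
      have := congrArg Fin.val h
      simp only [i₀] at this
      omega
    rw [Finset.sum_eq_add_of_mem j i₀ (Finset.mem_univ _) (Finset.mem_univ _) hi₀.symm]
    · have h1 : jordanBlockOver μ k i₀ j = 1 := by
        have : (j : ℕ) - 1 + 1 = j := by omega
        simp [jordanBlockOver, hi₀, i₀, this]
      rw [h1, one_smul, hB i₀]
      congr 1
      · simp [jordanBlockOver]
      · congr 2
        simp only [i₀]
        omega
    · rintro i - ⟨h1, h2⟩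
      have : (i : ℕ) + 1 ≠ j := fun h => h2 (Fin.ext (by simp only [i₀]; omega))
      simp [jordanBlockOver, h1, this]

/-- Existence of the Jordan normal form of a matrix killed by a polynomial that splits. -/
theorem exists_matSim_jordanSum {K : Type u} [Field K] {n : Type u} [Fintype n] [DecidableEq n]
    (M : Matrix n n K) (q : K[X]) (hq0 : q ≠ 0) (hs : q.Splits) (hq : aeval M q = 0) :
    ∃ (k : ℕ) (b : Fin k → K × ℕ), (∀ i, 0 < (b i).2 ∧ q.IsRoot (b i).1) ∧
      MatSim M (jordanSum b) := by
  classical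
  let f : Module.End K (n → K) := Matrix.toLinAlgEquiv' M
  have hf : aeval f q = 0 := by
    have := Polynomial.aeval_algHom_apply (Matrix.toLinAlgEquiv' : Matrix n n K ≃ₐ[K] _).toAlgHom M q
    rw [hq, map_zero] at this
    exact this
  have htors : Module.IsTorsion K[X] (Module.AEval K (n → K) f) :=
    Module.AEval.isTorsion_of_finiteDimensional K (n → K) f
  -- The structure theorem over the principal ideal domain `K[X]`, which acts through `f`. As `q`
  -- splits, every prime that really occurs is associated to some `X - μ`.
  obtain ⟨ι, hι, p, hp, e, ⟨E⟩⟩ := Module.equiv_directSum_of_isTorsion htors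
  have hroot : ∀ i, 0 < e i → ∃ μ, q.IsRoot μ ∧ Associated (p i) (X - C μ) := by
    intro i hi
    have h1 : q • (DirectSum.of (fun i => K[X] ⧸ K[X] ∙ p i ^ e i) i
        (Submodule.Quotient.mk 1)) = 0 := by
      apply E.symm.injective
      rw [map_smul, map_zero]
      have h0 : ∀ x : Module.AEval K (n → K) f, q • x = 0 := by
        intro x
        obtain ⟨y, rfl⟩ := (Module.AEval.of K (n → K) f).surjective x
        rw [← Module.AEval.of_aeval_smul, hf, zero_smul, map_zero]
      exact h0 _
    have h2 : q • (Submodule.Quotient.mk 1 : K[X] ⧸ K[X] ∙ p i ^ e i) = 0 := by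
      have h3 := congrArg (DirectSum.component K[X] ι (fun i => K[X] ⧸ K[X] ∙ p i ^ e i) i) h1
      rw [map_smul, map_zero] at h3
      rwa [← DirectSum.lof_eq_of K[X], DirectSum.component.lof_self] at h3
    rw [← Submodule.Quotient.mk_smul, Submodule.Quotient.mk_eq_zero, smul_eq_mul, mul_one,
      Submodule.mem_span_singleton] at h2
    obtain ⟨r, hr⟩ := h2
    have h3 : p i ∣ q := by
      rw [← hr]
      exact Dvd.dvd.mul_left (dvd_pow_self _ hi.ne') _
    have h4 : (p i).Splits := hs.of_dvd hq0 h3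
    have h5 : (p i).degree = 1 := h4.degree_eq_one_of_irreducible (hp i)
    obtain ⟨μ, hμ⟩ := Polynomial.exists_root_of_degree_eq_one h5
    have h6 : X - C μ ∣ p i := dvd_iff_isRoot.2 hμ
    exact ⟨μ, dvd_iff_isRoot.1 (h6.trans h3), ((irreducible_X_sub_C μ).associated_of_dvd (hp i) h6).symm⟩
  have hμ : ∀ i, ∃ μ, (0 < e i → q.IsRoot μ) ∧ K[X] ∙ p i ^ e i = Ideal.span {(X - C μ) ^ e i} := by
    intro i
    rcases Nat.eq_zero_or_pos (e i) with h | h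
    · exact ⟨0, by simp [h], by simp [h, Ideal.span]⟩
    · obtain ⟨μ, h1, h2⟩ := hroot i h
      exact ⟨μ, fun _ => h1, Ideal.span_singleton_eq_span_singleton.2 (h2.pow_pow)⟩
  choose μ hμr hμs using hμ
  choose B hB using fun i => exists_basis_quotient (μ i) (e i) (K[X] ∙ p i ^ e i) (hμs i)
  let B' : Module.Basis (Σ i, Fin (e i)) K (Π₀ i, K[X] ⧸ K[X] ∙ p i ^ e i) := DFinsupp.basis B
  let E' : (n → K) ≃ₗ[K] (Π₀ i, K[X] ⧸ K[X] ∙ p i ^ e i) :=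
    (Module.AEval.of K (n → K) f).trans (E.restrictScalars K)
  let Bn := B'.map E'.symm
  have hmat : LinearMap.toMatrix Bn Bn f = jordanSum fun i => (μ i, e i) := by
    have hX : ∀ v, E' (f v) = (X : K[X]) • E' v := by
      intro v
      change E (Module.AEval.of K (n → K) f (f v)) = (X : K[X]) • E (Module.AEval.of K (n → K) f v)
      rw [← map_smul, Module.AEval.X_smul_of]
      rfl
    have hB' : ∀ x : Σ i, Fin (e i), B' x = DFinsupp.single x.1 (B x.1 x.2) := by
      intro x
      apply B'.repr.injective
      ext y
      simp [B', DFinsupp.basis]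
    have hcol : ∀ y, f (Bn y) = ∑ x, jordanSum (fun i => (μ i, e i)) x y • Bn x := by
      rintro ⟨i, j⟩
      apply E'.injective
      rw [hX, map_sum]
      simp only [map_smul, Bn, Module.Basis.map_apply, LinearEquiv.apply_symm_apply]
      rw [Fintype.sum_sigma, Finset.sum_eq_single i]
      · simp only [hB', jordanSum, Matrix.blockDiagonal'_apply_eq]
        rw [← DFinsupp.single_smul, X_smul_basis_quotient _ _ _ (hμs i) _ (hB i)]
        have := map_sum (DFinsupp.lsingle (R := K) (M := fun i => K[X] ⧸ K[X] ∙ p i ^ e i) i)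
          (fun k => jordanBlockOver (μ i) (e i) k j • B i k) Finset.univ
        simp only [map_smul] at this
        exact this
      · intro i' _ hi'
        refine Finset.sum_eq_zero fun k _ => ?_
        exact (congrArg (· • B' ⟨i', k⟩) (Matrix.blockDiagonal'_apply_ne _ _ _ hi')).trans
          (DFinsupp.ext fun _ => zero_smul K _)
      · simp
    ext x y
    rw [LinearMap.toMatrix_apply, hcol, Bn.repr_sum_self]
  have h2 := matSim_toMatrix (Pi.basisFun K n) Bn f
  have h3 : LinearMap.toMatrix (Pi.basisFun K n) (Pi.basisFun K n) f = M := by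
    rw [LinearMap.toMatrix_eq_toMatrix']
    exact LinearMap.toMatrix'_toLin' M
  rw [h3, hmat] at h2
  -- Summands with exponent `0` are zero modules with an arbitrary `μ`. They carry no basis vectors
  -- and are dropped by reindexing.
  let g := Fintype.equivFin {i // 0 < e i}
  refine ⟨Fintype.card {i // 0 < e i}, fun j => (μ (g.symm j), e (g.symm j)),
    fun j => ⟨(g.symm j).2, hμr _ (g.symm j).2⟩, h2.trans ?_⟩
  let c : (Σ j : Fin (Fintype.card {i // 0 < e i}), Fin (e (g.symm j))) → Σ i, Fin (e i) :=
    fun x => ⟨g.symm x.1, x.2⟩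
  have hc : Function.Bijective c := by
    constructor
    · rintro ⟨j, x⟩ ⟨j', x'⟩ h
      simp only [c, Sigma.mk.injEq] at h
      obtain ⟨h1, h2⟩ := h
      have : j = j' := g.symm.injective (Subtype.ext h1)
      subst this
      simpa using h2
    · rintro ⟨i, x⟩
      refine ⟨⟨g ⟨i, x.pos⟩, Fin.cast (by simp) x⟩, ?_⟩
      simp only [c, Sigma.mk.injEq, Equiv.symm_apply_apply, true_and]
      exact (Fin.heq_ext_iff (by simp)).2 rfl
  refine MatSim.of_submatrix_eq (Equiv.ofBijective c hc) ?_
  rintro ⟨j, x⟩ ⟨j', x'⟩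
  simp only [Equiv.ofBijective_apply, c, jordanSum]
  by_cases h : j = j'
  · subst h
    rw [Matrix.blockDiagonal'_apply_eq, Matrix.blockDiagonal'_apply_eq]
  · rw [Matrix.blockDiagonal'_apply_ne _ _ _ h, Matrix.blockDiagonal'_apply_ne]
    exact fun h' => h (g.symm.injective (Subtype.ext h'))

end Jordan

/-! ### Uniqueness of the number of Jordan blocks. -/

section JordanCount

open Polynomial

/-- The dimension of the kernel of a square matrix. -/
noncomputable def matNullity {K : Type*} [Field K] {n : Type*} [Fintype n] (M : Matrix n n K) : ℕ :=
  Module.finrank K (LinearMap.ker M.mulVecLin)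

variable {K : Type*} [Field K] {m n ι : Type*} [Fintype m] [Fintype n] [DecidableEq m]
  [DecidableEq n] [Fintype ι] [DecidableEq ι]

omit [DecidableEq m] [DecidableEq n] in
theorem matNullity_le_of_map {M : Matrix m m K} {N : Matrix n n K} (Q : Matrix n m K)
    (hQ : ∀ x, M *ᵥ x = 0 → N *ᵥ (Q *ᵥ x) = 0)
    (hinj : ∀ x, M *ᵥ x = 0 → Q *ᵥ x = 0 → x = 0) : matNullity M ≤ matNullity N := by
  refine LinearMap.finrank_le_finrank_of_injective
    (f := Q.mulVecLin.restrict (p := LinearMap.ker M.mulVecLin) (q := LinearMap.ker N.mulVecLin)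
      fun x hx => ?_) ?_
  · rw [LinearMap.mem_ker, Matrix.mulVecLin_apply] at hx ⊢
    exact hQ x hx
  · rw [← LinearMap.ker_eq_bot, LinearMap.ker_eq_bot']
    rintro ⟨x, hx⟩ h
    rw [LinearMap.mem_ker, Matrix.mulVecLin_apply] at hx
    exact Subtype.ext (hinj x hx (congrArg Subtype.val h))

theorem MatSim.matNullity_le {M : Matrix m m K} {N : Matrix n n K} (h : MatSim M N) :
    matNullity M ≤ matNullity N := by
  obtain ⟨P, Q, h1, h2, rfl⟩ := h
  refine matNullity_le_of_map Q (fun x hx => ?_) fun x _ hx => ?_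
  · have := congrArg (fun y => Q *ᵥ y) hx
    simp only [Matrix.mulVec_mulVec, Matrix.mulVec_zero] at this
    rwa [← Matrix.mul_assoc, ← Matrix.mul_assoc, h2, Matrix.one_mul, ← Matrix.mulVec_mulVec] at this
  · have := congrArg (fun y => P *ᵥ y) hx
    simpa [Matrix.mulVec_mulVec, h1] using this

theorem MatSim.matNullity_eq {M : Matrix m m K} {N : Matrix n n K} (h : MatSim M N) :
    matNullity M = matNullity N :=
  le_antisymm h.matNullity_le h.symm.matNullity_le

theorem matNullity_fromBlocks_of_isUnit {A : Matrix m m K} (D : Matrix n n K) (hA : IsUnit A) :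
    matNullity (Matrix.fromBlocks A 0 0 D) = matNullity D := by
  have hinj : ∀ x, A *ᵥ x = 0 → x = 0 := fun x hx =>
    Matrix.mulVec_injective_of_isUnit hA (by rw [hx, Matrix.mulVec_zero])
  have key : ∀ x : m ⊕ n → K, Matrix.fromBlocks A 0 0 D *ᵥ x = 0 →
      x ∘ Sum.inl = 0 ∧ D *ᵥ (x ∘ Sum.inr) = 0 := by
    intro x hx
    rw [Matrix.fromBlocks_mulVec] at hx
    simp only [Matrix.zero_mulVec, add_zero, zero_add] at hx
    exact ⟨hinj _ (funext fun i => congrFun hx (Sum.inl i)), funext fun i => congrFun hx (Sum.inr i)⟩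
  apply le_antisymm
  · refine matNullity_le_of_map ((1 : Matrix (m ⊕ n) (m ⊕ n) K).submatrix Sum.inr id) ?_ ?_
    · intro x hx
      have : (1 : Matrix (m ⊕ n) (m ⊕ n) K).submatrix Sum.inr id *ᵥ x = x ∘ Sum.inr := by
        ext i
        simp [Matrix.mulVec, dotProduct, Matrix.one_apply]
      rw [this]
      exact (key x hx).2
    · intro x hx h
      have : (1 : Matrix (m ⊕ n) (m ⊕ n) K).submatrix Sum.inr id *ᵥ x = x ∘ Sum.inr := by
        ext i
        simp [Matrix.mulVec, dotProduct, Matrix.one_apply]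
      rw [this] at h
      ext (i | i)
      · exact congrFun (key x hx).1 i
      · exact congrFun h i
  · have hQ : ∀ y : n → K, (1 : Matrix (m ⊕ n) (m ⊕ n) K).submatrix id Sum.inr *ᵥ y =
        Sum.elim (0 : m → K) y := by
      intro y
      ext (i | i) <;> simp [Matrix.mulVec, dotProduct, Matrix.one_apply]
    refine matNullity_le_of_map ((1 : Matrix (m ⊕ n) (m ⊕ n) K).submatrix id Sum.inr) ?_ ?_
    · intro y hy
      rw [hQ, Matrix.fromBlocks_mulVec]
      ext (i | i) <;> simp [hy]
    · intro y _ h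
      rw [hQ] at h
      exact funext fun i => congrFun h (Sum.inr i)

theorem blockDiagonal'_mulVec_apply {p : ι → Type*} [∀ i, Fintype (p i)]
    [∀ i, DecidableEq (p i)] (B : ∀ i, Matrix (p i) (p i) K) (x : (Σ i, p i) → K) (i : ι) (a : p i) :
    (Matrix.blockDiagonal' B *ᵥ x) ⟨i, a⟩ = (B i *ᵥ fun c => x ⟨i, c⟩) a := by
  simp only [Matrix.mulVec, dotProduct]
  rw [Fintype.sum_sigma, Finset.sum_eq_single i]
  · simp
  · intro j _ hj
    exact Finset.sum_eq_zero fun c _ => by rw [Matrix.blockDiagonal'_apply_ne _ _ _ hj.symm, zero_mul]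
  · simp

theorem matNullity_blockDiagonal' {p : ι → Type*} [∀ i, Fintype (p i)]
    [∀ i, DecidableEq (p i)] (B : ∀ i, Matrix (p i) (p i) K) :
    matNullity (Matrix.blockDiagonal' B) = ∑ i, matNullity (B i) := by
  let e : LinearMap.ker (Matrix.blockDiagonal' B).mulVecLin ≃ₗ[K]
      ∀ i, LinearMap.ker (B i).mulVecLin :=
    { toFun := fun x i => ⟨fun c => x.1 ⟨i, c⟩, by
        rw [LinearMap.mem_ker, Matrix.mulVecLin_apply]
        ext a
        rw [← blockDiagonal'_mulVec_apply]
        have := x.2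
        rw [LinearMap.mem_ker, Matrix.mulVecLin_apply] at this
        rw [this]; rfl⟩
      invFun := fun y => ⟨fun c => (y c.1).1 c.2, by
        rw [LinearMap.mem_ker, Matrix.mulVecLin_apply]
        ext ⟨i, a⟩
        rw [blockDiagonal'_mulVec_apply]
        have := (y i).2
        rw [LinearMap.mem_ker, Matrix.mulVecLin_apply] at this
        exact congrFun this a⟩
      map_add' := fun _ _ => rfl
      map_smul' := fun _ _ => rfl
      left_inv := fun _ => rfl
      right_inv := fun _ => rfl }
  rw [matNullity, e.finrank_eq, Module.finrank_pi_fintype]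
  rfl

theorem jordanBlockOver_sub (μ x : K) (k : ℕ) :
    jordanBlockOver μ k - x • (1 : Matrix (Fin k) (Fin k) K) = jordanBlockOver (μ - x) k := by
  ext i j
  by_cases h : i = j <;> simp [jordanBlockOver, h]

theorem jordanBlockOver_isUpperTriangular (μ : K) (k : ℕ) :
    (jordanBlockOver μ k).IsUpperTriangular := by
  intro i j hij
  simp only [id] at hij
  have h1 : i ≠ j := by rintro rfl; exact lt_irrefl _ hij
  have h2 : (i : ℕ) + 1 ≠ j := by have := Fin.lt_def.1 hij; omega
  simp [jordanBlockOver, h1, h2]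

theorem jordanBlockOver_zero_pow_apply (k j : ℕ) (a b : Fin k) :
    ((jordanBlockOver (0 : K) k) ^ j) a b = if (a : ℕ) + j = b then 1 else 0 := by
  induction j generalizing a b with
  | zero => simp [Matrix.one_apply, Fin.ext_iff]
  | succ j ih =>
    rw [pow_succ, Matrix.mul_apply]
    simp only [ih, ite_mul, one_mul, zero_mul]
    by_cases h : (a : ℕ) + j < k
    · rw [Finset.sum_eq_single ⟨a + j, h⟩]
      · simp only [jordanBlockOver, Matrix.of_apply, if_true, Fin.ext_iff]
        split_ifs <;> first | rfl | omega
      · intro c _ hc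
        rw [if_neg]
        intro h'
        exact hc (Fin.ext h'.symm)
      · simp
    · rw [if_neg (by omega)]
      exact Finset.sum_eq_zero fun c _ => if_neg (by omega)

/-- The `j`-th power of the nilpotent block shifts coordinates by `j`, so its kernel consists of the
vectors supported on the first `j` coordinates, of which there are at most `k`. -/
theorem matNullity_jordanBlockOver_zero_pow (k j : ℕ) :
    matNullity ((jordanBlockOver (0 : K) k) ^ j) = min j k := by
  have hmul : ∀ (x : Fin k → K) (a : Fin k) , (((jordanBlockOver (0 : K) k) ^ j) *ᵥ x) a =
      if h : (a : ℕ) + j < k then x ⟨a + j, h⟩ else 0 := by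
    intro x a
    simp only [Matrix.mulVec, dotProduct, jordanBlockOver_zero_pow_apply, ite_mul, one_mul, zero_mul]
    split_ifs with h
    · rw [Finset.sum_eq_single ⟨a + j, h⟩]
      · simp
      · intro c _ hc
        rw [if_neg]
        intro h'
        exact hc (Fin.ext h'.symm)
      · simp
    · exact Finset.sum_eq_zero fun c _ => if_neg (by omega)
  have hker : LinearMap.ker ((jordanBlockOver (0 : K) k) ^ j).mulVecLin =
      ⨅ i ∈ {b : Fin k | j ≤ b}, LinearMap.ker (LinearMap.proj i : (Fin k → K) →ₗ[K] K) := by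
    ext x
    simp only [LinearMap.mem_ker, Matrix.mulVecLin_apply, Submodule.mem_iInf, LinearMap.proj_apply,
      Set.mem_ofPred_eq]
    constructor
    · intro h b hb
      have := congrFun h ⟨b - j, by omega⟩
      rw [hmul, dif_pos (show (b : ℕ) - j + j < k by omega)] at this
      have hb' : (⟨(b : ℕ) - j + j, by omega⟩ : Fin k) = b := Fin.ext (by simp; omega)
      rwa [hb'] at this
    · intro h
      ext a
      rw [hmul]
      split_ifs with h'
      · exact h _ (by simp)
      · rfl
  rw [matNullity, hker, (LinearMap.iInfKerProjEquiv K (fun _ : Fin k => K)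
    (I := {b : Fin k | (b : ℕ) < j}) (J := {b : Fin k | j ≤ b}) ?_ ?_).finrank_eq,
    Module.finrank_fintype_fun_eq_card]
  · rw [Fintype.card_subtype]
    have : (Finset.univ.filter fun b : Fin k => b ∈ {b : Fin k | (b : ℕ) < j}).card = min j k := by
      have h1 : (Finset.univ.filter fun b : Fin k => b ∈ {b : Fin k | (b : ℕ) < j}).map
          Fin.valEmbedding = Finset.range (min j k) := by
        ext b
        simp only [Set.mem_ofPred_eq, Finset.mem_map, Finset.mem_filter, Finset.mem_univ, true_and,
          Fin.valEmbedding_apply, Finset.mem_range, lt_min_iff]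
        constructor
        · rintro ⟨c, h, rfl⟩; exact ⟨h, c.2⟩
        · rintro ⟨h, h'⟩; exact ⟨⟨b, h'⟩, h, rfl⟩
      rw [← Finset.card_map, h1, Finset.card_range]
    convert this
  · rw [Set.disjoint_left]
    intro b hb hb'
    simp only [Set.mem_ofPred_eq] at hb hb'
    omega
  · intro b _
    simp only [Set.mem_union, Set.mem_ofPred_eq]
    omega

theorem matNullity_of_isUnit {M : Matrix m m K} (h : IsUnit M) : matNullity M = 0 := by
  have : LinearMap.ker M.mulVecLin = ⊥ := by
    rw [LinearMap.ker_eq_bot]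
    exact Matrix.mulVec_injective_of_isUnit h
  rw [matNullity, this, finrank_bot]

omit [Fintype ι] in
theorem jordanSum_sub (b : ι → K × ℕ) (x : K) :
    jordanSum b - x • 1 =
      Matrix.blockDiagonal' fun i => jordanBlockOver ((b i).1 - x) (b i).2 := by
  rw [jordanSum, ← Matrix.blockDiagonal'_one, ← Matrix.blockDiagonal'_smul,
    ← Matrix.blockDiagonal'_sub]
  congr 1
  ext1 i
  exact jordanBlockOver_sub _ _ _

theorem isUnit_jordanBlockOver {μ : K} (hμ : μ ≠ 0) (k : ℕ) : IsUnit (jordanBlockOver μ k) := by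
  rw [Matrix.isUnit_iff_isUnit_det, Matrix.det_of_isUpperTriangular
    (jordanBlockOver_isUpperTriangular _ _), isUnit_iff_ne_zero, Finset.prod_ne_zero_iff]
  intro a _
  simpa [jordanBlockOver] using hμ

theorem isUnit_jordanSum_sub (b : ι → K × ℕ) (x : K) (hb : ∀ i, (b i).1 ≠ x) :
    IsUnit (jordanSum b - x • (1 : Matrix (Σ i, Fin (b i).2) (Σ i, Fin (b i).2) K)) := by
  rw [jordanSum_sub]
  exact (Pi.isUnit_iff.2 fun i => isUnit_jordanBlockOver (sub_ne_zero.2 (hb i)) (b i).2).map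
    (Matrix.blockDiagonal'RingHom (fun i => Fin (b i).2) K)

theorem matNullity_jordanSum (b : ι → K × ℕ) (x : K) (j : ℕ) :
    matNullity ((jordanSum b - x • 1) ^ j) =
      open Classical in ∑ i, if (b i).1 = x then min j (b i).2 else 0 := by
  rw [jordanSum_sub, ← Matrix.blockDiagonal'_pow, matNullity_blockDiagonal']
  refine Finset.sum_congr rfl fun i _ => ?_
  rw [Pi.pow_apply]
  split_ifs with h
  · rw [h, sub_self, matNullity_jordanBlockOver_zero_pow]
  · exact matNullity_of_isUnit ((isUnit_jordanBlockOver (sub_ne_zero.2 h) _).pow j)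

-- The second difference of `j ↦ min j s` at `k` is `-1` if `s = k` and `0` otherwise. Second
-- differences of nullities therefore count the blocks of size exactly `k`. The identity is arranged
-- without subtraction of sums.
omit [DecidableEq ι] [Field K] in
open Classical in
theorem card_filter_add_sum_min (c : ι → K × ℕ) (x : K) (k : ℕ) (hk : 0 < k) :
    (Finset.univ.filter fun i => c i = (x, k)).card +
        (∑ i, if (c i).1 = x then min (k - 1) (c i).2 else 0) +
        (∑ i, if (c i).1 = x then min (k + 1) (c i).2 else 0) =
      2 * ∑ i, if (c i).1 = x then min k (c i).2 else 0 := by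
  rw [Finset.card_filter, ← Finset.sum_add_distrib, ← Finset.sum_add_distrib, Finset.mul_sum]
  refine Finset.sum_congr rfl fun i _ => ?_
  by_cases h : (c i).1 = x
  · simp only [Prod.ext_iff, h, true_and, if_true]
    split_ifs <;> omega
  · simp [Prod.ext_iff, h]

omit [DecidableEq ι] [Field K] in
open Classical in
theorem card_filter_eq_of_sum_min_eq {ι' : Type*} [Fintype ι'] (b : ι → K × ℕ) (b' : ι' → K × ℕ)
    (x : K) (h : ∀ j, (∑ i, if (b i).1 = x then min j (b i).2 else 0) =
      ∑ i, if (b' i).1 = x then min j (b' i).2 else 0) (k : ℕ) (hk : 0 < k) :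
    (Finset.univ.filter fun i => b i = (x, k)).card =
      (Finset.univ.filter fun i => b' i = (x, k)).card := by
  have h1 := card_filter_add_sum_min b x k hk
  have h2 := card_filter_add_sum_min b' x k hk
  rw [h, h, h] at h1
  omega

open Classical in
/-- The number of Jordan blocks of a given size for the eigenvalue `x` does not depend on the
Jordan form, even if the latter is given only on a complement of a block without eigenvalue `x`. -/
theorem card_filter_jordan_eq {κ o : Type*} [Fintype κ] [Fintype o] [DecidableEq κ]
    [DecidableEq o]
    (M : Matrix m m K) (b : ι → K × ℕ) (b' : κ → K × ℕ) (G : Matrix o o K) (x : K)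
    (hb : MatSim M (jordanSum b)) (hb' : MatSim M (Matrix.fromBlocks G 0 0 (jordanSum b')))
    (hG : IsUnit (G - x • (1 : Matrix o o K))) (k : ℕ) (hk : 0 < k) :
    (Finset.univ.filter fun i => b i = (x, k)).card =
      (Finset.univ.filter fun i => b' i = (x, k)).card := by
  refine card_filter_eq_of_sum_min_eq b b' x (fun j => ?_) k hk
  have h1 := ((hb.symm.trans hb').aeval ((X - C x) ^ j)).matNullity_eq
  simp only [map_pow, map_sub, aeval_X, aeval_C, Algebra.algebraMap_eq_smul_one] at h1
  have h2 : Matrix.fromBlocks G 0 0 (jordanSum b') - x • 1 =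
      Matrix.fromBlocks (G - x • 1) 0 0 (jordanSum b' - x • 1) := by
    rw [← Matrix.fromBlocks_one, Matrix.fromBlocks_smul, sub_eq_add_neg, Matrix.fromBlocks_neg,
      Matrix.fromBlocks_add]
    simp [sub_eq_add_neg]
  rw [h2, Matrix.fromBlocks_diagonal_pow, matNullity_fromBlocks_of_isUnit _ (hG.pow j),
    matNullity_jordanSum, matNullity_jordanSum] at h1
  convert h1

end JordanCount

/-! ### Real logarithms of real matrices. -/

section MatrixLog

open Polynomial

variable {m n : Type*} [Fintype m] [Fintype n] [DecidableEq m] [DecidableEq n]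

attribute [local instance] Matrix.linftyOpNormedRing Matrix.linftyOpNormedAlgebra

/-- The real square matrix `M` is the exponential of a real matrix. -/
def HasMatrixLog {m : Type*} [Fintype m] [DecidableEq m] (M : Matrix m m ℝ) : Prop :=
  ∃ L : Matrix m m ℝ, NormedSpace.exp L = M

/-- Conjugation is a continuous ring homomorphism, and these commute with the exponential. -/
theorem MatSim.hasMatrixLog {M : Matrix m m ℝ} {N : Matrix n n ℝ} (h : MatSim M N)
    (hM : HasMatrixLog M) : HasMatrixLog N := by
  obtain ⟨P, Q, h1, h2, rfl⟩ := h.symm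
  obtain ⟨L, rfl⟩ := hM
  let f : Matrix m m ℝ →+* Matrix n n ℝ :=
    { toFun := fun X => P * X * Q
      map_one' := by rw [Matrix.mul_one, h1]
      map_zero' := by simp
      map_add' := fun X Y => by rw [Matrix.mul_add, Matrix.add_mul]
      map_mul' := fun X Y => by
        calc P * (X * Y) * Q = P * (X * (1 : Matrix m m ℝ) * Y) * Q := by rw [Matrix.mul_one]
          _ = P * X * Q * (P * Y * Q) := by rw [← h2]; simp only [Matrix.mul_assoc] }
  have hf : Continuous f := by
    change Continuous fun X : Matrix m m ℝ => P * X * Q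
    fun_prop
  exact ⟨f L, (NormedSpace.map_exp f hf L).symm⟩

theorem Matrix.exp_fromBlocks_diagonal (A : Matrix m m ℝ) (D : Matrix n n ℝ) :
    NormedSpace.exp (Matrix.fromBlocks A 0 0 D) =
      Matrix.fromBlocks (NormedSpace.exp A) 0 0 (NormedSpace.exp D) := by
  let f : Matrix m m ℝ × Matrix n n ℝ →+* Matrix (m ⊕ n) (m ⊕ n) ℝ :=
    { toFun := fun X => Matrix.fromBlocks X.1 0 0 X.2
      map_one' := Matrix.fromBlocks_one
      map_zero' := Matrix.fromBlocks_zero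
      map_add' := fun X Y => by simp [Matrix.fromBlocks_add]
      map_mul' := fun X Y => by simp [Matrix.fromBlocks_multiply] }
  have hf : Continuous f := by
    change Continuous fun X : Matrix m m ℝ × Matrix n n ℝ => Matrix.fromBlocks X.1 0 0 X.2
    fun_prop
  refine (NormedSpace.map_exp f hf (A, D)).symm.trans ?_
  change Matrix.fromBlocks (NormedSpace.exp (A, D)).1 0 0 (NormedSpace.exp (A, D)).2 = _
  exact congrArg₂ (fun X Y => Matrix.fromBlocks X 0 0 Y) (Prod.fst_exp (A, D)) (Prod.snd_exp (A, D))

theorem HasMatrixLog.fromBlocks {M : Matrix m m ℝ} {N : Matrix n n ℝ} (hM : HasMatrixLog M)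
    (hN : HasMatrixLog N) : HasMatrixLog (Matrix.fromBlocks M 0 0 N) := by
  obtain ⟨L, rfl⟩ := hM
  obtain ⟨L', rfl⟩ := hN
  exact ⟨_, Matrix.exp_fromBlocks_diagonal L L'⟩

theorem hasMatrixLog_of_aeval {M : Matrix m m ℝ} (q : ℝ[X]) (hq : aeval M q = 0)
    (hroot : ∀ x ≤ 0, q.eval x ≠ 0) : HasMatrixLog M :=
  exists_exp_eq_of_aeval M q hq hroot

/-- Two copies of the negative of an exponential form an exponential. -/
theorem HasMatrixLog.fromBlocks_neg {M : Matrix m m ℝ} (h : HasMatrixLog (-M)) :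
    HasMatrixLog (Matrix.fromBlocks M 0 0 M) := by
  obtain ⟨L, hL⟩ := h
  -- A complex structure on the doubled space that commutes with `L ⊕ L`. Since `exp (π J) = -1`,
  -- adding `π J` to `L ⊕ L` changes the sign of the exponential.
  let J : Matrix (m ⊕ m) (m ⊕ m) ℝ := Matrix.fromBlocks 0 (-1) 1 0
  have hJ : J * J = -1 := by
    simp only [J, Matrix.fromBlocks_multiply]
    rw [← Matrix.fromBlocks_one, Matrix.fromBlocks_neg]
    simp
  let f : ℂ →ₐ[ℝ] Matrix (m ⊕ m) (m ⊕ m) ℝ := Complex.lift ⟨J, hJ⟩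
  have hf : Continuous f := f.toLinearMap.continuous_of_finiteDimensional
  have hrot : NormedSpace.exp (f (Real.pi * Complex.I)) = -1 := by
    refine (NormedSpace.map_exp f hf _).symm.trans ?_
    rw [← Complex.exp_eq_exp_ℂ, Complex.exp_pi_mul_I, map_neg, map_one]
  have hfI : f (Real.pi * Complex.I) = Real.pi • J := by
    rw [map_mul]
    have h1 : f (Real.pi : ℂ) = algebraMap ℝ _ Real.pi := f.commutes Real.pi
    have h2 : f Complex.I = J := by simp [f]
    rw [h1, h2, Algebra.smul_def]
  have hcomm : Commute (Matrix.fromBlocks L 0 0 L) (Real.pi • J) := by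
    refine Commute.smul_right ?_ _
    rw [commute_iff_eq]
    simp [J, Matrix.fromBlocks_multiply]
  refine ⟨Matrix.fromBlocks L 0 0 L + Real.pi • J, ?_⟩
  rw [Matrix.exp_add_of_commute _ _ hcomm, ← hfI, hrot, Matrix.exp_fromBlocks_diagonal, hL,
    mul_neg, mul_one, Matrix.fromBlocks_neg]
  simp

end MatrixLog

/-! ### Pairing equal Jordan blocks. -/

section Pairing

/-- A fibre of `b` with `N` elements is cut into two halves of size `N / 2` and a rest of size `N %
2`. The halves are the pairs of equal blocks with a common real logarithm. The rest lists each value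
of odd multiplicity once, as in `oddNegativeSize`. -/
theorem exists_pairing {ι β : Type} [Fintype ι] [DecidableEq β] (b : ι → β) :
    ∃ (A O : Type) (_ : Fintype A) (_ : Fintype O) (_ : DecidableEq A) (_ : DecidableEq O)
      (e : (A ⊕ A) ⊕ O ≃ ι) (c : A → β) (o : O → β), Function.Injective o ∧
      b ∘ e = Sum.elim (Sum.elim c c) o ∧
      ∀ y, (∃ x, o x = y) ↔ Odd (Finset.univ.filter fun i => b i = y).card := by
  classical
  let N : Set.range b → ℕ := fun y => Fintype.card {i // Set.rangeFactorization b i = y}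
  have hF : ∀ y, Nonempty ((Fin (N y / 2) ⊕ Fin (N y / 2)) ⊕ Fin (N y % 2) ≃
      {i // Set.rangeFactorization b i = y}) := fun y =>
    ⟨Fintype.equivOfCardEq (by simp only [Fintype.card_sum, Fintype.card_fin]; change _ = N y; omega)⟩
  let F := fun y => (hF y).some
  let e : ((Σ y, Fin (N y / 2)) ⊕ (Σ y, Fin (N y / 2))) ⊕ (Σ y, Fin (N y % 2)) ≃ ι :=
    (Equiv.sumCongr (Equiv.sigmaSumDistrib _ _).symm (Equiv.refl _)).trans
      ((Equiv.sigmaSumDistrib _ _).symm.trans ((Equiv.sigmaCongrRight F).trans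
        (Equiv.sigmaFiberEquiv (Set.rangeFactorization b))))
  have hfib : ∀ x : (Σ y, {i // Set.rangeFactorization b i = y}),
      b (Equiv.sigmaFiberEquiv (Set.rangeFactorization b) x) = x.1 := by
    rintro ⟨y, i, rfl⟩
    rfl
  refine ⟨Σ y, Fin (N y / 2), Σ y, Fin (N y % 2), inferInstance, inferInstance, inferInstance,
    inferInstance, e, fun x => x.1, fun x => x.1, ?_, ?_, ?_⟩
  · rintro ⟨y, i⟩ ⟨y', i'⟩ h
    have : y = y' := Subtype.ext h
    subst this
    have h1 : (i : ℕ) < N y % 2 := i.2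
    have h2 : (i' : ℕ) < N y % 2 := i'.2
    have h3 : (i : ℕ) = (i' : ℕ) := by omega
    rw [Fin.ext h3]
  · funext x
    rcases x with (x | x) | x <;> exact hfib _
  · intro y
    have hcard : ∀ y : Set.range b, N y = (Finset.univ.filter fun i => b i = y).card := by
      intro y
      simp only [N]
      rw [Fintype.card_subtype]
      congr 1
      ext i
      simp [Subtype.ext_iff]
    constructor
    · rintro ⟨⟨y, i⟩, rfl⟩
      rw [← hcard, Nat.odd_iff]
      have h : (i : ℕ) < N y % 2 := i.2
      change N y % 2 = 1
      omega
    · intro h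
      have hy : y ∈ Set.range b := by
        obtain ⟨i, hi⟩ := Finset.card_pos.1 h.pos
        exact ⟨i, (Finset.mem_filter.1 hi).2⟩
      rw [← hcard ⟨y, hy⟩, Nat.odd_iff] at h
      exact ⟨⟨⟨y, hy⟩, ⟨0, by omega⟩⟩, rfl⟩

variable {K : Type*} [CommRing K] {ι κ : Type*} [Fintype ι] [DecidableEq ι] [Fintype κ]
  [DecidableEq κ]

theorem matSim_jordanSum_comp (b : ι → K × ℕ) (e : κ ≃ ι) :
    MatSim (jordanSum b) (jordanSum (b ∘ e)) := by
  refine MatSim.of_submatrix_eq (Equiv.sigmaCongrLeft (β := fun i => Fin (b i).2) e) ?_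
  rintro ⟨i, x⟩ ⟨j, y⟩
  change jordanSum b ⟨e i, x⟩ ⟨e j, y⟩ = _
  simp only [jordanSum]
  by_cases h : i = j
  · subst h
    rw [Matrix.blockDiagonal'_apply_eq, Matrix.blockDiagonal'_apply_eq]
    rfl
  · rw [Matrix.blockDiagonal'_apply_ne _ _ _ h,
      Matrix.blockDiagonal'_apply_ne _ _ _ fun h' => h (e.injective h')]

theorem matSim_jordanSum_sum (b : ι ⊕ κ → K × ℕ) :
    MatSim (jordanSum b) (Matrix.fromBlocks (jordanSum fun i => b (Sum.inl i)) 0 0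
      (jordanSum fun i => b (Sum.inr i))) := by
  refine MatSim.of_submatrix_eq (Equiv.sumSigmaDistrib fun i => Fin (b i).2).symm ?_
  rintro (⟨i, x⟩ | ⟨i, x⟩) (⟨j, y⟩ | ⟨j, y⟩)
  · change jordanSum b ⟨Sum.inl i, x⟩ ⟨Sum.inl j, y⟩ = jordanSum (fun i => b (Sum.inl i)) ⟨i, x⟩ ⟨j, y⟩
    simp only [jordanSum]
    by_cases h : i = j
    · subst h
      rw [Matrix.blockDiagonal'_apply_eq, Matrix.blockDiagonal'_apply_eq]
    · rw [Matrix.blockDiagonal'_apply_ne _ _ _ h,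
        Matrix.blockDiagonal'_apply_ne _ _ _ fun h' => h (Sum.inl_injective h')]
  · exact Matrix.blockDiagonal'_apply_ne _ _ _ Sum.inl_ne_inr
  · exact Matrix.blockDiagonal'_apply_ne _ _ _ Sum.inr_ne_inl
  · change jordanSum b ⟨Sum.inr i, x⟩ ⟨Sum.inr j, y⟩ = jordanSum (fun i => b (Sum.inr i)) ⟨i, x⟩ ⟨j, y⟩
    simp only [jordanSum]
    by_cases h : i = j
    · subst h
      rw [Matrix.blockDiagonal'_apply_eq, Matrix.blockDiagonal'_apply_eq]
    · rw [Matrix.blockDiagonal'_apply_ne _ _ _ h,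
        Matrix.blockDiagonal'_apply_ne _ _ _ fun h' => h (Sum.inr_injective h')]

omit [Fintype ι] in
theorem jordanSum_map {L : Type*} [CommRing L] (f : K →+* L) (b : ι → K × ℕ) :
    (jordanSum b).map f = jordanSum fun i => (f (b i).1, (b i).2) := by
  ext ⟨i, x⟩ ⟨j, y⟩
  rw [Matrix.map_apply]
  simp only [jordanSum]
  by_cases h : i = j
  · subst h
    rw [Matrix.blockDiagonal'_apply_eq, Matrix.blockDiagonal'_apply_eq]
    simp only [jordanBlockOver, Matrix.of_apply]
    split_ifs <;> simp
  · rw [Matrix.blockDiagonal'_apply_ne _ _ _ h, Matrix.blockDiagonal'_apply_ne _ _ _ h, map_zero]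

/-- Minus a Jordan matrix with negative eigenvalues is an exponential. -/
theorem hasMatrixLog_neg_jordanSum (b : ι → ℝ × ℕ) (hb : ∀ i, (b i).1 < 0) :
    HasMatrixLog (-jordanSum b) := by
  refine hasMatrixLog_of_aeval _ (Matrix.aeval_self_charpoly _) fun x hx => ?_
  rw [Matrix.eval_charpoly]
  have h : Matrix.scalar _ x - -jordanSum b = jordanSum b - (-x) • 1 := by
    rw [sub_neg_eq_add, neg_smul, sub_neg_eq_add, add_comm, Matrix.scalar_apply,
      Matrix.smul_one_eq_diagonal]
  rw [h, ← isUnit_iff_ne_zero, ← Matrix.isUnit_iff_isUnit_det]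
  exact isUnit_jordanSum_sub b _ fun i => ((hb i).trans_le (by linarith)).ne

end Pairing

/-! ### The real Floquet normal form of a monodromy matrix. -/

section RealFloquet

open Polynomial

/-- The negative real roots of a polynomial can be split off. -/
theorem exists_mul_eq_of_neg_roots (q : ℝ[X]) (hq : q ≠ 0) :
    ∃ q₁ q₂ : ℝ[X], q₂ * q₁ = q ∧ q₁.Splits ∧ (∀ x, q₁.IsRoot x → x < 0) ∧
      (∀ x < 0, q₂.eval x ≠ 0) ∧ IsCoprime q₂ q₁ := by
  classical
  let s := q.roots.filter (· < 0)
  let q₁ : ℝ[X] := (s.map fun a => X - C a).prod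
  have hdvd : q₁ ∣ q :=
    (Multiset.prod_dvd_prod_of_le (Multiset.map_le_map (Multiset.filter_le _ _))).trans
      q.prod_multiset_X_sub_C_dvd
  obtain ⟨q₂, h⟩ := hdvd
  have hr₁ : q₁.roots = s := roots_multiset_prod_X_sub_C s
  have h0 : q₁ * q₂ ≠ 0 := h ▸ hq
  have hs : q₁.Splits := Splits.multisetProd fun p hp => by
    obtain ⟨a, _, rfl⟩ := Multiset.mem_map.1 hp
    exact Splits.X_sub_C a
  have hneg : ∀ x, q₁.IsRoot x → x < 0 := fun x hx => by
    have : x ∈ q₁.roots := (mem_roots (left_ne_zero_of_mul h0)).2 hx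
    rw [hr₁] at this
    exact (Multiset.mem_filter.1 this).2
  have hr₂ : q₂.roots = q.roots.filter fun x => ¬ x < 0 := by
    have h1 : q.roots = s + q₂.roots := by rw [h, roots_mul h0, hr₁]
    have h2 : s + q.roots.filter (fun x => ¬ x < 0) = q.roots := Multiset.filter_add_not _ _
    exact (add_left_cancel (h2.trans h1)).symm
  have hq₂ : ∀ x < 0, q₂.eval x ≠ 0 := fun x hx h' => by
    have : x ∈ q₂.roots := (mem_roots (right_ne_zero_of_mul h0)).2 h'
    rw [hr₂] at this
    exact (Multiset.mem_filter.1 this).2 hx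
  refine ⟨q₁, q₂, by rw [mul_comm]; exact h.symm, hs, hneg, hq₂, ?_⟩
  refine IsCoprime.symm ?_
  refine Multiset.prod_induction (fun p => IsCoprime p q₂) _ (fun a b => IsCoprime.mul_left)
    isCoprime_one_left fun p hp => ?_
  obtain ⟨a, ha, rfl⟩ := Multiset.mem_map.1 hp
  rw [(irreducible_X_sub_C a).coprime_iff_not_dvd, dvd_iff_isRoot]
  exact hq₂ a (Multiset.mem_filter.1 ha).2

/-- The eigenvalues of a matrix are roots of every polynomial that annihilates it. -/
theorem eval_charpoly_ne_zero_of_aeval {K : Type*} [Field K] {m : Type*} [Fintype m]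
    [DecidableEq m] {M : Matrix m m K} {q : K[X]} (hq : aeval M q = 0) {x : K}
    (hx : q.eval x ≠ 0) : M.charpoly.eval x ≠ 0 := by
  have h := isUnit_sub_algebraMap_of_aeval_eq_zero hq hx
  rw [Matrix.eval_charpoly, ← isUnit_iff_ne_zero, ← Matrix.isUnit_iff_isUnit_det]
  have : Matrix.scalar m x - M = -(M - algebraMap K _ x) := by
    rw [neg_sub]; rfl
  rw [this]
  exact h.neg

/-- Decomposition of a real matrix with simple eigenvalue `1`: the eigenvector splits off. -/
theorem exists_splitting_simple_one {n : ℕ} (M : Matrix (Fin n) (Fin n) ℝ) (q : ℝ[X])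
    (hq : M.charpoly = (X - C 1) * q) (hq1 : q.eval 1 ≠ 0) :
    ∃ (k : ℕ) (B : Matrix (Fin k) (Fin k) ℝ), MatSim M (Matrix.fromBlocks (1 : Matrix (Fin 1) (Fin 1) ℝ) 0 0 B) ∧
      B.charpoly = q ∧ 1 + k = n := by
  have hcop : IsCoprime (X - C (1 : ℝ)) q := by
    rw [(irreducible_X_sub_C (1 : ℝ)).coprime_iff_not_dvd, dvd_iff_isRoot]
    exact hq1
  obtain ⟨a, k, A, B, hM, hA, hB⟩ := exists_matSim_fromBlocks M hcop
    (by rw [← hq]; exact Matrix.aeval_self_charpoly M)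
  have hA1 : A = 1 := by
    simpa [sub_eq_zero] using hA
  have hB1 := eval_charpoly_ne_zero_of_aeval hB hq1
  have hchar : (X - C 1) ^ a * B.charpoly = (X - C 1) * q := by
    rw [← hq, hM.charpoly_eq, Matrix.charpoly_fromBlocks_zero₁₂, hA1, Matrix.charpoly_one]
    simp
  -- Compare the multiplicity of the root `1` on both sides of `hchar`: it is `a` on the left, as
  -- `B` has no eigenvalue `1`, and one on the right.
  have ha : a = 1 := by
    rcases a with _ | _ | a
    · have := congrArg (eval 1) hchar
      simp at this
      exact absurd this hB1
    · rfl
    · rw [pow_succ', mul_assoc] at hchar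
      have h := mul_left_cancel₀ (X_sub_C_ne_zero 1) hchar
      have := congrArg (eval 1) h
      simp at this
      exact absurd this.symm hq1
  subst ha
  refine ⟨k, B, hA1 ▸ hM, ?_, ?_⟩
  · rw [pow_one] at hchar
    exact mul_left_cancel₀ (X_sub_C_ne_zero 1) hchar
  · simpa using hM.card_eq.symm

theorem list_count_eq_card_filter {α : Type*} [inst : BEq α] [LawfulBEq α] [DecidableEq α]
    (l : List α) (a : α) : l.count a = (Finset.univ.filter fun i => l.get i = a).card := by
  -- Any lawful boolean equality gives the same count, so the instance hidden in a given `count`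
  -- does not matter.
  have hinst : inst = instBEqOfDecidableEq := lawful_beq_subsingleton _ _
  subst hinst
  have h : Finset.univ.val.map l.get = (l : Multiset α) := by
    rw [Fin.univ_val_map]; simp
  rw [← Multiset.coe_count, ← h, Multiset.count_map]
  simp only [eq_comm (a := a)]
  rfl

theorem isJordanForm_matSim {n : ℕ} {M : Matrix (Fin n) (Fin n) ℝ} {l : List (ℂ × ℕ)}
    (h : IsJordanForm M l) : MatSim (M.map (algebraMap ℝ ℂ)) (jordanSum l.get) := h.2

/-- A real matrix is similar to a block diagonal matrix with two blocks: an exponential and minus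
an exponential; the size of the second block is determined by the Jordan form. -/
theorem exists_matSim_exp_neg_exp {n k : ℕ} (M : Matrix (Fin n) (Fin n) ℝ)
    (B : Matrix (Fin k) (Fin k) ℝ)
    (hM : MatSim M (Matrix.fromBlocks (1 : Matrix (Fin 1) (Fin 1) ℝ) 0 0 B))
    (hB0 : B.charpoly.eval 0 ≠ 0) (l : List (ℂ × ℕ)) (hl : IsJordanForm M l) :
    ∃ (m : ℕ) (M₁ : Matrix (Fin m) (Fin m) ℝ)
      (M₂ : Matrix (Fin (oddNegativeSize l)) (Fin (oddNegativeSize l)) ℝ),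
      MatSim B (Matrix.fromBlocks M₁ 0 0 M₂) ∧ HasMatrixLog M₁ ∧ HasMatrixLog (-M₂) := by
  classical
  obtain ⟨q₁, q₂, hq, hs, hneg, hq₂, hcop⟩ :=
    exists_mul_eq_of_neg_roots B.charpoly (Matrix.charpoly_monic B).ne_zero
  have hq₁0 : q₁ ≠ 0 := by
    rintro rfl
    exact (Matrix.charpoly_monic B).ne_zero (by rw [← hq, mul_zero])
  obtain ⟨g, k', G, N, hBGN, hG, hN⟩ := exists_matSim_fromBlocks B hcop
    (by rw [hq]; exact Matrix.aeval_self_charpoly B)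
  have hGlog : HasMatrixLog G := by
    refine hasMatrixLog_of_aeval q₂ hG fun x hx => ?_
    rcases hx.lt_or_eq with h | rfl
    · exact hq₂ x h
    · rw [← hq, eval_mul] at hB0
      exact left_ne_zero_of_mul hB0
  obtain ⟨c, b, hb, hNb⟩ := exists_matSim_jordanSum N q₁ hq₁0 hs hN
  obtain ⟨A, O, _, _, _, _, e, cA, cO, hinj, hbe, hodd⟩ := exists_pairing b
  have hcA : ∀ a, (cA a).1 < 0 := fun a => by
    have h1 : b (e (Sum.inl (Sum.inl a))) = cA a := congrFun hbe (Sum.inl (Sum.inl a))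
    rw [← h1]
    exact hneg _ (hb _).2
  have hcO : ∀ o, (cO o).1 < 0 ∧ 0 < (cO o).2 := fun o => by
    have h1 : b (e (Sum.inr o)) = cO o := congrFun hbe (Sum.inr o)
    rw [← h1]
    exact ⟨hneg _ (hb _).2, (hb _).1⟩
  have hJ : MatSim (jordanSum b) (Matrix.fromBlocks
      (Matrix.fromBlocks (jordanSum cA) 0 0 (jordanSum cA)) 0 0 (jordanSum cO)) := by
    have h1 := matSim_jordanSum_comp b e
    rw [hbe] at h1
    exact h1.trans ((matSim_jordanSum_sum _).trans
      (MatSim.fromBlocks (matSim_jordanSum_sum _) (MatSim.refl _)))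
  have hBfull : MatSim B (Matrix.fromBlocks (Matrix.fromBlocks G 0 0
      (Matrix.fromBlocks (jordanSum cA) 0 0 (jordanSum cA))) 0 0 (jordanSum cO)) :=
    hBGN.trans ((MatSim.fromBlocks (MatSim.refl G) (hNb.trans hJ)).trans (MatSim.sumAssoc _ _ _).symm)
  -- the number of blocks of each kind
  have hcount : ∀ (x : ℝ) (s : ℕ), x < 0 → 0 < s →
      (Odd (l.count ((x : ℂ), s)) ↔ ∃ o, cO o = (x, s)) := by
    intro x s hx hs0
    have h1 : MatSim M (Matrix.fromBlocks (Matrix.fromBlocks (1 : Matrix (Fin 1) (Fin 1) ℝ) 0 0 G)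
        0 0 (jordanSum b)) :=
      hM.trans ((MatSim.fromBlocks (MatSim.refl _)
        (hBGN.trans (MatSim.fromBlocks (MatSim.refl _) hNb))).trans (MatSim.sumAssoc _ _ _).symm)
    have h2 := h1.map (algebraMap ℝ ℂ)
    rw [Matrix.fromBlocks_map, jordanSum_map] at h2
    simp only [Matrix.map_zero _ (map_zero (algebraMap ℝ ℂ))] at h2
    -- Neither the split-off eigenvalue `1` nor `G` contributes to a negative eigenvalue `x`, so the
    -- blocks in `l` for `x` are counted by the Jordan form of `N` alone.
    have hunit : IsUnit ((Matrix.fromBlocks (1 : Matrix (Fin 1) (Fin 1) ℝ) 0 0 G).map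
        (algebraMap ℝ ℂ) - (x : ℂ) • (1 : Matrix (Fin 1 ⊕ Fin g) (Fin 1 ⊕ Fin g) ℂ)) := by
      have h3 : ((Matrix.fromBlocks (1 : Matrix (Fin 1) (Fin 1) ℝ) 0 0 G).charpoly).eval x ≠ 0 := by
        rw [Matrix.charpoly_fromBlocks_zero₁₂, eval_mul, Matrix.charpoly_one]
        refine mul_ne_zero ?_ (eval_charpoly_ne_zero_of_aeval hG (hq₂ x hx))
        simp only [eval_pow, eval_sub, eval_X, eval_one]
        exact pow_ne_zero _ (by linarith)
      rw [Matrix.eval_charpoly, ← isUnit_iff_ne_zero, ← Matrix.isUnit_iff_isUnit_det] at h3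
      have h4 := (h3.map (algebraMap ℝ ℂ).mapMatrix).neg
      convert! h4 using 1
      ext i j
      by_cases hij : i = j <;>
        simp [Matrix.scalar_apply, hij]
    have h5 := card_filter_jordan_eq _ l.get (fun i => ((algebraMap ℝ ℂ) (b i).1, (b i).2))
      _ (x : ℂ) (isJordanForm_matSim hl) h2 hunit s hs0
    rw [hodd, list_count_eq_card_filter]
    have h6 : (Finset.univ.filter fun i => (((algebraMap ℝ ℂ) (b i).1, (b i).2) : ℂ × ℕ) =
        ((x : ℂ), s)) = Finset.univ.filter fun i => b i = (x, s) := by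
      ext i
      simp [Prod.ext_iff]
    rw [h6] at h5
    convert! Iff.rfl using 2
    convert h5.symm using 2
  have hsize : Fintype.card (Σ o, Fin (cO o).2) = oddNegativeSize l := by
    rw [Fintype.card_sigma]
    simp only [Fintype.card_fin]
    let φ : O → ℂ × ℕ := fun o => (((cO o).1 : ℂ), (cO o).2)
    have hφ : Function.Injective φ := by
      intro o o' h
      simp only [φ, Prod.mk.injEq, Complex.ofReal_inj] at h
      exact hinj (Prod.ext h.1 h.2)
    -- The blocks summed in `oddNegativeSize l` are exactly the unpaired blocks, each once.
    have himage : l.toFinset.filter (fun b => (b.1.im = 0 ∧ b.1.re < 0) ∧ Odd (l.count b)) =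
        Finset.univ.image φ := by
      ext ⟨z, s⟩
      simp only [Finset.mem_filter, List.mem_toFinset, Finset.mem_image, Finset.mem_univ, true_and]
      constructor
      · rintro ⟨hz, ⟨him, hre⟩, ho⟩
        have hz' : z = ((z.re : ℝ) : ℂ) := Complex.ext (by simp) (by simp [him])
        rw [hz'] at ho
        obtain ⟨o, ho⟩ := (hcount z.re s hre (hl.1 _ hz)).1 ho
        refine ⟨o, ?_⟩
        simp only [φ, ho]
        rw [← hz']
      · rintro ⟨o, ho⟩
        simp only [φ, Prod.mk.injEq] at ho
        obtain ⟨rfl, rfl⟩ := ho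
        have h1 := (hcount (cO o).1 (cO o).2 (hcO o).1 (hcO o).2).2 ⟨o, rfl⟩
        refine ⟨List.count_pos_iff.1 h1.pos, ⟨by simp, by simpa using (hcO o).1⟩, h1⟩
    rw [oddNegativeSize]
    trans ∑ b ∈ Finset.univ.image φ, b.2
    · rw [Finset.sum_image fun _ _ _ _ h => hφ h]
    · rw [← himage]
  -- `M₁` collects `G` and the paired negative blocks, `M₂` the unpaired ones.
  let e₁ := (Fintype.equivFin (Fin g ⊕ ((Σ a, Fin (cA a).2) ⊕ (Σ a, Fin (cA a).2)))).symm
  let e₂ := (Fintype.equivFinOfCardEq hsize).symm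
  refine ⟨_, _, _, hBfull.trans (MatSim.fromBlocks (MatSim.submatrix _ e₁)
    (MatSim.submatrix _ e₂)), ?_, ?_⟩
  · exact (MatSim.submatrix _ e₁).hasMatrixLog
      (hGlog.fromBlocks (hasMatrixLog_neg_jordanSum cA hcA).fromBlocks_neg)
  · exact (MatSim.submatrix _ e₂).neg.hasMatrixLog (hasMatrixLog_neg_jordanSum cO fun o => (hcO o).1)

/-- Real Floquet normal form of a matrix `M` with simple eigenvalue `1` and eigenvector `e`. -/
theorem exists_real_floquet_form {n : ℕ} (M : Matrix (Fin n) (Fin n) ℝ) (hM : IsUnit M)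
    (e : Fin n → ℝ) (he0 : e ≠ 0) (he : M *ᵥ e = e) (q : ℝ[X])
    (hq : M.charpoly = (X - C 1) * q) (hq1 : q.eval 1 ≠ 0) (l : List (ℂ × ℕ))
    (hl : IsJordanForm M l) :
    ∃ (m : ℕ) (L₁ : Matrix (Fin m) (Fin m) ℝ)
      (L₂ : Matrix (Fin (oddNegativeSize l)) (Fin (oddNegativeSize l)) ℝ)
      (S : Matrix (Fin n) (Fin m ⊕ Fin (oddNegativeSize l)) ℝ),
      m + oddNegativeSize l + 1 = n ∧
      (∀ (σ : ℝ) (h : Fin m ⊕ Fin (oddNegativeSize l) → ℝ), σ • e + S *ᵥ h = 0 → σ = 0 ∧ h = 0) ∧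
      M * S = S * Matrix.fromBlocks (NormedSpace.exp L₁) 0 0 (-NormedSpace.exp L₂) ∧
      q = (Matrix.fromBlocks (NormedSpace.exp L₁) 0 0 (-NormedSpace.exp L₂)).charpoly := by
  obtain ⟨k, B, hMB, hBq, hk⟩ := exists_splitting_simple_one M q hq hq1
  have hB0 : B.charpoly.eval 0 ≠ 0 := by
    rw [hBq]
    rw [Matrix.isUnit_iff_isUnit_det, isUnit_iff_ne_zero] at hM
    have h1 : M.charpoly.eval 0 ≠ 0 := by
      rw [Matrix.eval_charpoly]
      simpa [Matrix.det_neg] using hM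
    rw [hq, eval_mul] at h1
    exact right_ne_zero_of_mul h1
  obtain ⟨m, M₁, M₂, hsim, ⟨L₁, rfl⟩, L₂, hL₂⟩ := exists_matSim_exp_neg_exp M B hMB hB0 l hl
  have hM₂ : M₂ = -NormedSpace.exp L₂ := by rw [hL₂, neg_neg]
  subst hM₂
  have hmk : k = m + oddNegativeSize l := by simpa using hsim.card_eq
  have hchar := hsim.charpoly_eq
  obtain ⟨P, Q, hPQ, hQP, hMeq⟩ := hMB
  obtain ⟨P', Q', hPQ', hQP', hBeq⟩ := hsim
  -- The eigenvector in block coordinates. Its second component vanishes because `1` is not an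
  -- eigenvalue of `B`, so `e` is a nonzero multiple of the first column of `P`, and the other
  -- columns span an invariant complement.
  let y := Q *ᵥ e
  have hy : Matrix.fromBlocks (1 : Matrix (Fin 1) (Fin 1) ℝ) 0 0 B *ᵥ y = y := by
    have h1 : Q * M = Matrix.fromBlocks (1 : Matrix (Fin 1) (Fin 1) ℝ) 0 0 B * Q := by
      rw [hMeq, ← Matrix.mul_assoc, ← Matrix.mul_assoc, hQP, Matrix.one_mul]
    simp only [y]
    rw [Matrix.mulVec_mulVec, ← h1, ← Matrix.mulVec_mulVec, he]
  have hy2 : y ∘ Sum.inr = 0 := by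
    have h1 : IsUnit (Matrix.scalar (Fin k) (1 : ℝ) - B) := by
      rw [Matrix.isUnit_iff_isUnit_det, ← Matrix.eval_charpoly, hBq]
      exact isUnit_iff_ne_zero.2 hq1
    have h2 : B *ᵥ (y ∘ Sum.inr) = y ∘ Sum.inr := by
      rw [Matrix.fromBlocks_mulVec] at hy
      funext i
      simpa using congrFun hy (Sum.inr i)
    refine Matrix.mulVec_injective_of_isUnit h1 ?_
    rw [Matrix.mulVec_zero, Matrix.sub_mulVec, h2, map_one, Matrix.one_mulVec, sub_self]
  have hey : e = P *ᵥ y := by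
    simp only [y]
    rw [Matrix.mulVec_mulVec, hPQ, Matrix.one_mulVec]
  have hy0 : y (Sum.inl 0) ≠ 0 := by
    intro h
    apply he0
    have : y = 0 := by
      ext (i | i)
      · rw [Fin.fin_one_eq_zero i]; exact h
      · exact congrFun hy2 i
    rw [hey, this, Matrix.mulVec_zero]
  let S₀ : Matrix (Fin n) (Fin k) ℝ := P.submatrix id Sum.inr
  have hS₀ : ∀ h, S₀ *ᵥ h = P *ᵥ Sum.elim (0 : Fin 1 → ℝ) h := by
    intro h
    ext i
    simp [S₀, Matrix.mulVec, dotProduct]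
  refine ⟨m, L₁, L₂, S₀ * P', by omega, ?_, ?_, by rw [← hBq, hchar]⟩
  · intro σ h h0
    rw [← Matrix.mulVec_mulVec, hS₀, hey, ← Matrix.mulVec_smul, ← Matrix.mulVec_add] at h0
    have h1 := congrArg (fun v => Q *ᵥ v) h0
    simp only [Matrix.mulVec_mulVec, hQP, Matrix.one_mulVec, Matrix.mulVec_zero] at h1
    have h2 := congrFun h1 (Sum.inl 0)
    simp only [Pi.add_apply, Pi.smul_apply, Sum.elim_inl, Pi.zero_apply, add_zero, smul_eq_mul,
      mul_eq_zero, hy0, or_false] at h2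
    refine ⟨h2, ?_⟩
    rw [h2, zero_smul, zero_add] at h1
    have h3 : P' *ᵥ h = 0 := funext fun i => congrFun h1 (Sum.inr i)
    have h4 := congrArg (fun v => Q' *ᵥ v) h3
    simpa only [Matrix.mulVec_mulVec, hQP', Matrix.one_mulVec, Matrix.mulVec_zero] using h4
  · have h1 : M * P = P * Matrix.fromBlocks (1 : Matrix (Fin 1) (Fin 1) ℝ) 0 0 B := by
      rw [hMeq, Matrix.mul_assoc, hQP, Matrix.mul_one]
    have h2 : M * S₀ = S₀ * B := by
      ext i j
      have := congrFun (congrFun h1 i) (Sum.inr j)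
      simpa [Matrix.mul_apply, S₀] using this
    rw [← Matrix.mul_assoc, h2, hBeq, Matrix.mul_assoc, Matrix.mul_assoc, Matrix.mul_assoc,
      Matrix.mul_assoc, hQP', Matrix.mul_one]

end RealFloquet

/-! ### Eigenvalues of exponentials, with multiplicity. -/

section ExpEigenvalues

open Polynomial

attribute [local instance] Matrix.linftyOpNormedRing Matrix.linftyOpNormedAlgebra

theorem MatSim.smul_exp {m n : Type*} [Fintype m] [Fintype n] [DecidableEq m] [DecidableEq n]
    {M : Matrix m m ℂ} {N : Matrix n n ℂ} (h : MatSim M N) (c t : ℂ) :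
    MatSim (c • NormedSpace.exp (t • M)) (c • NormedSpace.exp (t • N)) := by
  obtain ⟨P, Q, h1, h2, rfl⟩ := h
  let f : Matrix n n ℂ →+* Matrix m m ℂ :=
    { toFun := fun X => P * X * Q
      map_one' := by rw [Matrix.mul_one, h1]
      map_zero' := by simp
      map_add' := fun X Y => by rw [Matrix.mul_add, Matrix.add_mul]
      map_mul' := fun X Y => by
        calc P * (X * Y) * Q = P * (X * (1 : Matrix n n ℂ) * Y) * Q := by rw [Matrix.mul_one]
          _ = P * X * Q * (P * Y * Q) := by rw [← h2]; simp only [Matrix.mul_assoc] }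
  have hf : Continuous f := by
    change Continuous fun X : Matrix n n ℂ => P * X * Q
    fun_prop
  have h3 : P * NormedSpace.exp (t • N) * Q = NormedSpace.exp (P * (t • N) * Q) :=
    NormedSpace.map_exp f hf (t • N)
  have h4 : t • (P * N * Q) = P * (t • N) * Q := by
    rw [Matrix.mul_smul, Matrix.smul_mul]
  exact ⟨P, Q, h1, h2, by rw [h4, ← h3, Matrix.mul_smul, Matrix.smul_mul]⟩

/-- Triangularization of complex matrices. -/
theorem exists_matSim_isUpperTriangular {n : ℕ} (M : Matrix (Fin n) (Fin n) ℂ) :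
    ∃ N : Matrix (Fin n) (Fin n) ℂ, N.IsUpperTriangular ∧ MatSim M N := by
  obtain ⟨k, b, -, h⟩ := exists_matSim_jordanSum M M.charpoly (Matrix.charpoly_monic M).ne_zero
    (IsAlgClosed.splits _) (Matrix.aeval_self_charpoly M)
  -- Enumerating the indices lexicographically, by block and then inside the block, turns the Jordan
  -- matrix into an upper triangular one.
  have hcard : Fintype.card (Σₗ i, Fin (b i).2) = n :=
    (Fintype.card_congr ofLex).trans (by simpa using h.card_eq.symm)
  let e := Fintype.orderIsoFinOfCardEq (Σₗ i, Fin (b i).2) hcard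
  refine ⟨(jordanSum b).submatrix (fun i => ofLex (e i)) fun i => ofLex (e i), ?_,
    h.trans (MatSim.submatrix _ (e.toEquiv.trans ofLex))⟩
  intro i j hij
  have h1 : e j < e i := e.lt_iff_lt.2 hij
  rw [Matrix.submatrix_apply]
  generalize hx : e i = x at h1
  generalize hy : e j = y at h1
  obtain ⟨x₁, x₂⟩ := x
  obtain ⟨y₁, y₂⟩ := y
  change jordanSum b ⟨x₁, x₂⟩ ⟨y₁, y₂⟩ = 0
  simp only [jordanSum]
  by_cases hxy : x₁ = y₁
  · subst hxy
    rw [Matrix.blockDiagonal'_apply_eq]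
    apply jordanBlockOver_isUpperTriangular
    rcases Sigma.lex_iff.1 h1 with h2 | ⟨h2, h3⟩
    · exact absurd h2 (lt_irrefl _)
    · exact h3
  · exact Matrix.blockDiagonal'_apply_ne _ _ _ hxy

theorem Matrix.IsUpperTriangular.pow_apply_self {n : ℕ} {N : Matrix (Fin n) (Fin n) ℂ}
    (hN : N.IsUpperTriangular) (i : Fin n) (k : ℕ) :
    (N ^ k).IsUpperTriangular ∧ (N ^ k) i i = N i i ^ k := by
  induction k with
  | zero => exact ⟨by rw [pow_zero]; exact Matrix.blockTriangular_one, by simp⟩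
  | succ k ih =>
    refine ⟨by rw [pow_succ]; exact ih.1.mul hN, ?_⟩
    rw [pow_succ, pow_succ, Matrix.mul_apply, Finset.sum_eq_single i, ih.2]
    · intro j _ hj
      rcases lt_or_gt_of_ne hj with h | h
      · rw [ih.1 h, zero_mul]
      · rw [hN h, mul_zero]
    · simp

theorem Matrix.IsUpperTriangular.exp_apply_self {n : ℕ} {N : Matrix (Fin n) (Fin n) ℂ}
    (hN : N.IsUpperTriangular) (i : Fin n) :
    NormedSpace.exp N i i = Complex.exp (N i i) := by
  have h1 := NormedSpace.exp_series_hasSum_exp' (𝕂 := ℂ) N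
  have h2 := (Pi.hasSum.1 (Pi.hasSum.1 h1 i)) i
  have h3 := NormedSpace.exp_series_hasSum_exp' (𝕂 := ℂ) (N i i)
  rw [← Complex.exp_eq_exp_ℂ] at h3
  refine h2.unique ?_
  have h4 : (fun k : ℕ => ((k.factorial : ℂ)⁻¹ • N ^ k) i i) =
      fun k : ℕ => (k.factorial : ℂ)⁻¹ • N i i ^ k := by
    funext k
    rw [Matrix.smul_apply, (hN.pow_apply_self i k).2]
  exact h4 ▸ h3

theorem Matrix.IsUpperTriangular.roots_charpoly {n : ℕ} {N : Matrix (Fin n) (Fin n) ℂ}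
    (hN : N.IsUpperTriangular) :
    N.charpoly.roots = Finset.univ.val.map fun i => N i i := by
  rw [Matrix.charpoly_of_isUpperTriangular _ hN]
  have := roots_multiset_prod_X_sub_C (Finset.univ.val.map fun i => N i i)
  rw [Multiset.map_map] at this
  exact this

/-- After triangularization the eigenvalues are the diagonal entries, and the exponential acts on
them entry by entry. This keeps the multiplicities. -/
theorem roots_charpoly_smul_exp {n : ℕ} (A : Matrix (Fin n) (Fin n) ℂ) (c t : ℂ) :
    (c • NormedSpace.exp (t • A)).charpoly.roots =
      A.charpoly.roots.map fun μ => c * Complex.exp (t * μ) := by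
  obtain ⟨N, hN, h⟩ := exists_matSim_isUpperTriangular A
  have htN : (t • N).IsUpperTriangular := fun i j hij => by
    rw [Matrix.smul_apply, hN hij, smul_zero]
  have hE : (c • NormedSpace.exp (t • N)).IsUpperTriangular := fun i j hij => by
    rw [Matrix.smul_apply, Matrix.BlockTriangular.exp htN hij, smul_zero]
  rw [(h.smul_exp c t).charpoly_eq, h.charpoly_eq, hE.roots_charpoly, hN.roots_charpoly,
    Multiset.map_map]
  refine Multiset.map_congr rfl fun i _ => ?_
  simp [htN.exp_apply_self]

theorem map_ofReal_exp {n : ℕ} (A : Matrix (Fin n) (Fin n) ℝ) :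
    (NormedSpace.exp A).map (algebraMap ℝ ℂ) = NormedSpace.exp (A.map (algebraMap ℝ ℂ)) := by
  have hf : Continuous ((algebraMap ℝ ℂ).mapMatrix : Matrix (Fin n) (Fin n) ℝ →+* _) := by
    change Continuous fun X : Matrix (Fin n) (Fin n) ℝ => X.map (algebraMap ℝ ℂ)
    exact Continuous.matrix_map continuous_id Complex.continuous_ofReal
  exact NormedSpace.map_exp (algebraMap ℝ ℂ).mapMatrix hf A

/-- Spectral mapping, with multiplicities, for the logarithms of the moduli of the eigenvalues. -/
theorem aroots_charpoly_smul_exp {n : ℕ} (A : Matrix (Fin n) (Fin n) ℝ) {T c : ℝ} (hT : T ≠ 0)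
    (hc : |c| = 1) :
    (A.charpoly.aroots ℂ).map Complex.re =
      ((c • NormedSpace.exp (T • A)).charpoly.aroots ℂ).map fun μ => 1 / T * Real.log ‖μ‖ := by
  have h1 : (c • NormedSpace.exp (T • A)).charpoly.aroots ℂ =
      ((c : ℂ) • NormedSpace.exp ((T : ℂ) • A.map (algebraMap ℝ ℂ))).charpoly.roots := by
    rw [aroots, ← Matrix.charpoly_map]
    congr 2
    have h2 : (T • A).map (algebraMap ℝ ℂ) = (T : ℂ) • A.map (algebraMap ℝ ℂ) := by
      ext i j; simp
    rw [← h2, ← map_ofReal_exp]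
    ext i j; simp
  rw [h1, roots_charpoly_smul_exp, Multiset.map_map, aroots, ← Matrix.charpoly_map]
  refine Multiset.map_congr rfl fun μ _ => ?_
  simp only [Function.comp_apply, norm_mul, Complex.norm_real, Real.norm_eq_abs, hc, one_mul,
    Complex.norm_exp, Real.log_exp]
  simp [hT]

/-- The eigenvalues of a real Floquet exponent and those of the multiplier matrix. -/
theorem aroots_charpoly_fromBlocks_exp {m d : ℕ} (H₁ : Matrix (Fin m) (Fin m) ℝ)
    (H₂ : Matrix (Fin d) (Fin d) ℝ) {T : ℝ} (hT : T ≠ 0) :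
    ((Matrix.fromBlocks H₁ 0 0 H₂).charpoly.aroots ℂ).map Complex.re =
      ((Matrix.fromBlocks (NormedSpace.exp (T • H₁)) 0 0 (-NormedSpace.exp (T • H₂))).charpoly.aroots
        ℂ).map fun μ => 1 / T * Real.log ‖μ‖ := by
  -- The two blocks are the cases `c = 1` and `c = -1`; the sign is invisible to the modulus.
  rw [Matrix.charpoly_fromBlocks_zero₁₂, Matrix.charpoly_fromBlocks_zero₁₂, aroots_mul, aroots_mul,
    Multiset.map_add, Multiset.map_add, aroots_charpoly_smul_exp H₁ hT abs_one,
    aroots_charpoly_smul_exp H₂ hT (c := -1) (by simp), one_smul, neg_one_smul]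
  · exact mul_ne_zero (Matrix.charpoly_monic _).ne_zero (Matrix.charpoly_monic _).ne_zero
  · exact mul_ne_zero (Matrix.charpoly_monic _).ne_zero (Matrix.charpoly_monic _).ne_zero

end ExpEigenvalues

/-! ### Linear differential equations: existence, uniqueness, regularity. -/

section LinearODE

/-- The terms of the Dyson series of `x' = A(t) x`. -/
noncomputable def dysonTerm {𝔸 : Type*} [NormedRing 𝔸] [NormedAlgebra ℝ 𝔸] (A : ℝ → 𝔸) :
    ℕ → ℝ → 𝔸
  | 0 => fun _ => 1
  | k + 1 => fun t => ∫ s in (0 : ℝ)..t, A s * dysonTerm A k s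

section Dyson

variable {𝔸 : Type*} [NormedRing 𝔸] [NormedAlgebra ℝ 𝔸] [CompleteSpace 𝔸] {A : ℝ → 𝔸}

omit [CompleteSpace 𝔸] in
theorem continuous_dysonTerm (hA : Continuous A) (k : ℕ) : Continuous (dysonTerm A k) := by
  induction k with
  | zero => exact continuous_const
  | succ k ih =>
    exact intervalIntegral.continuous_primitive
      (fun a b => (hA.mul ih).intervalIntegrable a b) 0

theorem hasDerivAt_dysonTerm_succ (hA : Continuous A) (k : ℕ) (t : ℝ) :
    HasDerivAt (dysonTerm A (k + 1)) (A t * dysonTerm A k t) t :=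
  ((hA.mul (continuous_dysonTerm hA k)).integral_hasStrictDerivAt 0 t).hasDerivAt

/-- The bound at order `k` is, up to the factor `L`, the derivative of the bound at order `k + 1`.
The comparison principle runs forward in time, so negative times are treated by reflection. -/
theorem norm_dysonTerm_le (hA : Continuous A) {L : ℝ} (hL : ∀ t, ‖A t‖ ≤ L) (k : ℕ) {x : ℝ}
    (hx : 0 ≤ x) :
    ‖dysonTerm A k x‖ ≤ ‖(1 : 𝔸)‖ * ((L * x) ^ k / k.factorial) ∧
      ‖dysonTerm A k (-x)‖ ≤ ‖(1 : 𝔸)‖ * ((L * x) ^ k / k.factorial) := by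
  have hL0 : 0 ≤ L := (norm_nonneg _).trans (hL 0)
  induction k generalizing x with
  | zero => simp [dysonTerm]
  | succ k ih =>
    have hB : ∀ y : ℝ, HasDerivAt
        (fun y : ℝ => ‖(1 : 𝔸)‖ * ((L * y) ^ (k + 1) / (k + 1).factorial))
        (L * (‖(1 : 𝔸)‖ * ((L * y) ^ k / k.factorial))) y := by
      intro y
      have h1 : HasDerivAt (fun y : ℝ => L * y) L y := by
        simpa using (hasDerivAt_id y).const_mul L
      have h2 := ((h1.pow (k + 1)).div_const ((k + 1).factorial : ℝ)).const_mul ‖(1 : 𝔸)‖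
      convert! h2 using 1
      rw [Nat.factorial_succ]
      push_cast
      have := Nat.cast_ne_zero (R := ℝ).2 k.factorial_ne_zero
      have : (k : ℝ) + 1 ≠ 0 := by positivity
      field_simp
    have h0 : dysonTerm A (k + 1) 0 = 0 := by simp [dysonTerm]
    constructor
    · refine image_norm_le_of_norm_deriv_right_le_deriv_boundary
        (continuous_dysonTerm hA (k + 1)).continuousOn
        (fun y _ => (hasDerivAt_dysonTerm_succ hA k y).hasDerivWithinAt) ?_ hB ?_ ⟨hx, le_rfl⟩
      · simp [h0]
      · intro y hy
        exact (norm_mul_le _ _).trans (mul_le_mul (hL y) (ih hy.1).1 (norm_nonneg _) hL0)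
    · have hneg : ∀ y, HasDerivAt (fun y => dysonTerm A (k + 1) (-y))
          (-(A (-y) * dysonTerm A k (-y))) y := fun y => by
        have := (hasDerivAt_dysonTerm_succ hA k (-y)).scomp y (hasDerivAt_neg y)
        simpa using! this
      refine image_norm_le_of_norm_deriv_right_le_deriv_boundary
        (f := fun y => dysonTerm A (k + 1) (-y))
        ((continuous_dysonTerm hA (k + 1)).comp continuous_neg).continuousOn
        (fun y _ => (hneg y).hasDerivWithinAt) ?_ hB ?_ ⟨hx, le_rfl⟩
      · simp [h0]
      · intro y hy
        rw [norm_neg]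
        exact (norm_mul_le _ _).trans (mul_le_mul (hL _) (ih hy.1).2 (norm_nonneg _) hL0)

theorem norm_dysonTerm_le_abs (hA : Continuous A) {L : ℝ} (hL : ∀ t, ‖A t‖ ≤ L) (k : ℕ) (x : ℝ) :
    ‖dysonTerm A k x‖ ≤ ‖(1 : 𝔸)‖ * ((L * |x|) ^ k / k.factorial) := by
  have h := norm_dysonTerm_le hA hL k (abs_nonneg x)
  rcases abs_choice x with hx | hx
  · rw [hx] at h ⊢; exact h.1
  · have h2 := h.2
    rwa [show -|x| = x by rw [hx, neg_neg]] at h2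

/-- A linear system with bounded continuous coefficients has a solution operator on the whole
line. -/
theorem exists_solution_operator (hA : Continuous A) {L : ℝ} (hL : ∀ t, ‖A t‖ ≤ L) :
    ∃ Φ : ℝ → 𝔸, Φ 0 = 1 ∧ ∀ t, HasDerivAt Φ (A t * Φ t) t := by
  have hL0 : 0 ≤ L := (norm_nonneg _).trans (hL 0)
  have hsum : ∀ x, Summable fun k => dysonTerm A k x := fun x =>
    Summable.of_norm_bounded ((Real.summable_pow_div_factorial (L * |x|)).mul_left _)
      fun k => norm_dysonTerm_le_abs hA hL k x
  refine ⟨fun t => ∑' k, dysonTerm A k t, ?_, fun t => ?_⟩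
  · change ∑' k, dysonTerm A k 0 = 1
    rw [tsum_eq_single 0]
    · rfl
    · intro k hk
      obtain ⟨k, rfl⟩ := Nat.exists_eq_succ_of_ne_zero hk
      simp [dysonTerm]
  -- The derivatives of the terms. The constant term contributes `0`, and after the shift of index
  -- the rest sums to `A` times the series.
  · let g' : ℕ → ℝ → 𝔸 := fun k => Nat.rec (fun _ => 0) (fun k _ y => A y * dysonTerm A k y) k
    have hg : ∀ k y, HasDerivAt (dysonTerm A k) (g' k y) y := by
      intro k y
      cases k with
      | zero => exact hasDerivAt_const y 1
      | succ k => exact hasDerivAt_dysonTerm_succ hA k y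
    let R := |t| + 1
    let u : ℕ → ℝ := fun k => Nat.rec 0
      (fun k _ => L * (‖(1 : 𝔸)‖ * ((L * R) ^ k / k.factorial))) k
    have hu : Summable u := by
      rw [← summable_nat_add_iff 1]
      exact ((Real.summable_pow_div_factorial (L * R)).mul_left _).mul_left _
    have hbound : ∀ k y, y ∈ Metric.ball (0 : ℝ) R → ‖g' k y‖ ≤ u k := by
      intro k y hy
      cases k with
      | zero => simp [g', u]
      | succ k =>
        have hy' : |y| ≤ R := by
          rw [mem_ball_zero_iff, Real.norm_eq_abs] at hy
          exact hy.le
        refine (norm_mul_le _ _).trans (mul_le_mul (hL y) ?_ (norm_nonneg _) hL0)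
        refine (norm_dysonTerm_le_abs hA hL k y).trans ?_
        gcongr
    have ht : t ∈ Metric.ball (0 : ℝ) R := by simp [R]
    have h0 : (0 : ℝ) ∈ Metric.ball (0 : ℝ) R := by simp [R]; positivity
    have h := hasDerivAt_tsum_of_isPreconnected hu Metric.isOpen_ball
      (convex_ball (0 : ℝ) R).isPreconnected (fun k y _ => hg k y) hbound h0 (hsum 0) ht
    have hs' : Summable fun k => g' k t :=
      Summable.of_norm_bounded hu fun k => hbound k t ht
    have : ∑' k, g' k t = A t * ∑' k, dysonTerm A k t := by
      rw [hs'.tsum_eq_zero_add, ← (hsum t).tsum_mul_left]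
      simp [g']
    rwa [this] at h

end Dyson

variable {E : Type*} [NormedAddCommGroup E] [NormedSpace ℝ E]

/-- Uniqueness for linear systems with bounded coefficients. -/
theorem linear_ode_unique {A : ℝ → E →L[ℝ] E} {L : ℝ} (hL : ∀ t, ‖A t‖ ≤ L) {y z : ℝ → E}
    (hy : ∀ t, HasDerivAt y (A t (y t)) t) (hz : ∀ t, HasDerivAt z (A t (z t)) t) {t₀ : ℝ}
    (h : y t₀ = z t₀) : y = z := by
  refine ODE_solution_unique_univ (v := fun t x => A t x) (s := fun _ => Set.univ)
    (K := L.toNNReal) (t₀ := t₀) (fun t => ?_) (fun t => ⟨hy t, trivial⟩)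
    (fun t => ⟨hz t, trivial⟩) h
  refine ((A t).lipschitz.weaken ?_).lipschitzOnWith
  rw [← NNReal.coe_le_coe, coe_nnnorm]
  exact (hL t).trans (Real.le_coe_toNNReal L)

/-- Bootstrap: `y' = A y` is as smooth as the less smooth of `A` and `y`, so `y` ends one class
above `A`. -/
theorem linear_ode_contDiff {A : ℝ → E →L[ℝ] E} {k : ℕ} (hA : ContDiff ℝ k A) {y : ℝ → E}
    (hy : ∀ t, HasDerivAt y (A t (y t)) t) : ContDiff ℝ (k + 1 : ℕ) y := by
  induction k with
  | zero =>
    have hcont : Continuous y := continuous_iff_continuousAt.2 fun t => (hy t).continuousAt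
    rw [zero_add, Nat.cast_one, contDiff_one_iff_deriv]
    refine ⟨fun t => (hy t).differentiableAt, ?_⟩
    rw [show deriv y = fun t => A t (y t) from funext fun t => (hy t).deriv]
    exact hA.continuous.clm_apply hcont
  | succ k ih =>
    have h1 : ContDiff ℝ (k + 1 : ℕ) y := ih (hA.of_le (by norm_cast; omega))
    rw [show ((k + 1 + 1 : ℕ) : WithTop ℕ∞) = ((k + 1 : ℕ) : WithTop ℕ∞) + 1 by norm_cast,
      contDiff_succ_iff_deriv]
    refine ⟨fun t => (hy t).differentiableAt, by simp, ?_⟩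
    rw [show deriv y = fun t => A t (y t) from funext fun t => (hy t).deriv]
    exact hA.clm_apply h1

theorem contDiff_of_nat_succ_le {F G : Type*} [NormedAddCommGroup F] [NormedSpace ℝ F]
    [NormedAddCommGroup G] [NormedSpace ℝ G] {y : F → G} {r : ℕ∞}
    (h : ∀ k : ℕ, ((k + 1 : ℕ) : ℕ∞) ≤ r → ContDiff ℝ (k + 1 : ℕ) y) (hr : 1 ≤ r) :
    ContDiff ℝ r y := by
  induction r with
  | top => exact contDiff_infty.2 fun k => (h k le_top).of_le (by norm_cast; omega)
  | coe r =>
    have h1 : 1 ≤ r := by exact_mod_cast hr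
    obtain ⟨k, rfl⟩ : ∃ k, r = k + 1 := ⟨r - 1, by omega⟩
    exact h k le_rfl

end LinearODE

/-! ### Smoothness and periodicity along the orbit. -/

section Orbit

variable {E : Type*} [NormedAddCommGroup E] [NormedSpace ℝ E] {f : E → E} {D : Set E} {φ : ℝ → E}
  {r : ℕ∞}

theorem contDiff_integralCurve (hD : IsOpen D) (hf : ContDiffOn ℝ r f D) (hφD : ∀ t, φ t ∈ D)
    (hφ : ∀ t, HasDerivAt φ (f (φ t)) t) (hr : 1 ≤ r) : ContDiff ℝ r φ := by
  have hcont : Continuous φ := continuous_iff_continuousAt.2 fun t => (hφ t).continuousAt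
  have hderiv : deriv φ = fun t => f (φ t) := funext fun t => (hφ t).deriv
  have hcomp : ∀ k : ℕ, (k : ℕ∞) ≤ r → ContDiff ℝ k φ → ContDiff ℝ k fun t => f (φ t) := by
    intro k hk h
    rw [contDiff_iff_contDiffAt]
    intro t
    have h1 : ContDiffAt ℝ k f (φ t) :=
      (hf.contDiffAt (hD.mem_nhds (hφD t))).of_le (by exact_mod_cast hk)
    exact h1.comp t h.contDiffAt
  refine contDiff_of_nat_succ_le (fun k hk => ?_) hr
  induction k with
  | zero =>
    rw [zero_add, Nat.cast_one, contDiff_one_iff_deriv, hderiv]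
    exact ⟨fun t => (hφ t).differentiableAt, (hcomp 0 (zero_le) (contDiff_zero.2 hcont)).continuous⟩
  | succ k ih =>
    have hk' : ((k + 1 : ℕ) : ℕ∞) ≤ r := le_trans (by norm_cast; omega) hk
    rw [show ((k + 1 + 1 : ℕ) : WithTop ℕ∞) = ((k + 1 : ℕ) : WithTop ℕ∞) + 1 by norm_cast,
      contDiff_succ_iff_deriv, hderiv]
    exact ⟨fun t => (hφ t).differentiableAt, by simp, hcomp _ hk' (ih hk')⟩

theorem contDiff_fderiv_comp (hD : IsOpen D) (hf : ContDiffOn ℝ r f D) (hφD : ∀ t, φ t ∈ D)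
    (hφ : ContDiff ℝ r φ) {k : ℕ} (hk : ((k + 1 : ℕ) : ℕ∞) ≤ r) :
    ContDiff ℝ k fun t => fderiv ℝ f (φ t) := by
  rw [contDiff_iff_contDiffAt]
  intro t
  have h1 : ContDiffAt ℝ r f (φ t) := hf.contDiffAt (hD.mem_nhds (hφD t))
  have h2 : ContDiffAt ℝ k (fderiv ℝ f) (φ t) := h1.fderiv_right (by exact_mod_cast hk)
  have h3 : ContDiffAt ℝ k φ t :=
    hφ.contDiffAt.of_le (by exact_mod_cast (le_trans (by norm_cast; omega) hk))
  exact h2.comp t h3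

/-- The solutions of the variational equation of a `C^r` field along an integral curve are
`C^r`. -/
theorem contDiff_variational_solution (hD : IsOpen D) (hf : ContDiffOn ℝ r f D)
    (hφD : ∀ t, φ t ∈ D) (hφ : ∀ t, HasDerivAt φ (f (φ t)) t) (hr : 1 ≤ r) {y : ℝ → E}
    (hy : ∀ t, HasDerivAt y (fderiv ℝ f (φ t) (y t)) t) : ContDiff ℝ r y :=
  contDiff_of_nat_succ_le (fun _ hk => linear_ode_contDiff
    (contDiff_fderiv_comp hD hf hφD (contDiff_integralCurve hD hf hφD hφ hr) hk) hy) hr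

theorem exists_norm_le_of_periodic {F : Type*} [NormedAddCommGroup F] {A : ℝ → F} {T : ℝ}
    (hA : Continuous A) (hper : Function.Periodic A T) (hT : 0 < T) :
    ∃ L, 0 < L ∧ ∀ t, ‖A t‖ ≤ L := by
  obtain ⟨L, hL⟩ := (isCompact_Icc (a := (0 : ℝ)) (b := 0 + T)).exists_bound_of_continuousOn
    hA.continuousOn
  refine ⟨max L 1, by positivity, fun t => ?_⟩
  obtain ⟨s, hs, h⟩ := hper.exists_mem_Ico₀ hT t
  rw [h]
  exact (hL s ⟨hs.1, by linarith [hs.2]⟩).trans (le_max_left _ _)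

end Orbit

/-! ### First-order expansion of the flow. -/

section FlowExpansion

open Set Filter Asymptotics

variable {E : Type*} [NormedAddCommGroup E] [NormedSpace ℝ E] {f : E → E} {D : Set E}

/-- A `C¹` map is differentiable uniformly along a compact set. -/
theorem exists_uniform_linearization (hD : IsOpen D) (hf : ContDiffOn ℝ 1 f D) {Z : Set E}
    (hZ : IsCompact Z) (hZD : Z ⊆ D) {η : ℝ} (hη : 0 < η) :
    ∃ ρ > 0, ∀ z ∈ Z, ∀ x, ‖x - z‖ < ρ → ‖f x - f z - fderiv ℝ f z (x - z)‖ ≤ η * ‖x - z‖ := by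
  obtain ⟨ρ₁, hρ₁, hsub⟩ := hZ.exists_thickening_subset_open hD hZD
  have hc : ∀ a ∈ Z, ContinuousAt (fderiv ℝ f) a := fun a ha =>
    (hf.continuousOn_fderiv_of_isOpen hD le_rfl).continuousAt (hD.mem_nhds (hZD ha))
  -- Compactness makes the derivative at points near `Z`, even off `Z`, uniformly close to that at
  -- the points of `Z`; the mean value inequality on a ball then applies.
  have hu := hZ.uniformContinuousAt_of_continuousAt (fderiv ℝ f) hc (Metric.dist_mem_uniformity hη)
  obtain ⟨ρ₂, hρ₂, hu⟩ := Metric.mem_uniformity_dist.1 hu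
  refine ⟨min ρ₁ ρ₂, lt_min hρ₁ hρ₂, fun z hz x hx => ?_⟩
  have hball : Metric.ball z (min ρ₁ ρ₂) ⊆ D := fun y hy =>
    hsub (Metric.mem_thickening_iff.2 ⟨z, hz, (Metric.mem_ball.1 hy).trans_le (min_le_left _ _)⟩)
  refine (convex_ball z (min ρ₁ ρ₂)).norm_image_sub_le_of_norm_fderiv_le' (𝕜 := ℝ)
    (fun y hy => ?_) (fun y hy => ?_) (Metric.mem_ball_self (lt_min hρ₁ hρ₂))
    (by rwa [Metric.mem_ball, dist_eq_norm])
  · exact (hf.contDiffAt (hD.mem_nhds (hball hy))).differentiableAt (by simp)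
  · have h : dist z y < ρ₂ := by
      rw [dist_comm]; exact (Metric.mem_ball.1 hy).trans_le (min_le_right _ _)
    have := hu h hz
    rw [mem_ofPred_eq, dist_comm, dist_eq_norm] at this
    exact this.le

/-- First-order expansion of the flow near a piece of an orbit, uniformly on compact time
intervals. -/
theorem flow_expansion (hD : IsOpen D) (hf : ContDiffOn ℝ 1 f D) {ψ : ℝ → E}
    (hψD : ∀ t, ψ t ∈ D) (hψ : ∀ t, HasDerivAt ψ (f (ψ t)) t) {Y : ℝ → E →L[ℝ] E} (hY0 : Y 0 = 1)
    (hY : ∀ t, HasDerivAt Y (fderiv ℝ f (ψ t) * Y t) t) {L : ℝ} (hL0 : 0 ≤ L)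
    (hL : ∀ t, ‖fderiv ℝ f (ψ t)‖ ≤ L) (R : ℝ) {η : ℝ} (hη : 0 < η) :
    ∀ᶠ h in 𝓝 (0 : E), ∀ θ ∈ Icc 0 R, ∀ γ : ℝ → E, γ 0 = ψ 0 + h →
      IsIntegralCurveOn γ (fun _ => f) (Icc 0 θ) → ‖γ θ - ψ θ - Y θ h‖ ≤ η * ‖h‖ := by
  have hψc : Continuous ψ := continuous_iff_continuousAt.2 fun t => (hψ t).continuousAt
  have hZ : IsCompact (ψ '' Icc 0 R) := isCompact_Icc.image hψc
  have hZD : ψ '' Icc 0 R ⊆ D := by rintro _ ⟨t, _, rfl⟩; exact hψD t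
  -- Chosen so that the final bound `2 K exp ((L + 1) R)` is exactly `η c`.
  set κ : ℝ := η / (2 * Real.exp ((L + 2) * R) * Real.exp ((L + 1) * R)) with hκ
  have hκ0 : 0 < κ := by positivity
  obtain ⟨ρ₁, hρ₁, h1⟩ := exists_uniform_linearization hD hf hZ hZD one_pos
  obtain ⟨ρ₂, hρ₂, h2⟩ := exists_uniform_linearization hD hf hZ hZD hκ0
  set ρ := min ρ₁ ρ₂
  have hρ : 0 < ρ := lt_min hρ₁ hρ₂
  -- The strict comparison needs a positive bound, so `‖h‖` is replaced by a larger `c > 0`, which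
  -- tends to `‖h‖` at the end. This also covers `h = 0`.
  have key : ∀ c > 0, c * Real.exp ((L + 2) * R) < ρ → ∀ h : E, ‖h‖ ≤ c → ∀ θ ∈ Icc 0 R,
      ∀ γ : ℝ → E, γ 0 = ψ 0 + h → IsIntegralCurveOn γ (fun _ => f) (Icc 0 θ) →
        ‖γ θ - ψ θ - Y θ h‖ ≤ η * c := by
    intro c hc hcρ h hh θ hθ γ hγ0 hγ
    have hγc : ContinuousOn γ (Icc 0 θ) := fun t ht => (hγ t ht).continuousWithinAt
    have hγd : ∀ t ∈ Ico 0 θ, HasDerivWithinAt γ (f (γ t)) (Ici t) t := fun t ht =>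
      (hγ t ⟨ht.1, ht.2.le⟩).mono_of_mem_nhdsWithin (mem_of_superset (Icc_mem_nhdsGE ht.2)
        (Icc_subset_Icc_left ht.1))
    have hexp : ∀ a b t : ℝ, HasDerivAt (fun t => a * Real.exp (b * t))
        (b * (a * Real.exp (b * t))) t := fun a b t => by
      have h3 : HasDerivAt (fun t : ℝ => b * t) b t := by
        simpa using (hasDerivAt_id t).const_mul b
      convert! h3.exp.const_mul a using 1
      ring
    have hmono : ∀ t ∈ Ico 0 θ, ∀ b, 0 ≤ b → Real.exp (b * t) ≤ Real.exp (b * R) :=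
      fun t ht b hb => Real.exp_le_exp.2 (mul_le_mul_of_nonneg_left (ht.2.le.trans hθ.2) hb)
    have hmem : ∀ t ∈ Ico 0 θ, ψ t ∈ ψ '' Icc 0 R := fun t ht =>
      mem_image_of_mem ψ ⟨ht.1, ht.2.le.trans hθ.2⟩
    -- In the rate, `L` bounds the derivative, one unit the linearization error, and one unit makes
    -- the comparison strict.
    have hclose : ∀ t ∈ Icc 0 θ, ‖γ t - ψ t‖ ≤ c * Real.exp ((L + 2) * t) := by
      refine image_norm_le_of_norm_deriv_right_lt_deriv_boundary
        (f' := fun t => f (γ t) - f (ψ t)) (hγc.sub hψc.continuousOn)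
        (fun t ht => (hγd t ht).sub (hψ t).hasDerivWithinAt) ?_ (hexp c (L + 2)) ?_
      · simpa [hγ0] using hh
      · intro t ht hteq
        replace hteq : ‖γ t - ψ t‖ = c * Real.exp ((L + 2) * t) := hteq
        have hB : 0 < c * Real.exp ((L + 2) * t) := by positivity
        have hlt : ‖γ t - ψ t‖ < ρ₁ := by
          rw [hteq]
          refine lt_of_le_of_lt ?_ (hcρ.trans_le (min_le_left _ _))
          exact mul_le_mul_of_nonneg_left (hmono t ht _ (by positivity)) hc.le
        have h3 := h1 _ (hmem t ht) _ hlt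
        have h4 := (fderiv ℝ f (ψ t)).le_of_opNorm_le (hL t) (γ t - ψ t)
        have h5 := norm_le_norm_sub_add (f (γ t) - f (ψ t)) (fderiv ℝ f (ψ t) (γ t - ψ t))
        rw [← hteq] at hB ⊢
        refine h5.trans_lt ?_
        linarith
    have hYd : ∀ t, HasDerivAt (fun t => Y t h) (fderiv ℝ f (ψ t) (Y t h)) t := fun t => by
      simpa using (hY t).clm_apply (hasDerivAt_const t h)
    have hYc : Continuous fun t => Y t h :=
      continuous_iff_continuousAt.2 fun t => (hYd t).continuousAt
    set K := κ * (c * Real.exp ((L + 2) * R)) with hK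
    have hK0 : 0 < K := by positivity
    -- The forcing term is at most `K`, while on the boundary of the comparison the deviation is at
    -- least `2 K`; the factor `2` gives strictness.
    have hfin : ∀ t ∈ Icc 0 θ, ‖γ t - ψ t - Y t h‖ ≤ 2 * K * Real.exp ((L + 1) * t) := by
      refine image_norm_le_of_norm_deriv_right_lt_deriv_boundary
        (f' := fun t => f (γ t) - f (ψ t) - fderiv ℝ f (ψ t) (Y t h))
        ((hγc.sub hψc.continuousOn).sub hYc.continuousOn)
        (fun t ht => ((hγd t ht).sub (hψ t).hasDerivWithinAt).sub (hYd t).hasDerivWithinAt) ?_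
        (hexp (2 * K) (L + 1)) ?_
      · simp [hγ0, hY0, hK0.le]
      · intro t ht hteq
        replace hteq : ‖γ t - ψ t - Y t h‖ = 2 * K * Real.exp ((L + 1) * t) := hteq
        have hcl := hclose t ⟨ht.1, ht.2.le⟩
        have hcl' : ‖γ t - ψ t‖ ≤ c * Real.exp ((L + 2) * R) :=
          hcl.trans (mul_le_mul_of_nonneg_left (hmono t ht _ (by positivity)) hc.le)
        have h3 := h2 _ (hmem t ht) _ (hcl'.trans_lt (hcρ.trans_le (min_le_right _ _)))
        have h3' : κ * ‖γ t - ψ t‖ ≤ K := mul_le_mul_of_nonneg_left hcl' hκ0.le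
        have h4 := (fderiv ℝ f (ψ t)).le_of_opNorm_le (hL t) (γ t - ψ t - Y t h)
        have hge : 2 * K ≤ ‖γ t - ψ t - Y t h‖ := by
          rw [hteq]
          refine le_mul_of_one_le_right (by positivity) (Real.one_le_exp ?_)
          exact mul_nonneg (by positivity) ht.1
        have h5 : f (γ t) - f (ψ t) - fderiv ℝ f (ψ t) (Y t h)
            = (f (γ t) - f (ψ t) - fderiv ℝ f (ψ t) (γ t - ψ t))
              + fderiv ℝ f (ψ t) (γ t - ψ t - Y t h) := by
          simp only [map_sub]; abel
        rw [← hteq, h5]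
        refine (norm_add_le _ _).trans_lt ?_
        linarith
    refine (hfin θ ⟨hθ.1, le_rfl⟩).trans ?_
    have : Real.exp ((L + 1) * θ) ≤ Real.exp ((L + 1) * R) :=
      Real.exp_le_exp.2 (mul_le_mul_of_nonneg_left hθ.2 (by positivity))
    calc 2 * K * Real.exp ((L + 1) * θ) ≤ 2 * K * Real.exp ((L + 1) * R) := by gcongr
      _ = η * c := by rw [hK, hκ]; field_simp
  have hev : ∀ᶠ h in 𝓝 (0 : E), ‖h‖ * Real.exp ((L + 2) * R) < ρ := by
    have : Continuous fun h : E => ‖h‖ * Real.exp ((L + 2) * R) := by fun_prop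
    exact this.continuousAt.eventually_lt continuousAt_const (by simpa using hρ)
  filter_upwards [hev] with h hh θ hθ γ hγ0 hγ
  have hnear : ∀ᶠ c in 𝓝[>] ‖h‖, ‖γ θ - ψ θ - Y θ h‖ ≤ η * c := by
    have hcont : ContinuousAt (fun c : ℝ => c * Real.exp ((L + 2) * R)) ‖h‖ := by fun_prop
    have h3 := (hcont.eventually_lt continuousAt_const hh).filter_mono
      (nhdsWithin_le_nhds (s := Ioi ‖h‖))
    filter_upwards [h3, self_mem_nhdsWithin] with c hc hc'
    exact key c ((norm_nonneg h).trans_lt hc') hc h (le_of_lt hc') θ hθ γ hγ0 hγ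
  have hlim : Tendsto (fun c : ℝ => η * c) (𝓝[>] ‖h‖) (𝓝 (η * ‖h‖)) :=
    ((continuous_const.mul continuous_id).tendsto _).mono_left nhdsWithin_le_nhds
  exact ge_of_tendsto hlim hnear

end FlowExpansion

/-! ### The derivative of a Poincaré map. -/

section Poincare

open Set Filter Asymptotics

theorem hasDerivAt_velocity {E : Type*} [NormedAddCommGroup E] [NormedSpace ℝ E] {f : E → E}
    {D : Set E} (hD : IsOpen D) (hf : ContDiffOn ℝ 1 f D) {φ : ℝ → E} (hφD : ∀ t, φ t ∈ D)
    (hφ : ∀ t, HasDerivAt φ (f (φ t)) t) (t : ℝ) :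
    HasDerivAt (fun t => f (φ t)) (fderiv ℝ f (φ t) (f (φ t))) t :=
  ((hf.contDiffAt (hD.mem_nhds (hφD t))).differentiableAt (by simp)).hasFDerivAt.comp_hasDerivAt t
    (hφ t)

variable {n : ℕ} {f : (Fin n → ℝ) → (Fin n → ℝ)} {D : Set (Fin n → ℝ)} {φ : ℝ → (Fin n → ℝ)}
  {T : ℝ}

namespace IsPeriodicOrbit

theorem continuous_fderiv (hφ : IsPeriodicOrbit f D φ T) (hD : IsOpen D)
    (hf : ContDiffOn ℝ 1 f D) : Continuous fun t => fderiv ℝ f (φ t) := by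
  rw [continuous_iff_continuousAt]
  intro t
  exact ((hf.continuousOn_fderiv_of_isOpen hD le_rfl).continuousAt
    (hD.mem_nhds (hφ.mem t))).comp (f := φ) (hφ.solution t).continuousAt

theorem exists_norm_fderiv_le (hφ : IsPeriodicOrbit f D φ T) (hD : IsOpen D)
    (hf : ContDiffOn ℝ 1 f D) : ∃ L, 0 < L ∧ ∀ t, ‖fderiv ℝ f (φ t)‖ ≤ L :=
  exists_norm_le_of_periodic (hφ.continuous_fderiv hD hf)
    (fun t => by rw [hφ.periodic t]) hφ.pos

/-- The velocity solves the variational equation: if it vanished once it would vanish always, and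
`φ` would be constant. -/
theorem velocity_ne_zero (hφ : IsPeriodicOrbit f D φ T) (hD : IsOpen D)
    (hf : ContDiffOn ℝ 1 f D) (s : ℝ) : f (φ s) ≠ 0 := by
  intro h0
  obtain ⟨L, -, hL⟩ := hφ.exists_norm_fderiv_le hD hf
  have h : (fun t => f (φ t)) = fun _ => 0 :=
    linear_ode_unique (A := fun t => fderiv ℝ f (φ t)) hL
      (hasDerivAt_velocity hD hf hφ.mem hφ.solution)
      (fun t => by simpa using hasDerivAt_const t (0 : Fin n → ℝ)) (t₀ := s) h0
  obtain ⟨t, ht⟩ := hφ.nontrivial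
  refine ht (is_const_of_deriv_eq_zero (fun t => (hφ.solution t).differentiableAt) (fun t => ?_) t 0)
  rw [(hφ.solution t).deriv]
  exact congr_fun h t

end IsPeriodicOrbit

/-- The derivative of a Poincaré map is the compression of the monodromy operator to the
section. -/
theorem IsPoincareMap.hasFDerivAt {s₀ : ℝ} {K : Submodule ℝ (Fin n → ℝ)} {P : K → K}
    (hP : IsPoincareMap f D φ T s₀ K P) (hφ : IsPeriodicOrbit f D φ T) (hD : IsOpen D)
    (hf : ContDiffOn ℝ 1 f D) {Y : ℝ → (Fin n → ℝ) →L[ℝ] (Fin n → ℝ)} (hY0 : Y 0 = 1)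
    (hY : ∀ t, HasDerivAt Y (fderiv ℝ f (φ (s₀ + t)) * Y t) t) :
    HasFDerivAt P (LinearMap.toContinuousLinearMap
      (K.projectionOnto _ hP.1 ∘ₗ (Y T : (Fin n → ℝ) →ₗ[ℝ] (Fin n → ℝ)) ∘ₗ K.subtype)) 0 := by
  obtain ⟨hK, τ, hτc, hτ0, hev⟩ := hP
  set e := f (φ s₀) with he
  have he0 : e ≠ 0 := hφ.velocity_ne_zero hD hf s₀
  obtain ⟨L, hL0, hL⟩ := hφ.exists_norm_fderiv_le hD hf
  set pr : (Fin n → ℝ) →L[ℝ] K := LinearMap.toContinuousLinearMap (K.projectionOnto _ hK) with hpr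
  have hpr_e : pr e = 0 :=
    Submodule.projectionOnto_apply_right hK ⟨e, Submodule.mem_span_singleton_self e⟩
  have hpr_K : ∀ k : K, pr k = k := fun k => Submodule.projectionOnto_apply_left hK k
  -- The projection onto the velocity direction along `K`, complementary to `pr`.
  set Q : (Fin n → ℝ) →L[ℝ] (Fin n → ℝ) := 1 - K.subtypeL ∘L pr with hQ
  have hQ_e : Q e = e := by simp [hQ, hpr_e]
  have hQ_K : ∀ k : K, Q k = 0 := fun k => by simp [hQ, hpr_K]
  have hψ : ∀ t, HasDerivAt (fun t => φ (s₀ + t)) (f (φ (s₀ + t))) t := fun t =>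
    (hφ.solution (s₀ + t)).comp_const_add s₀ t
  -- remainder of the flow expansion
  have hrem : (fun h : K => φ s₀ + (P h : Fin n → ℝ) - φ (s₀ + τ h) - Y (τ h) h)
      =o[𝓝 0] fun h : K => h := by
    rw [isLittleO_iff]
    intro η hη
    have hflow := flow_expansion hD hf (fun t => hφ.mem (s₀ + t)) hψ hY0 hY hL0.le
      (fun t => hL (s₀ + t)) (T + 1) hη
    have hcoe : Tendsto (fun h : K => (h : Fin n → ℝ)) (𝓝 0) (𝓝 0) :=
      (continuous_subtype_val.tendsto' (0 : K) _ rfl)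
    have hτ1 : ∀ᶠ h in 𝓝 0, τ h ∈ Icc 0 (T + 1) :=
      hτc.preimage_mem_nhds (Icc_mem_nhds (by rw [hτ0]; exact hφ.pos) (by rw [hτ0]; linarith))
    filter_upwards [hcoe.eventually hflow, hτ1, hev] with h h1 h2 ⟨γ, hγ0, _, hγ, hγe⟩
    have := h1 (τ h) h2 γ (by simpa using hγ0) hγ
    rwa [hγe] at this
  set a : K → ℝ := fun h => τ h - T with ha
  have ha0 : Tendsto a (𝓝 0) (𝓝 0) := by
    have : ContinuousAt a 0 := hτc.sub continuousAt_const
    simpa [ContinuousAt, ha, hτ0] using this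
  have hYc : Continuous Y := continuous_iff_continuousAt.2 fun t => (hY t).continuousAt
  have hYrem : (fun h : K => (Y (τ h) - Y T) (h : Fin n → ℝ)) =o[𝓝 0] fun h : K => h := by
    have h1 : Tendsto (fun h => ‖Y (τ h) - Y T‖) (𝓝 0) (𝓝 0) := by
      have : ContinuousAt (fun h => ‖Y (τ h) - Y T‖) 0 :=
        ((hYc.continuousAt.comp hτc).sub continuousAt_const).norm
      simpa [ContinuousAt, hτ0] using this
    rw [isLittleO_iff]
    intro c hc
    filter_upwards [h1.eventually (gt_mem_nhds hc)] with h hh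
    exact (Y (τ h) - Y T).le_of_opNorm_le hh.le _
  set ρ : ℝ → (Fin n → ℝ) := fun a => φ (s₀ + T + a) - φ s₀ - a • e with hρ
  have hρo : (fun h => ρ (a h)) =o[𝓝 0] a := by
    have h1 : HasDerivAt (fun a => φ (s₀ + T + a)) e 0 := by
      have := (hφ.solution (s₀ + T + 0)).comp_const_add (s₀ + T) 0
      simpa [hφ.periodic s₀, he] using this
    rw [hasDerivAt_iff_isLittleO] at h1
    have h2 := h1.comp_tendsto ha0
    simpa [Function.comp_def, hφ.periodic s₀, hρ] using h2
  set rest : K → (Fin n → ℝ) := fun h => (Y (τ h) - Y T) (h : Fin n → ℝ) +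
    (φ s₀ + (P h : Fin n → ℝ) - φ (s₀ + τ h) - Y (τ h) h) with hrest
  have hrest_o : rest =o[𝓝 0] fun h : K => h := hYrem.add hrem
  have hmain : ∀ h : K, (P h : Fin n → ℝ) = a h • e + ρ (a h) + Y T h + rest h := by
    intro h
    simp only [hrest, hρ, ha, sub_apply,
      show s₀ + T + (τ h - T) = s₀ + τ h by ring]
    abel
  -- Only continuity of the return time is given. Applying `Q` to `hmain` removes `P h` and leaves
  -- `a h • e + o(a h) = O(h)`, which bounds the time excess `a` linearly.
  have haO : a =O[𝓝 0] fun h : K => h := by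
    have h1 : ∀ h : K, Q (ρ (a h)) + a h • e = -Q (Y T h) - Q (rest h) := by
      intro h
      have h2 := congr_arg Q (hmain h)
      rw [hQ_K, map_add, map_add, map_add, map_smul, hQ_e] at h2
      linear_combination (exp := 1) -h2
    have h3 : (fun h => Q (ρ (a h))) =o[𝓝 0] fun h => a h • e := by
      have h4 : a =O[𝓝 0] fun h => a h • e := by
        refine IsBigO.of_bound ‖e‖⁻¹ (Eventually.of_forall fun h => ?_)
        have := norm_ne_zero_iff.2 he0
        rw [norm_smul]
        field_simp
        exact le_rfl
      exact ((Q.isBigO_comp _ _).trans_isLittleO hρo).trans_isBigO h4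
    have h5 : (fun h => a h • e) =O[𝓝 0] fun h : K => h := by
      refine h3.right_isBigO_add.trans ?_
      simp only [h1]
      refine IsBigO.sub ?_ ((Q.isBigO_comp _ _).trans hrest_o.isBigO)
      refine IsBigO.neg_left ?_
      exact (Q ∘L Y T ∘L K.subtypeL).isBigO_id _
    refine IsBigO.trans ?_ h5
    refine IsBigO.of_bound ‖e‖⁻¹ (Eventually.of_forall fun h => ?_)
    have := norm_ne_zero_iff.2 he0
    rw [norm_smul]
    field_simp
    exact le_rfl
  have hP0 : P 0 = 0 := by
    have h1 : a 0 = 0 := by simp [ha, hτ0]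
    have h2 : rest 0 = 0 := by simpa using (hrest_o.bound one_pos).self_of_nhds
    have h3 := hmain 0
    rw [h1, h2] at h3
    rw [← hpr_K (P 0), h3]
    simp [hρ, hφ.periodic s₀]
  rw [hasFDerivAt_iff_isLittleO]
  -- Projecting to `K` removes the term in `e`, so the time excess enters only through the remainder
  -- `ρ (a h)`, which is `o(h)` by `haO`.
  have h6 : ∀ h : K, P h - P 0 - LinearMap.toContinuousLinearMap
      (K.projectionOnto _ hK ∘ₗ (Y T : (Fin n → ℝ) →ₗ[ℝ] (Fin n → ℝ)) ∘ₗ K.subtype) (h - 0)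
      = pr (ρ (a h)) + pr (rest h) := by
    intro h
    have h7 := congr_arg pr (hmain h)
    rw [hpr_K, map_add, map_add, map_add, map_smul, hpr_e] at h7
    rw [hP0, sub_zero, sub_zero, h7]
    change _ - pr (Y T h) = _
    rw [smul_zero]
    abel
  refine IsLittleO.congr_left ?_ fun h => (h6 h).symm
  simp only [sub_zero]
  exact (((pr.isBigO_comp _ _).trans_isLittleO hρo).trans_isBigO haO).add
    ((pr.isBigO_comp _ _).trans_isLittleO hrest_o)

/-- The characteristic polynomial of an operator with a fixed vector spanning a complement of
`K`. -/
theorem charpoly_eq_of_apply_eq_self {V : Type*} [AddCommGroup V] [Module ℝ V]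
    [FiniteDimensional ℝ V] (B : V →ₗ[ℝ] V) {e : V} (he0 : e ≠ 0) (he : B e = e)
    {K : Submodule ℝ V} (hK : IsCompl K (Submodule.span ℝ {e})) :
    B.charpoly = (Polynomial.X - Polynomial.C 1) *
      (K.projectionOnto _ hK ∘ₗ B ∘ₗ K.subtype).charpoly := by
  classical
  let σ : ℝ ≃ₗ[ℝ] Submodule.span ℝ {e} := LinearEquiv.toSpanNonzeroSingleton ℝ V e he0
  let w : (K × ℝ) ≃ₗ[ℝ] V :=
    ((LinearEquiv.refl ℝ K).prodCongr σ).trans (Submodule.prodEquivOfIsCompl K _ hK)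
  have hw : ∀ k a, w (k, a) = k + a • e := fun k a => by simp [w, σ]
  have hwfst : ∀ x, (w.symm x).1 = K.projectionOnto _ hK x := fun x => by simp [w]
  let b := (Module.finBasis ℝ K).prod (Module.Basis.singleton Unit ℝ)
  -- The fixed vector `e` gives the column `(0, 1)`, so the matrix is block triangular.
  have hblocks : LinearMap.toMatrix b b (w.symm.conj B) = Matrix.fromBlocks
      (LinearMap.toMatrix (Module.finBasis ℝ K) (Module.finBasis ℝ K)
        (K.projectionOnto _ hK ∘ₗ B ∘ₗ K.subtype)) 0
      (LinearMap.toMatrix b b (w.symm.conj B)).toBlocks₂₁ 1 := by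
    have he' : w.symm e = (0, 1) := by
      rw [LinearEquiv.symm_apply_eq, hw]; simp
    ext (i | i) (j | j)
    · simp [LinearMap.toMatrix_apply, b, LinearEquiv.conj_apply, hw, hwfst]
    · simp [LinearMap.toMatrix_apply, b, LinearEquiv.conj_apply, hw, he, he']
    · simp [Matrix.toBlocks₂₁]
    · simp [LinearMap.toMatrix_apply, b, LinearEquiv.conj_apply, hw, he, he']
  rw [← LinearEquiv.charpoly_conj w.symm B, ← LinearMap.charpoly_toMatrix _ b, hblocks,
    Matrix.charpoly_fromBlocks_zero₁₂, LinearMap.charpoly_toMatrix, mul_comm]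
  congr 1
  simp [Matrix.charpoly, Matrix.charmatrix]

end Poincare

/-! ### Coordinates in a tube around the orbit. -/

section TubularCoordinates

open Set Filter Asymptotics

/-- A map with invertible derivatives transforms integral curves of the pulled-back field into
integral curves, and only those. -/
theorem isIntegralCurveOn_comp_iff {F E : Type*} [NormedAddCommGroup F] [NormedSpace ℝ F]
    [CompleteSpace F] [NormedAddCommGroup E] [NormedSpace ℝ E] {X : F → E} (hX : ContDiff ℝ 1 X)
    {c : ℝ → F} {J : Set ℝ} (hc : ContinuousOn c J)
    (hinv : ∀ t ∈ J, (fderiv ℝ X (c t)).IsInvertible) (v : ℝ → E → E) :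
    IsIntegralCurveOn (fun t => X (c t)) v J ↔
      IsIntegralCurveOn c (fun t p => (fderiv ℝ X p).inverse (v t (X p))) J := by
  refine forall₂_congr fun t ht => ?_
  obtain ⟨e, he⟩ := hinv t ht
  have hs : HasStrictFDerivAt X (e : F →L[ℝ] E) (c t) := by
    rw [he]; exact hX.contDiffAt.hasStrictFDerivAt (by simp)
  have hinv' : (fderiv ℝ X (c t)).inverse = (e.symm : E →L[ℝ] F) := by
    rw [← he, ContinuousLinearMap.inverse_equiv]
  constructor
  · intro h
    have h1 := (hs.to_localInverse.hasFDerivAt.comp_hasDerivWithinAt t h)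
    change HasDerivWithinAt c ((fderiv ℝ X (c t)).inverse (v t (X (c t)))) J t
    rw [hinv']
    -- Continuity of `c` keeps it in the domain of the local inverse, so near `t` it is the local
    -- inverse applied to `X ∘ c`, and differentiability is transported back.
    refine h1.congr_of_eventuallyEq ?_ ?_
    · have h2 := (hc t ht).eventually hs.eventually_left_inverse
      filter_upwards [h2] with u hu using hu.symm
    · exact hs.eventually_left_inverse.self_of_nhds.symm
  · intro h
    have h1 := hs.hasFDerivAt.comp_hasDerivWithinAt t h
    simp only [hinv'] at h1
    simpa using! h1

variable {E V : Type*} [NormedAddCommGroup E] [NormedSpace ℝ E] [NormedAddCommGroup V]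
  [NormedSpace ℝ V] {φ : ℝ → E} {W : ℝ → V →L[ℝ] E}

/-- The derivative of the coordinates `(s, h) ↦ φ(s) + W(s) h`. -/
theorem hasFDerivAt_tube {φ' : E} {W' : V →L[ℝ] E} {s : ℝ} (h : V) (hφ : HasDerivAt φ φ' s)
    (hW : HasDerivAt W W' s) :
    HasFDerivAt (fun p : ℝ × V => φ p.1 + W p.1 p.2)
      ((ContinuousLinearMap.toSpanSingleton ℝ (φ' + W' h)).coprod (W s)) (s, h) := by
  have h1 : HasFDerivAt (fun p : ℝ × V => φ p.1) _ (s, h) :=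
    hφ.hasFDerivAt.comp (s, h) (hasFDerivAt_fst (p := (s, h)))
  have h2 : HasFDerivAt (fun p : ℝ × V => W p.1) _ (s, h) :=
    hW.hasFDerivAt.comp (s, h) (hasFDerivAt_fst (p := (s, h)))
  have h3 := h1.add (h2.clm_apply (hasFDerivAt_snd (p := (s, h))))
  convert! h3 using 1
  ext <;> simp

/-- A function that is bounded by the linearization error of `f` along a linear map vanishes to
second order. -/
theorem hasFDerivAt_zero_of_bound {G : Type*} [NormedAddCommGroup G] [NormedSpace ℝ G] {f : E → E}
    {z : E} {A : E →L[ℝ] E} (hf : HasFDerivAt f A z) (w : V →L[ℝ] E) {F : V → G} {C : ℝ}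
    (hF0 : F 0 = 0)
    (hF : ∀ᶠ h in 𝓝 (0 : V), ‖F h‖ ≤ C * ‖f (z + w h) - f z - A (w h)‖) :
    HasFDerivAt F (0 : V →L[ℝ] G) 0 := by
  rw [hasFDerivAt_iff_isLittleO]
  simp only [hF0, sub_zero, zero_apply]
  refine (IsBigO.of_bound C hF).trans_isLittleO ?_
  have h1 := (hasFDerivAt_iff_isLittleO_nhds_zero.1 hf)
  have h2 : Tendsto (fun h => w h) (𝓝 0) (𝓝 0) := w.continuous.tendsto' _ _ (map_zero w)
  exact (h1.comp_tendsto h2).trans_isBigO (w.isBigO_id _)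

theorem isInvertible_of_injective [FiniteDimensional ℝ E] [FiniteDimensional ℝ V]
    (hdim : Module.finrank ℝ V = Module.finrank ℝ E)
    {B : V →L[ℝ] E} (hB : Function.Injective B) : B.IsInvertible :=
  ⟨(LinearEquiv.ofInjectiveOfFinrankEq (B : V →ₗ[ℝ] E) hB hdim).toContinuousLinearEquiv, by
    ext; rfl⟩

/-- The linear isometry `(s, h) ↦ (s, ι h)`. -/
noncomputable def tubeSymm (ι : V ≃ₗᵢ[ℝ] V) : (ℝ × V) ≃L[ℝ] (ℝ × V) :=
  (ContinuousLinearEquiv.refl ℝ ℝ).prodCongr ι.toContinuousLinearEquiv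

theorem tubeSymm_apply (ι : V ≃ₗᵢ[ℝ] V) (p : ℝ × V) : tubeSymm ι p = (p.1, ι p.2) := rfl

theorem tubeSymm_symm_apply (ι : V ≃ₗᵢ[ℝ] V) (p : ℝ × V) :
    (tubeSymm ι).symm p = (p.1, ι.symm p.2) := rfl

theorem norm_tubeSymm_symm (ι : V ≃ₗᵢ[ℝ] V) (p : ℝ × V) : ‖(tubeSymm ι).symm p‖ = ‖p‖ := by
  rw [tubeSymm_symm_apply, Prod.norm_def, Prod.norm_def, ι.symm.norm_map]

theorem fderiv_add_period {X : ℝ × V → E} {T : ℝ} {ι : V ≃ₗᵢ[ℝ] V}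
    (hι : ∀ s h, X (s + T, h) = X (s, ι h)) (s : ℝ) (h : V) :
    fderiv ℝ X (s + T, h) = fderiv ℝ X (s, ι h) ∘L (tubeSymm ι : (ℝ × V) →L[ℝ] (ℝ × V)) := by
  have h1 : (fun p => X (p + (T, 0))) = X ∘ tubeSymm ι := by
    ext ⟨s, h⟩
    simp [tubeSymm_apply, hι]
  have h2 := (tubeSymm ι).comp_right_fderiv (f := X) (x := (s, h))
  rw [← h1, fderiv_comp_add_right] at h2
  simpa [tubeSymm_apply] using h2

theorem inverse_fderiv_add_period {X : ℝ × V → E} {T : ℝ} {ι : V ≃ₗᵢ[ℝ] V}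
    (hι : ∀ s h, X (s + T, h) = X (s, ι h)) (s : ℝ) (h : V) (z : E) :
    (fderiv ℝ X (s + T, h)).inverse z =
      (tubeSymm ι).symm ((fderiv ℝ X (s, ι h)).inverse z) := by
  rw [fderiv_add_period hι, ContinuousLinearMap.inverse_comp_equiv]
  rfl

/-- The coordinates along a periodic orbit are regular, with uniform bounds, in a tube around the
orbit. The linear isometry `ι` describes the passage from `s` to `s + T`. -/
theorem exists_tube [CompleteSpace V] {D : Set E} (hD : IsOpen D) {T : ℝ} (hT : 0 < T)
    {X : ℝ × V → E} (hX : ContDiff ℝ 1 X) (hX0 : ∀ s, X (s, 0) ∈ D)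
    (hinv : ∀ s, (fderiv ℝ X (s, 0)).IsInvertible) (ι : V ≃ₗᵢ[ℝ] V)
    (hι : ∀ s h, X (s + T, h) = X (s, ι h)) :
    ∃ ε C : ℝ, 0 < ε ∧ 0 < C ∧ ∀ s h, ‖h‖ < ε → (fderiv ℝ X (s, h)).IsInvertible ∧
      X (s, h) ∈ D ∧ ∀ z, ‖(fderiv ℝ X (s, h)).inverse z‖ ≤ C * ‖z‖ := by
  have hXd : Continuous (fderiv ℝ X) := hX.continuous_fderiv (by simp)
  have hic : ∀ p, (fderiv ℝ X p).IsInvertible →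
      ContinuousAt (fun p => (fderiv ℝ X p).inverse) p := by
    rintro p ⟨e, he⟩
    have h1 : ContinuousAt (ContinuousLinearMap.inverse : (ℝ × V →L[ℝ] E) → _)
        (fderiv ℝ X p) := by
      rw [← he]; exact (contDiffAt_map_inverse (n := 0) e).continuousAt
    exact h1.comp hXd.continuousAt
  have hc0 : Continuous fun s : ℝ => (fderiv ℝ X (s, 0)).inverse := by
    rw [continuous_iff_continuousAt]
    intro s
    have h1 : ContinuousAt (fun s : ℝ => ((s, 0) : ℝ × V)) s := by fun_prop
    exact (hic (s, 0) (hinv s)).comp (f := fun s : ℝ => ((s, 0) : ℝ × V)) h1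
  obtain ⟨C₀, hC₀⟩ := (isCompact_Icc (a := 0) (b := T)).exists_bound_of_continuousOn
    hc0.continuousOn
  have hC0 : 0 ≤ C₀ := (norm_nonneg _).trans (hC₀ 0 ⟨le_rfl, hT.le⟩)
  set good : ℝ × V → Prop := fun p => (fderiv ℝ X p).IsInvertible ∧ X p ∈ D ∧
    ‖(fderiv ℝ X p).inverse‖ < C₀ + 1 with hgood
  have hnhds : ∀ s ∈ Icc 0 T, ∀ᶠ p in 𝓝 (s, (0 : V)), good p := by
    intro s hs
    obtain ⟨e, he⟩ := hinv s
    have h1 : ∀ᶠ p in 𝓝 (s, (0 : V)), (fderiv ℝ X p).IsInvertible := by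
      have := hXd.continuousAt.preimage_mem_nhds (x := (s, (0 : V)))
        (he ▸ ContinuousLinearEquiv.nhds e)
      filter_upwards [this] with p hp using hp
    have h2 : ∀ᶠ p in 𝓝 (s, (0 : V)), X p ∈ D :=
      hX.continuous.continuousAt.preimage_mem_nhds
        (hD.mem_nhds (hX0 s))
    have h3 : ∀ᶠ p in 𝓝 (s, (0 : V)), ‖(fderiv ℝ X p).inverse‖ < C₀ + 1 :=
      (hic _ (hinv s)).norm.eventually_lt continuousAt_const
        (lt_of_le_of_lt (hC₀ s hs) (lt_add_one _))
    filter_upwards [h1, h2, h3] with p hp1 hp2 hp3 using ⟨hp1, hp2, hp3⟩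
  have hK : IsCompact (Icc 0 T ×ˢ ({0} : Set V)) := isCompact_Icc.prod isCompact_singleton
  obtain ⟨ε, hε, hsub⟩ := hK.exists_thickening_subset_open isOpen_interior
    (t := interior {p | good p}) (by
      rintro ⟨s, h⟩ ⟨hs, rfl : h = 0⟩
      exact mem_interior_iff_mem_nhds.2 (hnhds s hs))
  refine ⟨ε, C₀ + 1, hε, by positivity, ?_⟩
  set tube : ℝ → Prop := fun s => ∀ h, ‖h‖ < ε → (fderiv ℝ X (s, h)).IsInvertible ∧
      X (s, h) ∈ D ∧ ∀ z, ‖(fderiv ℝ X (s, h)).inverse z‖ ≤ (C₀ + 1) * ‖z‖ with htube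
  -- Shifting `s` by `T` composes with isometries only, so the same `ε` and constant that work over
  -- `[0, T]` work for every `s`.
  have hper : Function.Periodic tube T := by
    intro s
    refine propext (Iff.trans (forall_congr' fun h => ?_) ι.surjective.forall.symm)
    rw [ι.norm_map, hι, fderiv_add_period hι, ContinuousLinearMap.isInvertible_comp_equiv]
    simp only [ContinuousLinearMap.inverse_comp_equiv, ContinuousLinearMap.comp_apply,
      ContinuousLinearEquiv.coe_coe, norm_tubeSymm_symm]
  have hbase : ∀ s ∈ Icc 0 T, tube s := by
    intro s hs h hh
    have h1 : (s, h) ∈ Metric.thickening ε (Icc 0 T ×ˢ ({0} : Set V)) :=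
      Metric.mem_thickening_iff.2 ⟨(s, 0), ⟨hs, rfl⟩, by simpa [Prod.dist_eq] using hh⟩
    obtain ⟨h2, h3, h4⟩ := interior_subset (hsub h1)
    exact ⟨h2, h3, fun z => ContinuousLinearMap.le_of_opNorm_le _ h4.le z⟩
  intro s
  obtain ⟨s', hs', heq⟩ := hper.exists_mem_Ico₀ hT s
  change tube s
  rw [heq]
  exact hbase s' ⟨hs'.1, hs'.2.le⟩

end TubularCoordinates

/-! ### Floquet theory of the periodic orbit. -/

section Floquet

open Set Filter Polynomial

theorem exists_isJordanForm {n : ℕ} (M : Matrix (Fin n) (Fin n) ℝ) :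
    ∃ l, IsJordanForm M l := by
  obtain ⟨k, b, hb, hMb⟩ := exists_matSim_jordanSum (M.map (algebraMap ℝ ℂ))
    (M.map (algebraMap ℝ ℂ)).charpoly (Matrix.charpoly_monic _).ne_zero
    (IsAlgClosed.splits _) (Matrix.aeval_self_charpoly _)
  have hget : ∀ (l : List (ℂ × ℕ)) (hl : l.length = k), (∀ i, l.get i = b (Fin.cast hl i)) →
      MatSim (M.map (algebraMap ℝ ℂ)) (jordanSum l.get) := by
    rintro l rfl hl
    rwa [show l.get = b from funext fun i => hl i]
  refine ⟨List.ofFn b, ?_, hget _ List.length_ofFn fun i => List.get_ofFn b i⟩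
  simpa [List.mem_ofFn] using fun i => (hb i).1

variable {n : ℕ} {f : (Fin n → ℝ) → (Fin n → ℝ)} {D : Set (Fin n → ℝ)} {φ : ℝ → (Fin n → ℝ)}
  {T : ℝ}

theorem variationalMatrix_mulVec (t : ℝ) (x : Fin n → ℝ) :
    variationalMatrix f φ t *ᵥ x = fderiv ℝ f (φ t) x :=
  LinearMap.toMatrix'_mulVec _ x

namespace IsFundamentalMatrix

variable {Φ : ℝ → Matrix (Fin n) (Fin n) ℝ}

theorem hasDerivAt_mulVec (hΦ : IsFundamentalMatrix (variationalMatrix f φ) Φ) (x : Fin n → ℝ)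
    (t : ℝ) : HasDerivAt (fun t => Φ t *ᵥ x) (fderiv ℝ f (φ t) (Φ t *ᵥ x)) t := by
  rw [← variationalMatrix_mulVec, Matrix.mulVec_mulVec, hasDerivAt_pi]
  intro i
  simp only [Matrix.mulVec, dotProduct]
  exact HasDerivAt.fun_sum fun j _ => (hΦ.1 t i j).mul_const (x j)

theorem mulVec_inv_mulVec (hΦ : IsFundamentalMatrix (variationalMatrix f φ) Φ) (t : ℝ)
    (x : Fin n → ℝ) : Φ t *ᵥ ((Φ t)⁻¹ *ᵥ x) = x := by
  rw [Matrix.mulVec_mulVec, Matrix.mul_nonsing_inv _ ((Matrix.isUnit_iff_isUnit_det _).1 (hΦ.2 t)),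
    Matrix.one_mulVec]

/-- Every solution of the variational equation is `Φ(t) Φ(t₀)⁻¹` applied to its value at `t₀`. -/
theorem eq_mulVec (hΦ : IsFundamentalMatrix (variationalMatrix f φ) Φ)
    (hφ : IsPeriodicOrbit f D φ T) (hD : IsOpen D) (hf : ContDiffOn ℝ 1 f D) {y : ℝ → (Fin n → ℝ)}
    (hy : ∀ t, HasDerivAt y (fderiv ℝ f (φ t) (y t)) t) (t₀ t : ℝ) :
    y t = Φ t *ᵥ ((Φ t₀)⁻¹ *ᵥ y t₀) := by
  obtain ⟨L, -, hL⟩ := hφ.exists_norm_fderiv_le hD hf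
  exact congr_fun (linear_ode_unique (A := fun t => fderiv ℝ f (φ t)) hL hy
    (hΦ.hasDerivAt_mulVec ((Φ t₀)⁻¹ *ᵥ y t₀)) (t₀ := t₀) (hΦ.mulVec_inv_mulVec t₀ _).symm) t

/-- By periodicity of the coefficients, the translate of a solution by `T` is again a solution,
determined by its value at `0`. -/
theorem add_period (hΦ : IsFundamentalMatrix (variationalMatrix f φ) Φ)
    (hφ : IsPeriodicOrbit f D φ T) (hD : IsOpen D) (hf : ContDiffOn ℝ 1 f D) (t : ℝ) :
    Φ (t + T) = Φ t * ((Φ 0)⁻¹ * Φ T) := by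
  refine Matrix.ext_iff_mulVec.2 fun x => ?_
  have h := hΦ.eq_mulVec hφ hD hf (y := fun t => Φ (t + T) *ᵥ x) (fun t => by
    have := (hΦ.hasDerivAt_mulVec x (t + T)).comp_add_const t T
    rwa [hφ.periodic t] at this) 0 t
  rw [zero_add] at h
  rw [h]
  simp only [Matrix.mulVec_mulVec]

end IsFundamentalMatrix

namespace IsPeriodicOrbit

/-- The solution operators of the variational equation. -/
theorem exists_variational_operator (hφ : IsPeriodicOrbit f D φ T) (hD : IsOpen D)
    (hf : ContDiffOn ℝ 1 f D) (s₀ : ℝ) : ∃ Y : ℝ → (Fin n → ℝ) →L[ℝ] (Fin n → ℝ), Y 0 = 1 ∧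
      ∀ t, HasDerivAt Y (fderiv ℝ f (φ (s₀ + t)) * Y t) t := by
  obtain ⟨L, -, hL⟩ := hφ.exists_norm_fderiv_le hD hf
  exact exists_solution_operator (A := fun t => fderiv ℝ f (φ (s₀ + t)))
    ((hφ.continuous_fderiv hD hf).comp (continuous_const.add continuous_id))
    (fun t => hL (s₀ + t))

theorem exists_isFundamentalMatrix (hφ : IsPeriodicOrbit f D φ T) (hD : IsOpen D)
    (hf : ContDiffOn ℝ 1 f D) : ∃ Φ, IsFundamentalMatrix (variationalMatrix f φ) Φ := by
  obtain ⟨L, -, hL⟩ := hφ.exists_norm_fderiv_le hD hf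
  obtain ⟨Y, hY0, hY⟩ := hφ.exists_variational_operator hD hf 0
  simp only [zero_add] at hY
  have hYx : ∀ x t, HasDerivAt (fun t => Y t x) (fderiv ℝ f (φ t) (Y t x)) t := fun x t => by
    simpa using (hY t).clm_apply (hasDerivAt_const t x)
  refine ⟨fun t => LinearMap.toMatrix' (Y t : (Fin n → ℝ) →ₗ[ℝ] (Fin n → ℝ)), fun t i j => ?_,
    fun t => ?_⟩
  · rw [variationalMatrix, ← LinearMap.toMatrix'_comp]
    simp only [LinearMap.toMatrix'_apply]
    exact hasDerivAt_pi.1 (hYx _ t) i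
  · rw [← Matrix.mulVec_injective_iff_isUnit, ← Matrix.coe_mulVecLin, ← LinearMap.ker_eq_bot,
      LinearMap.ker_eq_bot']
    intro x hx
    rw [Matrix.mulVecLin_apply, LinearMap.toMatrix'_mulVec] at hx
    have h := linear_ode_unique (A := fun t => fderiv ℝ f (φ t)) hL (hYx x)
      (z := fun _ => 0) (fun t => by simpa using hasDerivAt_const t (0 : Fin n → ℝ)) (t₀ := t) hx
    simpa [hY0] using congr_fun h 0

/-- Existence of a fundamental matrix and of a Jordan form makes the choice in `aIndex` meaningful:
the chosen value comes from some pair `Φ`, `l`, and the argument continues with that pair. -/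
theorem isAIndex_aIndex (hφ : IsPeriodicOrbit f D φ T) (hD : IsOpen D)
    (hf : ContDiffOn ℝ 1 f D) :
    IsAIndex (variationalMatrix f φ) T (aIndex (variationalMatrix f φ) T) := by
  obtain ⟨Φ, hΦ⟩ := hφ.exists_isFundamentalMatrix hD hf
  obtain ⟨l, hl⟩ := exists_isJordanForm ((Φ 0)⁻¹ * Φ T)
  exact Classical.epsilon_spec (p := fun d => IsAIndex (variationalMatrix f φ) T d)
    ⟨_, Φ, l, hΦ, hl, rfl⟩

end IsPeriodicOrbit

/-- The characteristic polynomials of a monodromy matrix and of the derivative of a Poincaré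
map. -/
theorem IsPoincareMap.exists_hasFDerivAt_charpoly {s₀ : ℝ} {K : Submodule ℝ (Fin n → ℝ)}
    {P : K → K} (hP : IsPoincareMap f D φ T s₀ K P) (hφ : IsPeriodicOrbit f D φ T)
    (hD : IsOpen D) (hf : ContDiffOn ℝ 1 f D) {Φ : ℝ → Matrix (Fin n) (Fin n) ℝ}
    (hΦ : IsFundamentalMatrix (variationalMatrix f φ) Φ) :
    ∃ B : K →L[ℝ] K, HasFDerivAt P B 0 ∧
      ((Φ 0)⁻¹ * Φ T).charpoly = (X - C 1) * (B : K →ₗ[ℝ] K).charpoly := by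
  obtain ⟨Y, hY0, hY⟩ := hφ.exists_variational_operator hD hf s₀
  refine ⟨_, hP.hasFDerivAt hφ hD hf hY0 hY, ?_⟩
  have hYx : ∀ x, Y T x = Φ (s₀ + T) *ᵥ ((Φ s₀)⁻¹ *ᵥ x) := by
    intro x
    have h := hΦ.eq_mulVec hφ hD hf (y := fun t => Y (t - s₀) x) (fun t => by
      have h1 := (hY (t - s₀)).clm_apply (hasDerivAt_const (t - s₀) x)
      have h2 := h1.comp_sub_const t s₀
      simpa using h2) s₀ (s₀ + T)
    simpa [hY0] using h
  have hYe : Y T (f (φ s₀)) = f (φ s₀) := by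
    rw [hYx, ← hΦ.eq_mulVec hφ hD hf (y := fun t => f (φ t))
      (hasDerivAt_velocity hD hf hφ.mem hφ.solution) s₀ (s₀ + T), hφ.periodic s₀]
  -- The monodromy operator based at `s₀` is `Φ(s₀ + T) Φ(s₀)⁻¹ = Φ(s₀) M Φ(s₀)⁻¹`, so its spectrum
  -- depends neither on `s₀` nor on the section.
  have hYM : MatSim (LinearMap.toMatrix' (Y T : (Fin n → ℝ) →ₗ[ℝ] (Fin n → ℝ)))
      ((Φ 0)⁻¹ * Φ T) := by
    have hdet := (Matrix.isUnit_iff_isUnit_det _).1 (hΦ.2 s₀)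
    refine ⟨Φ s₀, (Φ s₀)⁻¹, Matrix.mul_nonsing_inv _ hdet, Matrix.nonsing_inv_mul _ hdet, ?_⟩
    rw [← hΦ.add_period hφ hD hf]
    refine Matrix.ext_iff_mulVec.2 fun x => ?_
    rw [LinearMap.toMatrix'_mulVec, ← Matrix.mulVec_mulVec]
    exact hYx x
  have htm : (LinearMap.toMatrix' (Y T : (Fin n → ℝ) →ₗ[ℝ] (Fin n → ℝ))).charpoly =
      (Y T : (Fin n → ℝ) →ₗ[ℝ] (Fin n → ℝ)).charpoly := by
    rw [← LinearMap.toMatrix_eq_toMatrix', LinearMap.charpoly_toMatrix]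
  rw [← hYM.charpoly_eq, htm, charpoly_eq_of_apply_eq_self _
    (hφ.velocity_ne_zero hD hf s₀) hYe hP.1]
  rfl

/-- Floquet data of a hyperbolic periodic orbit. -/
theorem IsHyperbolicOrbit.exists_floquet (hyp : IsHyperbolicOrbit f D φ T)
    (hφ : IsPeriodicOrbit f D φ T) (hD : IsOpen D) (hf : ContDiffOn ℝ 1 f D) :
    ∃ (m : ℕ) (Φ : ℝ → Matrix (Fin n) (Fin n) ℝ)
      (H₁ : Matrix (Fin m) (Fin m) ℝ)
      (H₂ : Matrix (Fin (aIndex (variationalMatrix f φ) T)) (Fin (aIndex (variationalMatrix f φ) T))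
        ℝ)
      (S : Matrix (Fin n) (Fin m ⊕ Fin (aIndex (variationalMatrix f φ) T)) ℝ),
      m + aIndex (variationalMatrix f φ) T + 1 = n ∧
      IsFundamentalMatrix (variationalMatrix f φ) Φ ∧
      (∀ t (σ : ℝ) h, σ • f (φ t) + Φ t *ᵥ (S *ᵥ h) = 0 → σ = 0 ∧ h = 0) ∧
      (∀ t, Φ (t + T) * S = Φ t * S *
        Matrix.fromBlocks (NormedSpace.exp (T • H₁)) 0 0 (-NormedSpace.exp (T • H₂))) ∧
      ∀ (s₀ : ℝ) (K : Submodule ℝ (Fin n → ℝ)) (P : K → K), IsPoincareMap f D φ T s₀ K P →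
        DifferentiableAt ℝ P 0 ∧
        ((Matrix.fromBlocks H₁ 0 0 H₂).charpoly.aroots ℂ).map Complex.re =
          ((fderiv ℝ P 0 : K →ₗ[ℝ] K).charpoly.aroots ℂ).map fun μ => 1 / T * Real.log ‖μ‖ := by
  have hT := hφ.pos.ne'
  obtain ⟨Φ, l, hΦ, hl, hd⟩ := hφ.isAIndex_aIndex hD hf
  obtain ⟨s₁, K₁, P₁, A₁, hP₁, hA₁, hμ⟩ := hyp
  obtain ⟨B, hB, hchar⟩ := hP₁.exists_hasFDerivAt_charpoly hφ hD hf hΦ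
  obtain rfl := hA₁.unique hB
  rw [hd]
  have he := fun t => hΦ.eq_mulVec hφ hD hf (y := fun t => f (φ t))
      (hasDerivAt_velocity hD hf hφ.mem hφ.solution) 0 t
  have he0 : (Φ 0)⁻¹ *ᵥ f (φ 0) ≠ 0 := by
    intro h
    have := he 0
    rw [h, Matrix.mulVec_zero] at this
    exact hφ.velocity_ne_zero hD hf 0 this
  have hdet := fun t => (Matrix.isUnit_iff_isUnit_det _).1 (hΦ.2 t)
  have hMe : ((Φ 0)⁻¹ * Φ T) *ᵥ ((Φ 0)⁻¹ *ᵥ f (φ 0)) = (Φ 0)⁻¹ *ᵥ f (φ 0) := by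
    rw [← Matrix.mulVec_mulVec, ← he T]
    have := hφ.periodic 0
    rw [zero_add] at this
    rw [this]
  have hM : IsUnit ((Φ 0)⁻¹ * Φ T) :=
    ((Matrix.isUnit_nonsing_inv_iff).2 (hΦ.2 0)).mul (hΦ.2 T)
  -- Hyperbolicity excludes the root `1` from the characteristic polynomial of the Poincaré
  -- derivative, which makes `1` a simple eigenvalue of the monodromy matrix.
  obtain ⟨m, L₁, L₂, S, hmn, hS, hMS, hq⟩ := exists_real_floquet_form _ hM _ he0 hMe _ hchar
    (fun h => hμ 1 (by
      rw [mem_aroots]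
      refine ⟨(LinearMap.charpoly_monic _).ne_zero, ?_⟩
      have := aeval_algebraMap_apply_eq_algebraMap_eval (A := ℂ) (1 : ℝ)
        (A₁ : K₁ →ₗ[ℝ] K₁).charpoly
      rw [h] at this
      simpa using this) (by simp)) l hl
  refine ⟨m, Φ, (1 / T) • L₁, (1 / T) • L₂, S, hmn, hΦ, ?_, ?_, ?_⟩
  · intro t σ h h0
    refine hS σ h ?_
    rw [he t, ← Matrix.mulVec_smul, ← Matrix.mulVec_add] at h0
    exact (Matrix.mulVec_injective_iff_isUnit.2 (hΦ.2 t)) (by rw [h0, Matrix.mulVec_zero])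
  · intro t
    simp only [smul_smul, mul_one_div_cancel hT, one_smul]
    rw [hΦ.add_period hφ hD hf, Matrix.mul_assoc, hMS, Matrix.mul_assoc]
  · intro s₀ K P hP
    obtain ⟨B, hB, hchar'⟩ := hP.exists_hasFDerivAt_charpoly hφ hD hf hΦ
    refine ⟨hB.differentiableAt, ?_⟩
    rw [hB.fderiv, aroots_charpoly_fromBlocks_exp _ _ hT]
    simp only [smul_smul, mul_one_div_cancel hT, one_smul]
    -- Both sections give the same product with `X - 1`, so their characteristic polynomials agree.
    rw [← hq, mul_left_cancel₀ (X_sub_C_ne_zero 1) (hchar.symm.trans hchar')]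

end Floquet

/-! ### The moving frame of Floquet type. -/

section FloquetFrame

open Set Filter

theorem hasDerivAt_of_forall_apply {F E : Type*} [NormedAddCommGroup F] [NormedSpace ℝ F]
    [NormedAddCommGroup E] [NormedSpace ℝ E] {B : ℝ → F →L[ℝ] E} {B' : F →L[ℝ] E} {t : ℝ}
    (hB : DifferentiableAt ℝ B t) (h : ∀ x, HasDerivAt (fun t => B t x) (B' x) t) :
    HasDerivAt B B' t := by
  convert! hB.hasDerivAt using 1
  ext x
  have := hB.hasDerivAt.clm_apply (hasDerivAt_const t x)
  simpa using (h x).unique this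

section

attribute [local instance] Matrix.linftyOpNormedRing Matrix.linftyOpNormedAlgebra

theorem Matrix.hasDerivAt_exp_smul_mulVec {k : Type*} [Fintype k] [DecidableEq k]
    (A : Matrix k k ℝ) (y : k → ℝ) (t : ℝ) :
    HasDerivAt (fun t : ℝ => NormedSpace.exp (t • A) *ᵥ y)
      (A *ᵥ (NormedSpace.exp (t • A) *ᵥ y)) t := by
  have h := hasDerivAt_exp_smul_const' (𝕂 := ℝ) A t
  have h2 := (LinearMap.toContinuousLinearMap
    ((Matrix.mulVecBilin ℝ ℝ).flip y : Matrix k k ℝ →ₗ[ℝ] (k → ℝ))).hasFDerivAt.comp_hasDerivAt t h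
  rw [Matrix.mulVec_mulVec]
  exact h2

theorem Matrix.exp_smul_mul_exp_smul {k : Type*} [Fintype k] [DecidableEq k]
    (A : Matrix k k ℝ) (a b : ℝ) :
    NormedSpace.exp (a • A) * NormedSpace.exp (b • A) = NormedSpace.exp ((a + b) • A) := by
  rw [add_smul, Matrix.exp_add_of_commute]
  exact ((Commute.refl A).smul_left a).smul_right b

end

variable {n m d : ℕ}

/-- The matrix `A` as a continuous linear map. -/
noncomputable def mulVecCLM {k l : Type*} [Fintype k] [Fintype l] (A : Matrix k l ℝ) :
    (l → ℝ) →L[ℝ] (k → ℝ) :=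
  LinearMap.toContinuousLinearMap A.mulVecLin

@[simp]
theorem mulVecCLM_apply {k l : Type*} [Fintype k] [Fintype l] (A : Matrix k l ℝ) (x : l → ℝ) :
    mulVecCLM A x = A *ᵥ x := rfl

/-- The space of the pairs `(v, w)`. -/
abbrev PairSpace (m d : ℕ) : Type := (Fin m → ℝ) × (Fin d → ℝ)

/-- The identification of pairs `(v, w)` with vectors of length `m + d`. -/
noncomputable def pairCLE (m d : ℕ) : PairSpace m d ≃L[ℝ] (Fin m ⊕ Fin d → ℝ) :=
  (LinearEquiv.sumArrowLequivProdArrow (Fin m) (Fin d) ℝ ℝ).symm.toContinuousLinearEquiv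

theorem pairCLE_apply (h : PairSpace m d) : pairCLE m d h = Sum.elim h.1 h.2 := rfl

/-- The reflection `(v, w) ↦ (v, -w)`. -/
noncomputable def reflectSnd (m d : ℕ) :
    PairSpace m d ≃ₗᵢ[ℝ] PairSpace m d where
  toLinearEquiv := (LinearEquiv.refl ℝ _).prodCongr (LinearEquiv.neg ℝ)
  norm_map' h := by simp [Prod.norm_def]

theorem reflectSnd_apply (h : PairSpace m d) : reflectSnd m d h = (h.1, -h.2) := rfl

theorem reflectSnd_symm_apply (h : PairSpace m d) :
    (reflectSnd m d).symm h = (h.1, -h.2) := by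
  rw [LinearIsometryEquiv.symm_apply_eq, reflectSnd_apply]
  simp

/-- The frame `Φ(t) S exp(-tH)`. -/
noncomputable def floquetFrame (Φ : ℝ → Matrix (Fin n) (Fin n) ℝ)
    (S : Matrix (Fin n) (Fin m ⊕ Fin d) ℝ) (H : Matrix (Fin m ⊕ Fin d) (Fin m ⊕ Fin d) ℝ) (t : ℝ) :
    Matrix (Fin n) (Fin m ⊕ Fin d) ℝ :=
  Φ t * S * NormedSpace.exp (t • -H)

/-- Over one period `Φ S` gains the factor `exp(T H₁) ⊕ (-exp(T H₂))`, and `exp(-tH)` gains its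
inverse up to the sign of the second block. -/
theorem floquetFrame_add_period {Φ : ℝ → Matrix (Fin n) (Fin n) ℝ}
    {S : Matrix (Fin n) (Fin m ⊕ Fin d) ℝ} {H₁ : Matrix (Fin m) (Fin m) ℝ}
    {H₂ : Matrix (Fin d) (Fin d) ℝ} {T : ℝ}
    (hΦS : ∀ t, Φ (t + T) * S = Φ t * S *
      Matrix.fromBlocks (NormedSpace.exp (T • H₁)) 0 0 (-NormedSpace.exp (T • H₂))) (t : ℝ) :
    floquetFrame Φ S (Matrix.fromBlocks H₁ 0 0 H₂) (t + T) =
      floquetFrame Φ S (Matrix.fromBlocks H₁ 0 0 H₂) t *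
        (Matrix.fromBlocks 1 0 0 (-1) : Matrix (Fin m ⊕ Fin d) (Fin m ⊕ Fin d) ℝ) := by
  have hexp : ∀ a : ℝ, NormedSpace.exp (a • -Matrix.fromBlocks H₁ 0 0 H₂) =
      Matrix.fromBlocks (NormedSpace.exp ((-a) • H₁)) 0 0 (NormedSpace.exp ((-a) • H₂)) := by
    intro a
    rw [← Matrix.exp_fromBlocks_diagonal, smul_neg, ← neg_smul, Matrix.fromBlocks_smul, smul_zero,
      smul_zero]
  rw [floquetFrame, floquetFrame, hΦS, Matrix.mul_assoc (Φ t * S), Matrix.mul_assoc (Φ t * S)]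
  congr 1
  simp only [hexp, Matrix.fromBlocks_multiply, Matrix.exp_smul_mul_exp_smul, Matrix.mul_zero,
    Matrix.zero_mul, add_zero, zero_add, Matrix.neg_mul, Matrix.mul_neg, Matrix.mul_one, neg_zero,
    show T + -(t + T) = -t by ring]

section Frame

variable {f : (Fin n → ℝ) → (Fin n → ℝ)} {D : Set (Fin n → ℝ)} {φ : ℝ → (Fin n → ℝ)} {r : ℕ∞}
  {Φ : ℝ → Matrix (Fin n) (Fin n) ℝ}

theorem contDiff_exp_smul {k : Type*} [Fintype k] [DecidableEq k] (A : Matrix k k ℝ) (hr : 1 ≤ r) :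
    ContDiff ℝ r fun t : ℝ => mulVecCLM (NormedSpace.exp (t • A)) := by
  rw [contDiff_clm_apply_iff]
  intro y
  exact contDiff_of_nat_succ_le (fun k _ => linear_ode_contDiff (A := fun _ => mulVecCLM A)
    contDiff_const (fun t => A.hasDerivAt_exp_smul_mulVec y t)) hr

theorem IsFundamentalMatrix.contDiff (hΦ : IsFundamentalMatrix (variationalMatrix f φ) Φ)
    (hD : IsOpen D) (hf : ContDiffOn ℝ r f D) (hφD : ∀ t, φ t ∈ D)
    (hφ : ∀ t, HasDerivAt φ (f (φ t)) t) (hr : 1 ≤ r) :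
    ContDiff ℝ r fun t => mulVecCLM (Φ t) := by
  rw [contDiff_clm_apply_iff]
  exact fun x => contDiff_variational_solution hD hf hφD hφ hr (hΦ.hasDerivAt_mulVec x)

theorem contDiff_floquetFrame (hΦ : ContDiff ℝ r fun t => mulVecCLM (Φ t)) (hr : 1 ≤ r)
    (S : Matrix (Fin n) (Fin m ⊕ Fin d) ℝ) (H : Matrix (Fin m ⊕ Fin d) (Fin m ⊕ Fin d) ℝ) :
    ContDiff ℝ r fun t => mulVecCLM (floquetFrame Φ S H t) := by
  have h : (fun t => mulVecCLM (floquetFrame Φ S H t)) = fun t =>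
      mulVecCLM (Φ t) ∘L (mulVecCLM S ∘L mulVecCLM (NormedSpace.exp (t • -H))) := by
    ext t x : 2
    simp [floquetFrame, Matrix.mul_assoc]
  rw [h]
  exact hΦ.clm_comp (contDiff_const.clm_comp (contDiff_exp_smul (-H) hr))

/-- Product rule, with `H` commuting with its exponentials. The term `-U H` is what makes the linear
part of the transformed system the constant matrix `H`. -/
theorem hasDerivAt_floquetFrame (hΦ : IsFundamentalMatrix (variationalMatrix f φ) Φ)
    (hΦd : ContDiff ℝ 1 fun t => mulVecCLM (Φ t))
    (S : Matrix (Fin n) (Fin m ⊕ Fin d) ℝ) (H : Matrix (Fin m ⊕ Fin d) (Fin m ⊕ Fin d) ℝ) (t : ℝ) :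
    HasDerivAt (fun t => mulVecCLM (floquetFrame Φ S H t))
      (fderiv ℝ f (φ t) ∘L mulVecCLM (floquetFrame Φ S H t) -
        mulVecCLM (floquetFrame Φ S H t) ∘L mulVecCLM H) t := by
  have h1 : HasDerivAt (fun t => mulVecCLM (Φ t)) (fderiv ℝ f (φ t) ∘L mulVecCLM (Φ t)) t :=
    hasDerivAt_of_forall_apply (hΦd.contDiffAt.differentiableAt (by simp))
      fun x => hΦ.hasDerivAt_mulVec x t
  refine hasDerivAt_of_forall_apply
    ((contDiff_floquetFrame hΦd le_rfl S H).contDiffAt.differentiableAt (by simp)) fun x => ?_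
  have h2 := h1.clm_apply ((mulVecCLM S).hasFDerivAt.comp_hasDerivAt t
    ((-H).hasDerivAt_exp_smul_mulVec x t))
  have hcomm : (-H) * NormedSpace.exp (t • -H) = NormedSpace.exp (t • -H) * -H := by
    have h3 : Commute (-H) (t • -H) := (Commute.refl (-H)).smul_right t
    exact h3.exp_right
  convert! h2 using 1
  · ext t : 1
    simp [floquetFrame, Matrix.mul_assoc]
  · simp only [Matrix.mulVec_mulVec, hcomm, mulVecCLM_apply, sub_apply,
      ContinuousLinearMap.comp_apply, Function.comp_apply, floquetFrame, Matrix.mul_neg,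
      Matrix.neg_mulVec, Matrix.mul_assoc]
    simp [sub_eq_add_neg, Matrix.mulVec_neg, Matrix.mul_assoc]

end Frame

end FloquetFrame

/-! ### The change of variables. -/

theorem theoremB (n : ℕ) (r : ℕ∞) (hr : 2 ≤ r)
    (D : Set (Fin n → ℝ)) (hD : IsOpen D)
    (f : (Fin n → ℝ) → (Fin n → ℝ)) (hf : ContDiffOn ℝ r f D)
    (φ : ℝ → (Fin n → ℝ)) (T : ℝ)
    (hφ : IsPeriodicOrbit f D φ T) (hyp : IsHyperbolicOrbit f D φ T)
    (d : ℕ) (hd : d = aIndex (variationalMatrix f φ) T) :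
    d + 1 ≤ n ∧
    ∃ (U : ℝ → Matrix (Fin n) (Fin (n - d - 1) ⊕ Fin d) ℝ)
      (H₁ : Matrix (Fin (n - d - 1)) (Fin (n - d - 1)) ℝ) (H₂ : Matrix (Fin d) (Fin d) ℝ)
      (L₀ : ℝ → (Fin (n - d - 1) → ℝ) → (Fin d → ℝ) → ℝ)
      (L₁ : ℝ → (Fin (n - d - 1) → ℝ) → (Fin d → ℝ) → (Fin (n - d - 1) → ℝ))
      (L₂ : ℝ → (Fin (n - d - 1) → ℝ) → (Fin d → ℝ) → (Fin d → ℝ))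
      (ε C : ℝ), 0 < ε ∧ 0 < C ∧
      -- `U(t + T) = U(t) [I ⊕ (-I)]`
      (∀ t, U (t + T) = U t * Matrix.fromBlocks 1 0 0 (-1)) ∧
      -- the coordinates are of class `C^r`, and regular and with values in `D` for `‖(v, w)‖ < ε`
      ContDiff ℝ r (orbitCoord φ U) ∧
      (∀ (s : ℝ) (v : Fin (n - d - 1) → ℝ) (w : Fin d → ℝ), ‖(v, w)‖ < ε →
        (fderiv ℝ (orbitCoord φ U) (s, v, w)).IsInvertible) ∧
      (∀ (s : ℝ) (v : Fin (n - d - 1) → ℝ) (w : Fin d → ℝ), ‖(v, w)‖ < ε →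
        orbitCoord φ U (s, v, w) ∈ D) ∧
      -- the eigenvalues, with multiplicity, for every Poincaré map of the orbit
      (∀ (s₀ : ℝ) (K : Submodule ℝ (Fin n → ℝ)) (P : K → K), IsPoincareMap f D φ T s₀ K P →
        DifferentiableAt ℝ P 0 ∧
        ((Matrix.fromBlocks H₁ 0 0 H₂).charpoly.aroots ℂ).map Complex.re =
          ((fderiv ℝ P 0 : K →ₗ[ℝ] K).charpoly.aroots ℂ).map fun μ => 1 / T * Real.log ‖μ‖) ∧
      -- the functions `L₀, L₁, L₂` vanish to second order on the orbit
      (∀ s, L₀ s 0 0 = 0 ∧ L₁ s 0 0 = 0 ∧ L₂ s 0 0 = 0) ∧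
      (∀ s : ℝ, HasFDerivAt (fun h : (Fin (n - d - 1) → ℝ) × (Fin d → ℝ) => L₀ s h.1 h.2)
        (0 : (Fin (n - d - 1) → ℝ) × (Fin d → ℝ) →L[ℝ] ℝ) 0) ∧
      (∀ s : ℝ, HasFDerivAt (fun h : (Fin (n - d - 1) → ℝ) × (Fin d → ℝ) => L₁ s h.1 h.2)
        (0 : (Fin (n - d - 1) → ℝ) × (Fin d → ℝ) →L[ℝ] (Fin (n - d - 1) → ℝ)) 0) ∧
      (∀ s : ℝ, HasFDerivAt (fun h : (Fin (n - d - 1) → ℝ) × (Fin d → ℝ) => L₂ s h.1 h.2)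
        (0 : (Fin (n - d - 1) → ℝ) × (Fin d → ℝ) →L[ℝ] (Fin d → ℝ)) 0) ∧
      -- their symmetries
      (∀ (s : ℝ) (v : Fin (n - d - 1) → ℝ) (w : Fin d → ℝ), ‖(v, w)‖ < ε →
        L₀ (s + T) v w = L₀ s v (-w) ∧ L₁ (s + T) v w = L₁ s v (-w) ∧
        L₂ (s + T) v w = -L₂ s v (-w)) ∧
      -- every perturbation `g`
      ∀ (I : Set ℝ) (g : ℝ → (Fin n → ℝ) → (Fin n → ℝ)),
        ContDiffOn ℝ r (Function.uncurry g) (I ×ˢ D) →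
        ∃ (M₀ : ℝ → ℝ → (Fin (n - d - 1) → ℝ) → (Fin d → ℝ) → ℝ)
          (M₁ : ℝ → ℝ → (Fin (n - d - 1) → ℝ) → (Fin d → ℝ) → (Fin (n - d - 1) → ℝ))
          (M₂ : ℝ → ℝ → (Fin (n - d - 1) → ℝ) → (Fin d → ℝ) → (Fin d → ℝ)),
          -- the change of variables transforms `z' = f(z) + g(t, z)` into the new system
          (∀ (J : Set ℝ) (c : ℝ → ℝ × (Fin (n - d - 1) → ℝ) × (Fin d → ℝ)),
            J ⊆ I → ContinuousOn c J → (∀ t ∈ J, ‖(c t).2‖ < ε) →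
            (IsIntegralCurveOn (fun t => orbitCoord φ U (c t)) (fun t z => f z + g t z) J ↔
              IsIntegralCurveOn c (fun t p =>
                (1 + L₀ p.1 p.2.1 p.2.2 + M₀ t p.1 p.2.1 p.2.2,
                  H₁ *ᵥ p.2.1 + L₁ p.1 p.2.1 p.2.2 + M₁ t p.1 p.2.1 p.2.2,
                  H₂ *ᵥ p.2.2 + L₂ p.1 p.2.1 p.2.2 + M₂ t p.1 p.2.1 p.2.2)) J)) ∧
          -- the symmetries of the terms coming from `g`
          (∀ t ∈ I, ∀ (s : ℝ) (v : Fin (n - d - 1) → ℝ) (w : Fin d → ℝ), ‖(v, w)‖ < ε →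
            M₀ t (s + T) v w = M₀ t s v (-w) ∧ M₁ t (s + T) v w = M₁ t s v (-w) ∧
            M₂ t (s + T) v w = -M₂ t s v (-w)) ∧
          -- the bound by `g`
          (∀ t ∈ I, ∀ (s : ℝ) (v : Fin (n - d - 1) → ℝ) (w : Fin d → ℝ), ‖(v, w)‖ < ε →
            ‖M₀ t s v w‖ ≤ C * ‖g t (orbitCoord φ U (s, v, w))‖ ∧
            ‖M₁ t s v w‖ ≤ C * ‖g t (orbitCoord φ U (s, v, w))‖ ∧
            ‖M₂ t s v w‖ ≤ C * ‖g t (orbitCoord φ U (s, v, w))‖) := by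
  have hr1 : 1 ≤ r := le_trans (by norm_num) hr
  have hf1 : ContDiffOn ℝ 1 f D := hf.of_le (by exact_mod_cast hr1)
  have hfl := hyp.exists_floquet hφ hD hf1
  rw [← hd] at hfl
  obtain ⟨m, Φ, H₁, H₂, S, hmn, hΦ, hinj, hΦS, hPoinc⟩ := hfl
  obtain rfl : m = n - d - 1 := by omega
  refine ⟨by omega, ?_⟩
  set H : Matrix (Fin (n - d - 1) ⊕ Fin d) (Fin (n - d - 1) ⊕ Fin d) ℝ :=
    Matrix.fromBlocks H₁ 0 0 H₂ with hH
  set U := floquetFrame Φ S H with hU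
  set X := orbitCoord φ U with hXdef
  let W : ℝ → PairSpace (n - d - 1) d →L[ℝ] (Fin n → ℝ) := fun s =>
    mulVecCLM (U s) ∘L (pairCLE (n - d - 1) d : PairSpace (n - d - 1) d →L[ℝ] (Fin (n - d - 1) ⊕ Fin d → ℝ))
  let HV : PairSpace (n - d - 1) d →L[ℝ] PairSpace (n - d - 1) d := (mulVecCLM H₁).prodMap (mulVecCLM H₂)
  have hHVa : ∀ h, HV h = (H₁ *ᵥ h.1, H₂ *ᵥ h.2) := fun _ => rfl
  have hHV : ∀ h : PairSpace (n - d - 1) d, mulVecCLM H (pairCLE _ _ h) = pairCLE _ _ (HV h) := fun h => by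
    simp [hH, pairCLE_apply, hHVa, Matrix.fromBlocks_mulVec]
  have hXW : X = fun p : ℝ × PairSpace (n - d - 1) d => φ p.1 + W p.1 p.2 := rfl
  have hΦr := hΦ.contDiff hD hf hφ.mem hφ.solution hr1
  have hφr : ContDiff ℝ r φ := contDiff_integralCurve hD hf hφ.mem hφ.solution hr1
  have hWr : ContDiff ℝ r W := (contDiff_floquetFrame hΦr hr1 S H).clm_comp contDiff_const
  have hXr : ContDiff ℝ r X := by
    rw [hXW]
    exact (hφr.comp contDiff_fst).add ((hWr.comp contDiff_fst).clm_apply contDiff_snd)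
  have hX1 : ContDiff ℝ 1 X := hXr.of_le (by exact_mod_cast hr1)
  have hWd : ∀ s, HasDerivAt W (fderiv ℝ f (φ s) ∘L W s - W s ∘L HV) s := fun s => by
    have h1 := hasDerivAt_floquetFrame hΦ (hΦr.of_le (by exact_mod_cast hr1)) S H s
    have h2 := h1.clm_comp (hasDerivAt_const s
      (pairCLE (n - d - 1) d : PairSpace (n - d - 1) d →L[ℝ] (Fin (n - d - 1) ⊕ Fin d → ℝ)))
    convert! h2 using 1
    refine ContinuousLinearMap.ext fun h => ?_
    have := congr_arg (mulVecCLM (U s)) (hHV h)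
    simp only [W, sub_apply, ContinuousLinearMap.comp_apply, ContinuousLinearEquiv.coe_coe] at this ⊢
    rw [← this]
    simp [hU]
  have hXd : ∀ s (h : PairSpace (n - d - 1) d), fderiv ℝ X (s, h) = (ContinuousLinearMap.toSpanSingleton ℝ
      (f (φ s) + (fderiv ℝ f (φ s) ∘L W s - W s ∘L HV) h)).coprod (W s) := fun s h => by
    rw [hXW]; exact (hasFDerivAt_tube h (hφ.solution s) (hWd s)).fderiv
  have hX0 : ∀ s, X (s, 0) = φ s := fun s => by simp [hXW]
  -- On the orbit the derivative has as columns the velocity and the frame; they are independent by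
  -- `hinj`, since `exp(-sH)` is invertible, and their number is `n`.
  have hinv : ∀ s, (fderiv ℝ X (s, (0 : PairSpace (n - d - 1) d))).IsInvertible := by
    intro s
    refine isInvertible_of_injective ?_ ?_
    · simp; omega
    · rw [injective_iff_map_eq_zero]
      rintro ⟨σ, h⟩ h0
      rw [hXd] at h0
      have h1 : σ • f (φ s) + Φ s *ᵥ (S *ᵥ (NormedSpace.exp (s • -H) *ᵥ pairCLE _ _ h)) = 0 := by
        simpa [W, hU, floquetFrame, Matrix.mul_assoc] using h0
      obtain ⟨h2, h3⟩ := hinj s σ _ h1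
      have h4 : NormedSpace.exp ((-s) • -H) *ᵥ (NormedSpace.exp (s • -H) *ᵥ pairCLE _ _ h) = 0 := by
        rw [h3, Matrix.mulVec_zero]
      rw [Matrix.mulVec_mulVec, Matrix.exp_smul_mul_exp_smul, neg_add_cancel, zero_smul,
        NormedSpace.exp_zero, Matrix.one_mulVec] at h4
      rw [h2, (pairCLE _ _).map_eq_zero_iff.1 h4]
      rfl
  have hUper : ∀ t, U (t + T) = U t * (Matrix.fromBlocks 1 0 0 (-1) :
      Matrix (Fin (n - d - 1) ⊕ Fin d) (Fin (n - d - 1) ⊕ Fin d) ℝ) := floquetFrame_add_period hΦS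
  set ι := reflectSnd (n - d - 1) d with hιdef
  have hι : ∀ s h, X (s + T, h) = X (s, ι h) := by
    intro s h
    simp [hXdef, orbitCoord, hUper, hφ.periodic s, ← Matrix.mulVec_mulVec,
      Matrix.fromBlocks_mulVec, hιdef, reflectSnd_apply, Matrix.neg_mulVec]
  obtain ⟨ε, C, hε, hC, htube⟩ := exists_tube hD hφ.pos hX1 (fun s => by rw [hX0]; exact hφ.mem s)
    hinv ι hι
  have hpull : ∀ (k : (Fin n → ℝ) → (Fin n → ℝ)) s (h : PairSpace (n - d - 1) d),
      (fderiv ℝ X (s + T, h)).inverse (k (X (s + T, h))) =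
        (tubeSymm ι).symm ((fderiv ℝ X (s, ι h)).inverse (k (X (s, ι h)))) := fun k s h => by
    rw [inverse_fderiv_add_period hι, hι]
  -- The pulled-back field minus its linear part; its components are `Λ₀`, `Λ₁`, `Λ₂`. Where the
  -- derivative of `X` is not invertible, `inverse` is `0`, which happens only outside the tube.
  let F : ℝ × PairSpace (n - d - 1) d → ℝ × PairSpace (n - d - 1) d := fun p => (fderiv ℝ X p).inverse (f (X p)) - (1, HV p.2)
  have hF0 : ∀ s, F (s, 0) = 0 := fun s => by
    have h1 : fderiv ℝ X (s, (0 : PairSpace (n - d - 1) d)) (1, 0) = f (φ s) := by simp [hXd]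
    simp only [F, hX0, ← h1, (hinv s).inverse_apply_self]
    simp
  have hFd : ∀ s, HasFDerivAt (fun h : PairSpace (n - d - 1) d => F (s, h)) (0 : PairSpace (n - d - 1) d →L[ℝ] ℝ × PairSpace (n - d - 1) d) 0 := fun s => by
    refine hasFDerivAt_zero_of_bound (C := C)
      ((hf1.contDiffAt (hD.mem_nhds (hφ.mem s))).differentiableAt (by simp)).hasFDerivAt (W s)
      (hF0 s) ?_
    filter_upwards [Metric.ball_mem_nhds (0 : PairSpace (n - d - 1) d) hε] with h hh
    obtain ⟨h1, -, h3⟩ := htube s h (mem_ball_zero_iff.1 hh)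
    -- The heart of the matter: `DX(s, h)` maps `(1, HV h)` to the first-order Taylor polynomial of
    -- `f` at `φ s`, so `F` is the pullback of the Taylor remainder and is bounded by `C` times it.
    have h4 : F (s, h) = (fderiv ℝ X (s, h)).inverse
        (f (φ s + W s h) - f (φ s) - fderiv ℝ f (φ s) (W s h)) := by
      have h5 : fderiv ℝ X (s, h) (1, HV h) = f (φ s) + fderiv ℝ f (φ s) (W s h) := by
        rw [hXd]; simp; abel
      rw [sub_sub, ← h5, map_sub, h1.inverse_apply_self]
      rfl
    rw [h4]
    exact h3 _
  have hFT : ∀ s h, F (s + T, h) = (tubeSymm ι).symm (F (s, ι h)) := fun s h => by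
    -- The linear part is invariant because `HV` is block diagonal and commutes with the reflection
    -- `ι`.
    have h1 : (tubeSymm ι).symm (1, HV (ι h)) = (1, HV h) := by
      simp [tubeSymm_symm_apply, hιdef, reflectSnd_symm_apply, reflectSnd_apply, hHVa,
        Matrix.mulVec_neg]
    simp only [F]
    rw [hpull f, map_sub, h1]
  refine ⟨U, H₁, H₂, fun s v w => (F (s, v, w)).1, fun s v w => (F (s, v, w)).2.1,
    fun s v w => (F (s, v, w)).2.2, ε, C, hε, hC, hUper, hXr, fun s v w h => (htube s _ h).1,
    fun s v w h => (htube s _ h).2.1, hPoinc, fun s => ?_, fun s => ?_, fun s => ?_, fun s => ?_,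
    fun s v w _ => ?_, fun I g _ => ?_⟩
  · have h0 := hF0 s
    exact ⟨congr_arg Prod.fst h0, congr_arg (fun p => p.2.1) h0, congr_arg (fun p => p.2.2) h0⟩
  · exact (hFd s).fst
  · exact (hFd s).snd.fst
  · exact (hFd s).snd.snd
  · have h1 := hFT s (v, w)
    rw [tubeSymm_symm_apply, hιdef, reflectSnd_symm_apply, reflectSnd_apply] at h1
    simp only [h1, and_self]
  let M : ℝ → ℝ × PairSpace (n - d - 1) d → ℝ × PairSpace (n - d - 1) d := fun t p => (fderiv ℝ X p).inverse (g t (X p))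
  refine ⟨fun t s v w => (M t (s, v, w)).1, fun t s v w => (M t (s, v, w)).2.1,
    fun t s v w => (M t (s, v, w)).2.2, fun J c _ hc hcε => ?_, fun t _ s v w _ => ?_,
    fun t _ s v w h => ?_⟩
  · rw [isIntegralCurveOn_comp_iff hX1 hc (fun t ht => (htube _ _ (hcε t ht)).1)]
    refine iff_of_eq (congr_arg (fun v => IsIntegralCurveOn c v J) ?_)
    funext t p
    have h1 : (fderiv ℝ X p).inverse (f (X p) + g t (X p)) = (1, HV p.2) + F p + M t p := by
      simp only [F, M, map_add]; abel
    rw [h1]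
    rfl
  · have h1 : M t (s + T, v, w) = _ := hpull (g t) s (v, w)
    rw [tubeSymm_symm_apply, hιdef, reflectSnd_symm_apply, reflectSnd_apply] at h1
    simp only [h1, and_self, M]
  · have h1 : ‖M t (s, v, w)‖ ≤ _ := (htube s _ h).2.2 (g t (X (s, v, w)))
    exact ⟨(norm_fst_le _).trans h1, ((norm_fst_le _).trans (norm_snd_le _)).trans h1,
      ((norm_snd_le _).trans (norm_snd_le _)).trans h1⟩
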